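/- Consider $n$ bosonic modes on the Fock space $\ell^2(\mathbb N^n)$, with annihilation and creation operators $a_j,a_j^\dagger$, and for $z\in\mathbb C^n$ put $a^\dagger(z)=\sum_j z_ja_j^\dagger$, $a(z)=\sum_j\bar z_ja_j$, $D(z)=e^{a^\dagger(z)-a(z)}$. A density operator $\rho$ has the characteristic function $\chi_\rho(z)=\mathrm{Tr}\,\rho D(z)$ and the Wigner function $$W_\rho(\alpha)=\frac1{\pi^{2n}}\int\chi_\rho(z)\,e^{\bar z\cdot\alpha-z\cdot\bar\alpha}\,d^{2n}z ,$$ where $u\cdot v=\sum_j u_jv_j$ and, if $\chi_\rho$ is not integrable, the integral is the limit as $\varepsilon\downarrow0$ of the integrals with the additional factor $e^{-\varepsilon|z|^2}$. Let $c\in\mathbb C^n$ with $\sum_j|c_j|^2=1$, let $\rho$ be a density operator, and let $$\rho_+=\mathcal N_+\,a^\dagger(c)\rho\,a(c),\quad \rho_-=\mathcal N_-\,a(c)\rho\,a^\dagger(c),\quad \mathcal N_+^{-1}=\mathrm{Tr}[a^\dagger(c)\rho\,a(c)],\quad \mathcal N_-^{-1}=\mathrm{Tr}[a(c)\rho\,a^\dagger(c)].$$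 In the case of $\rho_-$ assume that $\mathrm{Tr}[a(c)\rho\,a^\dagger(c)]\neq0$. Write $\chi,W$ and $\chi_\pm,W_\pm$ for the characteristic and Wigner functions of $\rho$ and $\rho_\pm$. (1) General mother state. If the trace that defines $\mathcal N_\pm$ is finite, then $\rho_\pm$ is a well-defined density operator, the limits defining $W$ and $W_\pm$ exist at every point, the directional derivatives below exist everywhere, and for all $z,\alpha\in\mathbb C^n$ $$\chi_\pm(z)=-\mathcal N_\pm\Big[c\cdot\Big(\partial_z\mp\frac{\bar z}2\Big)\Big]\Big[\bar c\cdot\Big(\partial_{\bar z}\mp\frac z2\Big)\Big]\chi(z),\qquad W_\pm(\alpha)=\mathcal N_\pm\Big[c\cdot\Big(\frac{\partial_\alpha}2\mp\bar\alpha\Big)\Big]\Big[\bar c\cdot\Big(\frac{\partial_{\bar\alpha}}2\mp\alpha\Big)\Big]W(\alpha).$$ Here $c\cdot\partial_z=\frac12(D_c-iD_{ic})$ and $\bar c\cdot\partial_{\bar z}=\frac12(D_c+iD_{ic})$ with $D_v$ the real directional derivative along $v$. (2) Gaussian mother state. Let $\hat r=(\hat x_1,\hat p_1,\dots,\hat x_n,\hat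 p_n)$ with $\hat x_j=(a_j+a_j^\dagger)/\sqrt2$, $\hat p_j=-i(a_j-a_j^\dagger)/\sqrt2$, let $d=\langle\hat r\rangle$ and $V_{ij}=\langle\{\hat r_i,\hat r_j\}\rangle-2\langle\hat r_i\rangle\langle\hat r_j\rangle$ be the displacement vector and covariance matrix of $\rho$, and let $$\Omega=\bigoplus_{j=1}^n\begin{pmatrix}0&1\\-1&0\end{pmatrix},\qquad U=\bigoplus_{j=1}^n\frac1{\sqrt2}\begin{pmatrix}1&i\\1&-i\end{pmatrix},\qquad m_c=U^\dagger(c_1,0,\dots,c_n,0)^T .$$ Suppose that $\rho$ is Gaussian: $\chi(z)=\exp\{-\frac12\xi^T\Omega V\Omega^T\xi-i\sqrt2(\Omega d)^T\xi\}=:\chi^G(z)$ for all $z$, where $\xi=(\mathrm{Re}\,z_1,\mathrm{Im}\,z_1,\dots,\mathrm{Re}\,z_n,\mathrm{Im}\,z_n)^T$; write $W^G=W$. Then the trace that defines $\mathcal N_\pm$ is finite, $V$ is invertible, $\chi^G$ and $\chi_\pm$ are integrable, and for all $z\in\mathbb C^n$, with $Z=(z_1,\bar z_1,\dots,z_n,\bar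 z_n)^T$, $$\chi_\pm(z)=\mathcal N_\pm\Big(\tfrac12\bar m_c^TVm_c\pm\tfrac12-\beta_\pm^Tm_c\,\bar m_c^T\beta_\pm\Big)\chi^G(z),\qquad \beta_\pm=\tfrac12(\Omega V\Omega\mp\mathbb I)U^\dagger Z-i\,\Omega d ;$$ and for all $r=(x_1,p_1,\dots,x_n,p_n)^T\in\mathbb R^{2n}$, with $\alpha_j=(x_j+ip_j)/\sqrt2$, $$W_\pm(\alpha)=\mathcal N_\pm\Big(M_\pm(V,c)+\lambda_\pm^Tm_c\,\bar m_c^T\lambda_\pm\Big)W^G(\alpha),$$ $$\lambda_\pm=(V^{-1}\pm\mathbb I)r-V^{-1}d,\qquad M_\pm(V,c)=\mp\tfrac12-\tfrac12\bar m_c^TV^{-1}m_c .$$ -/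

import Mathlib

open MeasureTheory Filter Topology
open scoped ComplexConjugate Kronecker Matrix ENNReal Nat

noncomputable section

namespace PhotonGaussian

/-! ### The `n`-mode Fock space -/

/-- The Hilbert space of `n` bosonic modes, `ℓ²(ℕⁿ)`; the coordinate `k` is the coefficient on the
number state `|k₁, …, kₙ⟩`. -/
abbrev FockSpace (n : ℕ) : Type := lp (fun _ : Fin n → ℕ => ℂ) 2

/-- The dense subspace of finite linear combinations of number states. -/
abbrev FiniteVectors (n : ℕ) : Type := (Fin n → ℕ) →₀ ℂ

variable {n : ℕ}

/-- The number state `|k₁, …, kₙ⟩` as a vector of the Fock space. -/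
def numberState (k : Fin n → ℕ) : FockSpace n := lp.single 2 k (1 : ℂ)

/-- The inclusion of the finite vectors in the Fock space. -/
def incl : FiniteVectors n →ₗ[ℂ] FockSpace n := Finsupp.linearCombination ℂ numberState

/-- The annihilation operator `a_j`: `a_j |k⟩ = √k_j |k - e_j⟩`. -/
def annih (j : Fin n) : Module.End ℂ (FiniteVectors n) :=
  Finsupp.linearCombination ℂ fun k : Fin n → ℕ =>
    Finsupp.single (Function.update k j (k j - 1)) ((Real.sqrt (k j) : ℝ) : ℂ)

/-- The creation operator `a_j†`: `a_j† |k⟩ = √(k_j + 1) |k + e_j⟩`. -/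
def creat (j : Fin n) : Module.End ℂ (FiniteVectors n) :=
  Finsupp.linearCombination ℂ fun k : Fin n → ℕ =>
    Finsupp.single (Function.update k j (k j + 1)) ((Real.sqrt (k j + 1) : ℝ) : ℂ)

/-- `a(z) = ∑ conj(z_j) a_j`. -/
def annihAt (z : Fin n → ℂ) : Module.End ℂ (FiniteVectors n) := ∑ j, conj (z j) • annih j

/-- `a†(z) = ∑ z_j a_j†`. -/
def creatAt (z : Fin n → ℂ) : Module.End ℂ (FiniteVectors n) := ∑ j, z j • creat j

/-- The displacement operator `D(z) = exp(a†(z) - a(z))` on finite vectors, by its exponential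
series (finite vectors are analytic vectors of the generator, so the series converges in norm). -/
def displacement (z : Fin n → ℂ) (v : FiniteVectors n) : FockSpace n :=
  ∑' m : ℕ, ((m ! : ℂ)⁻¹) • incl (((creatAt z - annihAt z) ^ m) v)

/-! ### States, characteristic functions and Wigner functions -/

/-- Density operators: positive operators of trace one. -/
structure IsDensityOperator (ρ : FockSpace n →L[ℂ] FockSpace n) : Prop where
  pos : ρ.IsPositive
  trace_one : HasSum (fun k : Fin n → ℕ => inner ℂ (numberState k) (ρ (numberState k))) 1

/-- The characteristic function `χ(z) = Tr (ρ D(z))`, the trace being taken in the number basis. -/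
def charFn (ρ : FockSpace n →L[ℂ] FockSpace n) (z : Fin n → ℂ) : ℂ :=
  ∑' k : Fin n → ℕ, inner ℂ (numberState k) (ρ (displacement z (Finsupp.single k 1)))

/-- The phase `exp(conj(z)·α - z·conj(α))`. -/
def phase (α z : Fin n → ℂ) : ℂ :=
  Complex.exp (∑ j, (conj (z j) * α j - z j * conj (α j)))

/-- The Fourier integral `(π²)⁻ⁿ ∫ χ(z) exp(conj(z)·α - z·conj(α)) d²ⁿz` with the convergence factor
`exp(-ε|z|²)`. -/
def regFourier (χ : (Fin n → ℂ) → ℂ) (ε : ℝ) (α : Fin n → ℂ) : ℂ :=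
  (((Real.pi ^ 2) ^ n : ℝ) : ℂ)⁻¹ *
    ∫ z : Fin n → ℂ, ((Real.exp (-ε * ∑ j, ‖z j‖ ^ 2) : ℝ) : ℂ) * (χ z * phase α z)

/-- The Wigner function of the state `ρ`: the Fourier transform of its characteristic function `χ`.
For a general state `χ` is bounded and square integrable but need not be integrable, and the
Fourier integral is understood as the limit of the integrals with the convergence factor
`exp(-ε|z|²)` as `ε ↓ 0`; if `χ` is integrable it is the ordinary integral, see
`wigner_eq_integral`. -/
def wigner (ρ : FockSpace n →L[ℂ] FockSpace n) (α : Fin n → ℂ) : ℂ :=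
  limUnder (𝓝[>] (0 : ℝ)) fun ε => regFourier (charFn ρ) ε α

theorem norm_phase (α z : Fin n → ℂ) : ‖phase α z‖ = 1 := by
  rw [phase, Complex.norm_exp]
  have h : (∑ j, (conj (z j) * α j - z j * conj (α j))).re = 0 := by
    rw [Complex.re_sum]
    refine Finset.sum_eq_zero fun j _ => ?_
    simp [Complex.mul_re]
  rw [h, Real.exp_zero]

theorem continuous_phase (α : Fin n → ℂ) : Continuous (phase α) := by
  unfold phase
  fun_prop

/-- If the characteristic function is integrable, the Wigner function is given by the ordinary
Fourier integral. -/
theorem wigner_eq_integral (ρ : FockSpace n →L[ℂ] FockSpace n) (h : Integrable (charFn ρ))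
    (α : Fin n → ℂ) :
    wigner ρ α = (((Real.pi ^ 2) ^ n : ℝ) : ℂ)⁻¹ * ∫ z : Fin n → ℂ, charFn ρ z * phase α z := by
  refine Tendsto.limUnder_eq (Tendsto.const_mul _ ?_)
  refine tendsto_integral_filter_of_dominated_convergence (fun z => ‖charFn ρ z‖) ?_ ?_ h.norm ?_
  · refine Eventually.of_forall fun ε => ?_
    refine AEStronglyMeasurable.mul ?_
      (h.aestronglyMeasurable.mul (continuous_phase α).aestronglyMeasurable)
    exact Continuous.aestronglyMeasurable (by fun_prop)
  · filter_upwards [self_mem_nhdsWithin] with ε hε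
    refine Eventually.of_forall fun z => ?_
    have h0 : 0 ≤ ∑ j, ‖z j‖ ^ 2 := Finset.sum_nonneg fun j _ => sq_nonneg _
    have h1 : Real.exp (-ε * ∑ j, ‖z j‖ ^ 2) ≤ 1 := by
      rw [Real.exp_le_one_iff]
      have hε' : 0 < ε := hε
      nlinarith
    rw [norm_mul, norm_mul, norm_phase, mul_one, Complex.norm_real, Real.norm_eq_abs,
      abs_of_pos (Real.exp_pos _)]
    exact mul_le_of_le_one_left (norm_nonneg _) h1
  · refine Eventually.of_forall fun z => ?_
    have hc : Continuous fun ε : ℝ =>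
        ((Real.exp (-ε * ∑ j, ‖z j‖ ^ 2) : ℝ) : ℂ) * (charFn ρ z * phase α z) := by fun_prop
    have := (hc.tendsto 0).mono_left (nhdsWithin_le_nhds (s := Set.Ioi 0))
    simpa using this

/-! ### Photon addition and subtraction -/

/-- The two processes; addition goes with the upper signs, subtraction with the lower ones. -/
inductive PhotonProcess
  | addition
  | subtraction

/-- The upper or lower sign of `±`. -/
def PhotonProcess.sign : PhotonProcess → ℂ
  | .addition => 1
  | .subtraction => -1

/-- The adjoint of the operator that acts on state vectors: a state `ρ` becomes
`a†(c) ρ a(c)` under addition and `a(c) ρ a†(c)` under subtraction; this is the right-hand factor. -/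
def PhotonProcess.rightOp (s : PhotonProcess) (c : Fin n → ℂ) : Module.End ℂ (FiniteVectors n) :=
  match s with
  | .addition => annihAt c
  | .subtraction => creatAt c

/-- `Tr [a†(c) ρ a(c)]`, respectively `Tr [a(c) ρ a†(c)]`, a number in `[0, ∞]`. -/
def processTrace (s : PhotonProcess) (c : Fin n → ℂ) (ρ : FockSpace n →L[ℂ] FockSpace n) : ℝ≥0∞ :=
  ∑' k : Fin n → ℕ, ENNReal.ofReal (inner ℂ
    (incl (s.rightOp c (Finsupp.single k 1))) (ρ (incl (s.rightOp c (Finsupp.single k 1))))).re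

/-- The normalization constant `𝒩_±`, the inverse of the trace. -/
def normConst (s : PhotonProcess) (c : Fin n → ℂ) (ρ : FockSpace n →L[ℂ] FockSpace n) : ℝ :=
  (processTrace s c ρ).toReal⁻¹

/-- `σ = 𝒩_+ a†(c) ρ a(c)`, respectively `σ = 𝒩_- a(c) ρ a†(c)`. Both sides are compared through
their matrix elements between finite vectors, which determine a bounded operator. -/
def IsProcessed (s : PhotonProcess) (c : Fin n → ℂ) (ρ σ : FockSpace n →L[ℂ] FockSpace n) : Prop :=
  ∀ u v : FiniteVectors n, inner ℂ (incl u) (σ (incl v)) =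
    normConst s c ρ * inner ℂ (incl (s.rightOp c u)) (ρ (incl (s.rightOp c v)))

/-! ### Differential operators in the complex variables -/

/-- `c·∂_z f = ½ (D_c f - i D_{ic} f)`, with `D` the real directional derivative. -/
def dz (c : Fin n → ℂ) (f : (Fin n → ℂ) → ℂ) (z : Fin n → ℂ) : ℂ :=
  (lineDeriv ℝ f z c - Complex.I * lineDeriv ℝ f z (Complex.I • c)) / 2

/-- `conj(c)·∂_{conj z} f = ½ (D_c f + i D_{ic} f)`. -/
def dzbar (c : Fin n → ℂ) (f : (Fin n → ℂ) → ℂ) (z : Fin n → ℂ) : ℂ :=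
  (lineDeriv ℝ f z c + Complex.I * lineDeriv ℝ f z (Complex.I • c)) / 2

/-- The directional derivatives that enter `c·∂_z` and `conj(c)·∂_{conj z}` exist everywhere. -/
def DirDifferentiable (c : Fin n → ℂ) (f : (Fin n → ℂ) → ℂ) : Prop :=
  ∀ z, LineDifferentiableAt ℝ f z c ∧ LineDifferentiableAt ℝ f z (Complex.I • c)

theorem lineDeriv_eq_sum {f : (Fin n → ℂ) → ℂ} {z : Fin n → ℂ} (h : DifferentiableAt ℝ f z)
    (c : Fin n → ℂ) :
    lineDeriv ℝ f z c = ∑ j, (((c j).re : ℂ) * lineDeriv ℝ f z (Pi.single j 1) +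
      ((c j).im : ℂ) * lineDeriv ℝ f z (Complex.I • Pi.single j 1)) := by
  have hc : c = ∑ j, ((c j).re • (Pi.single j 1 : Fin n → ℂ) +
      (c j).im • (Complex.I • (Pi.single j 1 : Fin n → ℂ))) := by
    ext i
    simp [Finset.sum_apply, Pi.single_apply, Finset.sum_add_distrib, mul_comm Complex.I,
      Complex.re_add_im]
  simp only [h.lineDeriv_eq_fderiv]
  conv_lhs => rw [hc]
  simp [map_sum]

/-- For a real-differentiable `f`, `c·∂_z f = ∑ c_j ∂_{z_j} f`. -/
theorem dz_eq_sum {f : (Fin n → ℂ) → ℂ} {z : Fin n → ℂ} (h : DifferentiableAt ℝ f z)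
    (c : Fin n → ℂ) : dz c f z = ∑ j, c j * dz (Pi.single j 1) f z := by
  unfold dz
  rw [lineDeriv_eq_sum h c, lineDeriv_eq_sum h (Complex.I • c), Finset.mul_sum,
    ← Finset.sum_sub_distrib, Finset.sum_div]
  refine Finset.sum_congr rfl fun j _ => ?_
  conv_rhs => rw [← Complex.re_add_im (c j)]
  simp only [Pi.smul_apply, smul_eq_mul, Complex.I_mul_re, Complex.I_mul_im, Complex.ofReal_neg]
  ring_nf
  simp only [Complex.I_sq]
  ring

/-- For a real-differentiable `f`, `conj(c)·∂_{conj z} f = ∑ conj(c_j) ∂_{conj z_j} f`. -/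
theorem dzbar_eq_sum {f : (Fin n → ℂ) → ℂ} {z : Fin n → ℂ} (h : DifferentiableAt ℝ f z)
    (c : Fin n → ℂ) : dzbar c f z = ∑ j, conj (c j) * dzbar (Pi.single j 1) f z := by
  unfold dzbar
  rw [lineDeriv_eq_sum h c, lineDeriv_eq_sum h (Complex.I • c), Finset.mul_sum,
    ← Finset.sum_add_distrib, Finset.sum_div]
  refine Finset.sum_congr rfl fun j _ => ?_
  have hj : conj (c j) = ((c j).re : ℂ) - (c j).im * Complex.I := by
    apply Complex.ext <;> simp
  rw [hj]
  simp only [Pi.smul_apply, smul_eq_mul, Complex.I_mul_re, Complex.I_mul_im, Complex.ofReal_neg]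
  ring_nf
  simp only [Complex.I_sq]
  ring

/-- `c·(∂_z ∓ conj(z)/2)`. -/
def charOp (s : PhotonProcess) (c : Fin n → ℂ) (f : (Fin n → ℂ) → ℂ) (z : Fin n → ℂ) : ℂ :=
  dz c f z - s.sign * ((∑ j, c j * conj (z j)) / 2) * f z

/-- `conj(c)·(∂_{conj z} ∓ z/2)`. -/
def charOpBar (s : PhotonProcess) (c : Fin n → ℂ) (f : (Fin n → ℂ) → ℂ) (z : Fin n → ℂ) : ℂ :=
  dzbar c f z - s.sign * ((∑ j, conj (c j) * z j) / 2) * f z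

/-- `c·(∂_α/2 ∓ conj(α))`. -/
def wignerOp (s : PhotonProcess) (c : Fin n → ℂ) (f : (Fin n → ℂ) → ℂ) (α : Fin n → ℂ) : ℂ :=
  dz c f α / 2 - s.sign * (∑ j, c j * conj (α j)) * f α

/-- `conj(c)·(∂_{conj α}/2 ∓ α)`. -/
def wignerOpBar (s : PhotonProcess) (c : Fin n → ℂ) (f : (Fin n → ℂ) → ℂ) (α : Fin n → ℂ) : ℂ :=
  dzbar c f α / 2 - s.sign * (∑ j, conj (c j) * α j) * f α

/-! ### Gaussian states

Vectors of `ℝ²ⁿ` are indexed by `Fin n × Fin 2`: the index `(j, 0)` belongs to the position and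
`(j, 1)` to the momentum of mode `j`. -/

/-- The index set of the coordinates `x₁, p₁, …, xₙ, pₙ`. -/
abbrev Quad (n : ℕ) : Type := Fin n × Fin 2

/-- The quadratures `x_j = (a_j + a_j†)/√2` and `p_j = -i (a_j - a_j†)/√2`. -/
def quadrature (q : Quad n) : Module.End ℂ (FiniteVectors n) :=
  if q.2 = 0 then ((Real.sqrt 2 : ℝ) : ℂ)⁻¹ • (annih q.1 + creat q.1)
  else (-Complex.I * ((Real.sqrt 2 : ℝ) : ℂ)⁻¹) • (annih q.1 - creat q.1)

/-- The expectation `⟨A⟩ = Tr (ρ A)`. -/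
def expect (ρ : FockSpace n →L[ℂ] FockSpace n) (A : Module.End ℂ (FiniteVectors n)) : ℂ :=
  ∑' k : Fin n → ℕ, inner ℂ (numberState k) (ρ (incl (A (Finsupp.single k 1))))

/-- The displacement vector `d = ⟨r⟩`. -/
def displacementVector (ρ : FockSpace n →L[ℂ] FockSpace n) (i : Quad n) : ℝ :=
  (expect ρ (quadrature i)).re

/-- The covariance matrix `V_{ij} = ⟨{r_i, r_j}⟩ - 2⟨r_i⟩⟨r_j⟩`. -/
def covarianceMatrix (ρ : FockSpace n →L[ℂ] FockSpace n) : Matrix (Quad n) (Quad n) ℝ :=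
  Matrix.of fun i j =>
    (expect ρ (quadrature i * quadrature j + quadrature j * quadrature i)).re -
      2 * displacementVector ρ i * displacementVector ρ j

/-- `Ω = ⨁ (0 1; -1 0)`. -/
def Omega (n : ℕ) : Matrix (Quad n) (Quad n) ℝ :=
  (1 : Matrix (Fin n) (Fin n) ℝ) ⊗ₖ !![0, 1; -1, 0]

/-- The unitary matrix `U = ⨁ u` with `u = (1 i; 1 -i)/√2`. -/
def Umat (n : ℕ) : Matrix (Quad n) (Quad n) ℂ :=
  (1 : Matrix (Fin n) (Fin n) ℂ) ⊗ₖ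
    (((Real.sqrt 2 : ℝ) : ℂ)⁻¹ • !![1, Complex.I; 1, -Complex.I])

/-- The real vector `ξ` of `z`: `z_j = ξ_{j1} + i ξ_{j2}`. -/
def realVec (z : Fin n → ℂ) (q : Quad n) : ℝ := if q.2 = 0 then (z q.1).re else (z q.1).im

/-- The Gaussian `exp(-½ ξᵀ Ω V Ωᵀ ξ - i√2 (Ω d)ᵀ ξ)`. -/
def gaussianChar (V : Matrix (Quad n) (Quad n) ℝ) (d : Quad n → ℝ) (z : Fin n → ℂ) : ℂ :=
  Complex.exp
    (((-(1 / 2) * (realVec z ⬝ᵥ ((Omega n * V * (Omega n)ᵀ) *ᵥ realVec z)) : ℝ) : ℂ) -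
      Complex.I * ((Real.sqrt 2 * ((Omega n *ᵥ d) ⬝ᵥ realVec z) : ℝ) : ℂ))

/-- Gaussian states: the characteristic function is the Gaussian determined by the covariance
matrix and the displacement vector of the state. -/
def IsGaussian (ρ : FockSpace n →L[ℂ] FockSpace n) : Prop :=
  ∀ z, charFn ρ z = gaussianChar (covarianceMatrix ρ) (displacementVector ρ) z

/-- `m_c = U† (c₁, 0, …, cₙ, 0)ᵀ`. -/
def mVec (c : Fin n → ℂ) : Quad n → ℂ :=
  (Umat n)ᴴ *ᵥ fun q => if q.2 = 0 then c q.1 else 0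

/-- The entrywise complex conjugate of `m_c`. -/
def mVecBar (c : Fin n → ℂ) : Quad n → ℂ := fun q => conj (mVec c q)

/-- `Z = (z₁, conj z₁, …, zₙ, conj zₙ)ᵀ`. -/
def Zvec (z : Fin n → ℂ) : Quad n → ℂ := fun q => if q.2 = 0 then z q.1 else conj (z q.1)

/-- A real matrix as a complex one. -/
def toC (A : Matrix (Quad n) (Quad n) ℝ) : Matrix (Quad n) (Quad n) ℂ := A.map Complex.ofReal

/-- `β_± = ½ (Ω V Ω ∓ 1) U† Z - i Ω d`. -/
def betaVec (s : PhotonProcess) (V : Matrix (Quad n) (Quad n) ℝ) (d : Quad n → ℝ)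
    (z : Fin n → ℂ) : Quad n → ℂ :=
  (1 / 2 : ℂ) • ((toC (Omega n * V * Omega n) - s.sign • 1) *ᵥ ((Umat n)ᴴ *ᵥ Zvec z)) -
    Complex.I • fun q => (((Omega n *ᵥ d) q : ℝ) : ℂ)

/-- `½ m̄_cᵀ V m_c ± ½ - β_±ᵀ m_c m̄_cᵀ β_±`. -/
def charFactor (s : PhotonProcess) (c : Fin n → ℂ) (V : Matrix (Quad n) (Quad n) ℝ)
    (d : Quad n → ℝ) (z : Fin n → ℂ) : ℂ :=
  (1 / 2) * (mVecBar c ⬝ᵥ (toC V *ᵥ mVec c)) + s.sign * (1 / 2) -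
    (betaVec s V d z ⬝ᵥ mVec c) * (mVecBar c ⬝ᵥ betaVec s V d z)

/-- `λ_± = (V⁻¹ ± 1) r - V⁻¹ d`. -/
def lambdaVec (s : PhotonProcess) (V : Matrix (Quad n) (Quad n) ℝ) (d r : Quad n → ℝ) :
    Quad n → ℂ :=
  (toC V⁻¹ + s.sign • 1) *ᵥ (fun q => (r q : ℂ)) - toC V⁻¹ *ᵥ (fun q => (d q : ℂ))

/-- `M_±(V, c) = ∓½ - ½ m̄_cᵀ V⁻¹ m_c`. -/
def Mconst (s : PhotonProcess) (c : Fin n → ℂ) (V : Matrix (Quad n) (Quad n) ℝ) : ℂ :=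
  -(s.sign * (1 / 2)) - (1 / 2) * (mVecBar c ⬝ᵥ (toC V⁻¹ *ᵥ mVec c))

/-- `M_±(V, c) + λ_±ᵀ m_c m̄_cᵀ λ_±`. -/
def wignerFactor (s : PhotonProcess) (c : Fin n → ℂ) (V : Matrix (Quad n) (Quad n) ℝ)
    (d r : Quad n → ℝ) : ℂ :=
  Mconst s c V + (lambdaVec s V d r ⬝ᵥ mVec c) * (mVecBar c ⬝ᵥ lambdaVec s V d r)

/-- The phase-space point `α_j = (x_j + i p_j)/√2` of `r = (x₁, p₁, …, xₙ, pₙ)`. -/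
def alphaOf (r : Quad n → ℝ) (j : Fin n) : ℂ :=
  ((Real.sqrt 2 : ℝ) : ℂ)⁻¹ * ((r (j, 0) : ℂ) + Complex.I * (r (j, 1) : ℂ))

end PhotonGaussian

end

noncomputable section

namespace PhotonGaussian

variable {n : ℕ}

/-! ### Coordinates of the Fock space -/

/-! Everything is reduced to matrix coefficients of the displacement operators. Write `ρ` as a sum
of rank-one operators `|ψ_l⟩⟨ψ_l|` with `∑ ‖ψ_l‖² < ∞` (`IsDensityOperator.exists_mixture`). Then
`χ(z) = ∑ ⟨ψ_l, D(z) ψ_l⟩`. By the Weyl relation, moving `z` along `w` multiplies `D(z)` by `D(tw)`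
on the right or on the left, up to a scalar phase. A directional derivative can therefore be charged
to either vector of the coefficient. The combinations `∂_z` and `∂_{conj z}` of the derivatives
along `c` and `ic` isolate `a†(c)` or `a(c)`, and the multiplication terms `∓ conj(z)/2`, `∓ z/2`
cancel the derivative of the phase. One of the two operators of the theorem is charged to the left
vector and the other to the right one (`charOp_charOpBar_matCoeff`), so no vector is hit twice by a
ladder operator. Hence only the images `a†(c)ψ_l`, `a(c)ψ_l` have to exist with summable squared
norms. That follows from the finite trace together with `‖a†(c)ψ‖² = ‖a(c)ψ‖² + |c|²‖ψ‖²`. The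
Wigner function is a matrix coefficient too. The operator `∫ exp(-ε|z|²) D(z)` is diagonal in the
number basis, with eigenvalues proportional to the powers of `(ε - 1/2)/(ε + 1/2)`. As `ε ↓ 0` this
ratio tends to `-1`, and the parity operator `Π` appears. The phase in the Fourier integral is a
conjugation by `D(α)`, and so `W(α)` is a constant times `∑ ⟨ψ_l, D(2α) Π ψ_l⟩`
(`Mixture.wigner_eq`). The same calculus applies after the rescaling `z = 2α`; since `Π`
anticommutes with the ladder operators, the sign in front of the formula changes. For a Gaussian
state, `χ` never vanishes. If `|χ(z)| = 1` at some `z ≠ 0`, every `ψ_l` would be an eigenvector of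
`D(z)` with a common eigenvalue, and the Weyl relations would force a zero of `χ`. So `|χ| < 1` off
the origin, which makes `V` positive definite (`norm_charFn_lt_one`,
`Mixture.posDef_covarianceMatrix`). The bound `1 - Re χ(tv) = O(t²)` gives finite second moments,
hence a finite trace. What remains is to differentiate a Gaussian, done once for both functions in
`dz_gamma_mul_quadExp`, and to compute the Gaussian Fourier integral up to a constant factor, which
is enough because both sides are proportional to `W`. -/

theorem inner_numberState_left (k : Fin n → ℕ) (ψ : FockSpace n) :
    inner ℂ (numberState k) ψ = ψ k := by
  simp [numberState, lp.inner_single_left]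

theorem inner_numberState_right (k : Fin n → ℕ) (ψ : FockSpace n) :
    inner ℂ ψ (numberState k) = conj (ψ k) := by
  rw [← inner_conj_symm, inner_numberState_left]

theorem numberState_apply (k l : Fin n → ℕ) :
    (numberState k : FockSpace n) l = if l = k then 1 else 0 := by
  unfold numberState
  rw [lp.single_apply, Pi.single_apply]

theorem norm_numberState (k : Fin n → ℕ) : ‖(numberState k : FockSpace n)‖ = 1 := by
  simp [numberState, lp.norm_single]

/-- The number basis. -/
def numberBasis : HilbertBasis (Fin n → ℕ) ℂ (FockSpace n) :=
  HilbertBasis.ofRepr (LinearIsometryEquiv.refl ℂ _)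

theorem numberBasis_apply (k : Fin n → ℕ) : numberBasis k = numberState k := by
  have h := (numberBasis (n := n)).repr_symm_single k
  rw [← h]
  rfl

theorem fock_ext {η ψ : FockSpace n}
    (h : ∀ k, inner ℂ (numberState k) η = inner ℂ (numberState k) ψ) : η = ψ := by
  ext k
  simpa [inner_numberState_left] using h k

theorem clm_ext {E : Type*} [NormedAddCommGroup E] [NormedSpace ℂ E]
    {A B : FockSpace n →L[ℂ] E} (h : ∀ k, A (numberState k) = B (numberState k)) : A = B := by
  refine ContinuousLinearMap.ext_on (s := Set.range (numberBasis (n := n))) ?_ ?_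
  · rw [dense_iff_closure_eq, ← Submodule.topologicalClosure_coe, HilbertBasis.dense_span]
    rfl
  · rintro _ ⟨k, rfl⟩
    rw [numberBasis_apply]
    exact h k

theorem hasSum_norm_sq (ψ : FockSpace n) : HasSum (fun k => ‖ψ k‖ ^ 2) (‖ψ‖ ^ 2) := by
  have h := lp.hasSum_norm (p := 2) (by norm_num) ψ
  simpa using h

theorem hasSum_inner_mul_inner (η ψ : FockSpace n) :
    HasSum (fun k => inner ℂ η (numberState k) * inner ℂ (numberState k) ψ) (inner ℂ η ψ) := by
  simpa [numberBasis_apply] using (numberBasis (n := n)).hasSum_inner_mul_inner η ψ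

@[simp]
theorem incl_single (k : Fin n → ℕ) (a : ℂ) :
    incl (Finsupp.single k a) = a • numberState k := by
  simp [incl]

theorem incl_apply (v : FiniteVectors n) (k : Fin n → ℕ) : incl v k = v k := by
  induction v using Finsupp.induction_linear with
  | zero => simp
  | add u v hu hv => simp [hu, hv]
  | single l a =>
    simp only [incl_single, lp.coeFn_smul, Pi.smul_apply, numberState_apply, smul_eq_mul,
      Finsupp.single_apply, mul_ite, mul_one, mul_zero]
    simp only [eq_comm]

theorem denseRange_incl : DenseRange (incl (n := n)) := by
  have h := (numberBasis (n := n)).dense_span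
  have h2 : Submodule.span ℂ (Set.range (numberBasis (n := n))) ≤ LinearMap.range incl := by
    rw [Submodule.span_le]
    rintro _ ⟨k, rfl⟩
    exact ⟨Finsupp.single k 1, by simp [numberBasis_apply]⟩
  have h3 : (LinearMap.range (incl (n := n))).topologicalClosure = ⊤ :=
    top_le_iff.mp (h ▸ Submodule.topologicalClosure_mono h2)
  intro x
  have : x ∈ (LinearMap.range (incl (n := n))).topologicalClosure := by rw [h3]; trivial
  exact this

/-! ### Ladder operators -/

theorem annih_single (j : Fin n) (k : Fin n → ℕ) (a : ℂ) :
    annih j (Finsupp.single k a) =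
      Finsupp.single (Function.update k j (k j - 1)) (a * ((Real.sqrt (k j) : ℝ) : ℂ)) := by
  simp [annih]

theorem creat_single (j : Fin n) (k : Fin n → ℕ) (a : ℂ) :
    creat j (Finsupp.single k a) =
      Finsupp.single (Function.update k j (k j + 1)) (a * ((Real.sqrt (k j + 1) : ℝ) : ℂ)) := by
  simp [creat]

/-- The hypothesis guards against truncated subtraction: if `l j = 0`, lowering leaves `l`
unchanged, while no raised index equals `l`. -/
theorem update_eq_update_iff {k l : Fin n → ℕ} {j : Fin n} (hl : l j ≠ 0) :
    Function.update k j (k j + 1) = l ↔ k = Function.update l j (l j - 1) := by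
  constructor
  · rintro rfl
    simp
  · rintro rfl
    simp [Nat.sub_add_cancel (Nat.one_le_iff_ne_zero.mpr hl)]

theorem inner_creat_left (j : Fin n) (u v : FiniteVectors n) :
    inner ℂ (incl (creat j u)) (incl v) = inner ℂ (incl u) (incl (annih j v)) := by
  induction u using Finsupp.induction_linear with
  | zero => simp
  | add u u' hu hu' => simp only [map_add, inner_add_left, hu, hu']
  | single k a =>
    induction v using Finsupp.induction_linear with
    | zero => simp
    | add v v' hv hv' => simp only [map_add, inner_add_right, hv, hv']
    | single l b =>
      rw [creat_single, annih_single]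
      simp only [incl_single, inner_smul_left, inner_smul_right, inner_numberState_left,
        numberState_apply, map_mul, Complex.conj_ofReal]
      -- If `l j = 0`, both sides vanish: a raised number state is never `l`, and the annihilation
      -- coefficient is `√0`.
      by_cases hl : l j = 0
      · have : ¬ Function.update k j (k j + 1) = l := by
          rintro rfl
          simp at hl
        rw [if_neg this]
        simp [hl]
      · simp only [update_eq_update_iff hl]
        split_ifs with h
        · have hk : k j + 1 = l j := by
            rw [h]; simp; omega
          have hk' : ((k j : ℝ) + 1) = l j := by exact_mod_cast hk
          rw [hk']
          ring
        · simp

theorem inner_creatAt_left (z : Fin n → ℂ) (u v : FiniteVectors n) :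
    inner ℂ (incl (creatAt z u)) (incl v) = inner ℂ (incl u) (incl (annihAt z v)) := by
  simp only [creatAt, annihAt, LinearMap.sum_apply, LinearMap.smul_apply, map_sum, map_smul,
    sum_inner, inner_sum, inner_smul_left, inner_smul_right, inner_creat_left]

theorem inner_annihAt_left (z : Fin n → ℂ) (u v : FiniteVectors n) :
    inner ℂ (incl (annihAt z u)) (incl v) = inner ℂ (incl u) (incl (creatAt z v)) := by
  rw [← inner_conj_symm, ← inner_creatAt_left, inner_conj_symm]

theorem sqrt_mul_sqrt_cast (m : ℕ) :
    ((Real.sqrt m : ℝ) : ℂ) * ((Real.sqrt m : ℝ) : ℂ) = m := by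
  rw [← Complex.ofReal_mul, Real.mul_self_sqrt (Nat.cast_nonneg m)]
  simp

theorem sqrt_mul_sqrt_cast_succ (m : ℕ) :
    ((Real.sqrt (m + 1) : ℝ) : ℂ) * ((Real.sqrt (m + 1) : ℝ) : ℂ) = m + 1 := by
  simpa using sqrt_mul_sqrt_cast (m + 1)

theorem creat_mul_creat (i j : Fin n) : creat i * creat j = creat j * creat i := by
  refine Finsupp.lhom_ext fun k a => ?_
  rcases eq_or_ne i j with rfl | h
  · rfl
  · simp only [Module.End.mul_apply, creat_single, Function.update_of_ne h,
      Function.update_of_ne h.symm, Function.update_comm h]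
    ring_nf

theorem annih_mul_annih (i j : Fin n) : annih i * annih j = annih j * annih i := by
  refine Finsupp.lhom_ext fun k a => ?_
  rcases eq_or_ne i j with rfl | h
  · rfl
  · simp only [Module.End.mul_apply, annih_single, Function.update_of_ne h,
      Function.update_of_ne h.symm, Function.update_comm h]
    ring_nf

theorem annih_mul_creat (i j : Fin n) :
    annih i * creat j = creat j * annih i + if i = j then 1 else 0 := by
  refine Finsupp.lhom_ext fun k a => ?_
  rcases eq_or_ne i j with rfl | h
  · simp only [Module.End.mul_apply, creat_single, annih_single, Function.update_self,
      Function.update_idem, if_true, LinearMap.add_apply, Module.End.one_apply]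
    -- In an empty mode the truncated `k i - 1` is harmless, since its coefficient is `√0`.
    rcases Nat.eq_zero_or_pos (k i) with hk | hk
    · have h1 : Function.update k i 0 = k := by rw [← hk]; simp
      simp [hk, h1]
    · have h2 : k i - 1 + 1 = k i := Nat.sub_add_cancel hk
      have h3 : ((k i - 1 : ℕ) : ℝ) + 1 = k i := by exact_mod_cast h2
      rw [h2, h3]
      push_cast
      simp only [Function.update_eq_self, mul_assoc, sqrt_mul_sqrt_cast,
        sqrt_mul_sqrt_cast_succ, ← Finsupp.single_add]
      ring_nf
  · simp only [Module.End.mul_apply, creat_single, annih_single, Function.update_of_ne h,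
      Function.update_of_ne h.symm, Function.update_comm h, if_neg h, add_zero]
    ring_nf

/-- The symplectic form `z·conj(w) - conj(z)·w`. -/
def symp (z w : Fin n → ℂ) : ℂ := ∑ j, (z j * conj (w j) - conj (z j) * w j)

theorem creatAt_mul_creatAt (z w : Fin n → ℂ) : creatAt z * creatAt w = creatAt w * creatAt z := by
  simp only [creatAt, Finset.sum_mul_sum, smul_mul_smul_comm]
  rw [Finset.sum_comm]
  refine Finset.sum_congr rfl fun i _ => Finset.sum_congr rfl fun j _ => ?_
  rw [creat_mul_creat, mul_comm]

theorem annihAt_mul_annihAt (z w : Fin n → ℂ) : annihAt z * annihAt w = annihAt w * annihAt z := by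
  simp only [annihAt, Finset.sum_mul_sum, smul_mul_smul_comm]
  rw [Finset.sum_comm]
  refine Finset.sum_congr rfl fun i _ => Finset.sum_congr rfl fun j _ => ?_
  rw [annih_mul_annih, mul_comm]

theorem annihAt_mul_creatAt (z w : Fin n → ℂ) :
    annihAt z * creatAt w = creatAt w * annihAt z + (∑ j, conj (z j) * w j) • 1 := by
  simp only [annihAt, creatAt, Finset.sum_mul_sum, smul_mul_smul_comm, annih_mul_creat, smul_add,
    Finset.sum_add_distrib]
  rw [Finset.sum_comm (f := fun i j => (w i * conj (z j)) • (creat i * annih j))]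
  congr 1
  · refine Finset.sum_congr rfl fun i _ => Finset.sum_congr rfl fun j _ => ?_
    rw [mul_comm]
  · simp [Finset.sum_smul]

/-- The generator `a†(z) - a(z)` of the displacements. -/
def gen (z : Fin n → ℂ) : Module.End ℂ (FiniteVectors n) := creatAt z - annihAt z

/-- Only the mixed products of `a` and `a†` fail to commute, and they do so by scalars. A central
commutator is all that the exponential identity needs. -/
theorem gen_mul_gen (z w : Fin n → ℂ) : gen z * gen w = gen w * gen z + symp z w • 1 := by
  have h1 := annihAt_mul_creatAt z w
  have h2 := annihAt_mul_creatAt w z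
  have h3 : symp z w = (∑ j, conj (w j) * z j) - ∑ j, conj (z j) * w j := by
    rw [symp, Finset.sum_sub_distrib]
    simp only [mul_comm]
  refine LinearMap.ext fun v => ?_
  have h4 := congrArg (fun A => A v) h1
  have h5 := congrArg (fun A => A v) h2
  have h6 := congrArg (fun A => A v) (creatAt_mul_creatAt z w)
  have h7 := congrArg (fun A => A v) (annihAt_mul_annihAt z w)
  simp only [Module.End.mul_apply, LinearMap.add_apply, LinearMap.smul_apply,
    Module.End.one_apply] at h4 h5 h6 h7
  simp only [gen, Module.End.mul_apply, LinearMap.add_apply, LinearMap.sub_apply, map_sub,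
    LinearMap.smul_apply, Module.End.one_apply, h4, h5, h6, h7, h3, sub_smul]
  abel

theorem creatAt_add (z w : Fin n → ℂ) : creatAt (z + w) = creatAt z + creatAt w := by
  simp [creatAt, add_smul, Finset.sum_add_distrib]

theorem annihAt_add (z w : Fin n → ℂ) : annihAt (z + w) = annihAt z + annihAt w := by
  simp [annihAt, add_smul, Finset.sum_add_distrib]

theorem creatAt_smul (a : ℂ) (z : Fin n → ℂ) : creatAt (a • z) = a • creatAt z := by
  simp [creatAt, Finset.smul_sum, smul_smul]

theorem annihAt_smul (a : ℂ) (z : Fin n → ℂ) : annihAt (a • z) = conj a • annihAt z := by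
  simp [annihAt, Finset.smul_sum, smul_smul]

theorem gen_add (z w : Fin n → ℂ) : gen (z + w) = gen z + gen w := by
  simp only [gen, creatAt_add, annihAt_add]
  abel

theorem gen_real_smul (t : ℝ) (z : Fin n → ℂ) : gen (t • z) = (t : ℂ) • gen z := by
  have h : t • z = (t : ℂ) • z := by ext; simp
  refine LinearMap.ext fun v => ?_
  simp only [h, gen, creatAt_smul, annihAt_smul, Complex.conj_ofReal, LinearMap.sub_apply,
    LinearMap.smul_apply, smul_sub]

theorem gen_neg (z : Fin n → ℂ) : gen (-z) = -gen z := by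
  have h := gen_real_smul (-1) z
  rw [neg_one_smul] at h
  rw [h]
  refine LinearMap.ext fun v => ?_
  simp

theorem inner_gen_left (z : Fin n → ℂ) (u v : FiniteVectors n) :
    inner ℂ (incl (gen z u)) (incl v) = inner ℂ (incl u) (incl (gen (-z) v)) := by
  rw [gen_neg]
  simp only [gen, LinearMap.neg_apply, LinearMap.sub_apply, map_sub, inner_sub_left,
    inner_creatAt_left, inner_annihAt_left, neg_sub, inner_sub_right]

theorem inner_gen_pow_left (z : Fin n → ℂ) (m : ℕ) (u v : FiniteVectors n) :
    inner ℂ (incl ((gen z ^ m) u)) (incl v) = inner ℂ (incl u) (incl ((gen (-z) ^ m) v)) := by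
  induction m generalizing u v with
  | zero => simp
  | succ m ih =>
    rw [pow_succ', Module.End.mul_apply, inner_gen_left, ih, pow_succ, Module.End.mul_apply]

/-! ### The exponential of a sum with central commutator -/

section Exponential

variable {R : Type*} [Semiring R] [Algebra ℂ R]

/-- The product rule on coefficients: on the antidiagonal the factor `N + 1` is `p.1 + p.2`, and
each summand differentiates one of the two factors. -/
theorem add_smul_sum_antidiagonal {M : Type*} [AddCommMonoid M] [Module ℂ M] (f : ℕ → ℕ → M)
    (N : ℕ) :
    ((N + 1 : ℕ) : ℂ) • ∑ p ∈ Finset.HasAntidiagonal.antidiagonal (N + 1), f p.1 p.2 =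
      ∑ p ∈ Finset.HasAntidiagonal.antidiagonal N, (((p.1 + 1 : ℕ) : ℂ) • f (p.1 + 1) p.2 +
        ((p.2 + 1 : ℕ) : ℂ) • f p.1 (p.2 + 1)) := by
  have h1 : ∑ p ∈ Finset.HasAntidiagonal.antidiagonal (N + 1), ((p.1 : ℕ) : ℂ) • f p.1 p.2 =
      ∑ p ∈ Finset.HasAntidiagonal.antidiagonal N, ((p.1 + 1 : ℕ) : ℂ) • f (p.1 + 1) p.2 := by
    rw [Finset.Nat.sum_antidiagonal_succ]
    simp
  have h2 : ∑ p ∈ Finset.HasAntidiagonal.antidiagonal (N + 1), ((p.2 : ℕ) : ℂ) • f p.1 p.2 =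
      ∑ p ∈ Finset.HasAntidiagonal.antidiagonal N, ((p.2 + 1 : ℕ) : ℂ) • f p.1 (p.2 + 1) := by
    rw [Finset.Nat.sum_antidiagonal_succ']
    simp
  rw [Finset.sum_add_distrib, ← h1, ← h2, ← Finset.sum_add_distrib, Finset.smul_sum]
  refine Finset.sum_congr rfl fun p hp => ?_
  rw [← add_smul, ← Finset.HasAntidiagonal.mem_antidiagonal.mp hp]
  push_cast
  rfl

/-- The terms `xⁱ / i!` of the exponential series. -/
def expTerm (x : R) (i : ℕ) : R := ((i ! : ℂ)⁻¹) • x ^ i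

theorem succ_smul_expTerm (x : R) (i : ℕ) :
    ((i + 1 : ℕ) : ℂ) • expTerm x (i + 1) = x * expTerm x i := by
  have h : ((i + 1 : ℕ) : ℂ) ≠ 0 := Nat.cast_ne_zero.mpr i.succ_ne_zero
  rw [expTerm, expTerm, smul_smul, Nat.factorial_succ, mul_smul_comm, ← pow_succ']
  congr 1
  push_cast at h ⊢
  rw [mul_inv, mul_inv_cancel_left₀ h]

theorem pow_succ_mul_of_comm {x y : R} {κ : ℂ} (h : x * y = y * x + κ • 1) (i : ℕ) :
    x ^ (i + 1) * y = y * x ^ (i + 1) + (((i + 1 : ℕ) : ℂ) * κ) • x ^ i := by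
  induction i with
  | zero => simp [h]
  | succ i ih =>
    rw [pow_succ' x (i + 1), mul_assoc, ih, mul_add, ← mul_assoc, h, add_mul, mul_assoc,
      mul_smul_comm, ← pow_succ', smul_mul_assoc, one_mul, ← pow_succ' x i, add_assoc, ← add_smul]
    congr 2
    push_cast
    ring

/-- Commutation with `y` acts on powers of `x` as `κ d/dx`, which lowers the index of a divided
power by one. -/
theorem expTerm_succ_mul {x y : R} {κ : ℂ} (h : x * y = y * x + κ • 1) (i : ℕ) :
    expTerm x (i + 1) * y = y * expTerm x (i + 1) + κ • expTerm x i := by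
  have h0 : ((i : ℂ) + 1) ≠ 0 := by exact_mod_cast i.succ_ne_zero
  rw [expTerm, expTerm, smul_mul_assoc, pow_succ_mul_of_comm h, smul_add, mul_smul_comm, smul_smul,
    smul_smul]
  congr 2
  rw [Nat.factorial_succ]
  push_cast
  field_simp

/-- The Taylor coefficients of `t ↦ exp(κ t² / 2)`. -/
def sqExpCoeff (κ : ℂ) (i : ℕ) : ℂ := if Even i then (κ / 2) ^ (i / 2) / ((i / 2)! : ℂ) else 0

/-- The differential equation `g' = κ t g` of `g(t) = exp(κ t²/2)`, read on Taylor coefficients. -/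
theorem sqExpCoeff_add_two (κ : ℂ) (i : ℕ) :
    ((i + 2 : ℕ) : ℂ) * sqExpCoeff κ (i + 2) = κ * sqExpCoeff κ i := by
  unfold sqExpCoeff
  rcases Nat.even_or_odd i with h | h
  · obtain ⟨m, rfl⟩ := h
    have h1 : Even (m + m + 2) := ⟨m + 1, by ring⟩
    have h2 : (m + m + 2) / 2 = m + 1 := by omega
    have h3 : (m + m) / 2 = m := by omega
    have h0 : ((m : ℂ) + 1) ≠ 0 := by exact_mod_cast m.succ_ne_zero
    have h4 : ((m ! : ℕ) : ℂ) ≠ 0 := Nat.cast_ne_zero.mpr (Nat.factorial_ne_zero m)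
    rw [if_pos h1, if_pos ⟨m, rfl⟩, h2, h3, Nat.factorial_succ]
    push_cast
    field_simp
    ring
  · have h1 : ¬ Even (i + 2) := by
      rw [Nat.not_even_iff_odd]
      exact h.add_even even_two
    rw [if_neg h1, if_neg (Nat.not_even_iff_odd.mpr h)]
    simp

theorem hasSum_sqExpCoeff (κ : ℂ) : HasSum (sqExpCoeff κ) (Complex.exp (κ / 2)) := by
  have h := NormedSpace.expSeries_div_hasSum_exp (κ / 2)
  rw [← Complex.exp_eq_exp_ℂ] at h
  have hinj : Function.Injective fun m : ℕ => 2 * m := fun a b hab => by simpa using hab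
  have h2 : ∀ x ∉ Set.range (fun m : ℕ => 2 * m), sqExpCoeff κ x = 0 := by
    intro x hx
    unfold sqExpCoeff
    rw [if_neg]
    rintro ⟨m, rfl⟩
    exact hx ⟨m, by ring⟩
  rw [← hinj.hasSum_iff h2]
  have h3 : sqExpCoeff κ ∘ (fun m : ℕ => 2 * m) = fun m => (κ / 2) ^ m / (m ! : ℂ) := by
    funext m
    simp [sqExpCoeff]
  rw [h3]
  exact h

theorem summable_norm_sqExpCoeff (κ : ℂ) : Summable fun i => ‖sqExpCoeff κ i‖ :=
  (hasSum_sqExpCoeff κ).summable.norm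

/-- The coefficient of `t^N` in `exp(tx) exp(ty) = exp(κt²/2) exp(t(x+y))`. Both sides solve `F' =
(x + y + κt) F`, which on coefficients is a two-step recurrence. Being purely algebraic, the
identity is available for unbounded operators on finite vectors, before any convergence is
discussed. -/
theorem sum_expTerm_mul_expTerm {x y : R} {κ : ℂ} (h : x * y = y * x + κ • 1) (N : ℕ) :
    ∑ p ∈ Finset.HasAntidiagonal.antidiagonal N, expTerm x p.1 * expTerm y p.2 =
      ∑ p ∈ Finset.HasAntidiagonal.antidiagonal N, sqExpCoeff κ p.1 • expTerm (x + y) p.2 := by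
  induction N using Nat.strong_induction_on with
  | _ N ih =>
    match N with
    | 0 => simp [expTerm, sqExpCoeff]
    | 1 => simp [Finset.Nat.sum_antidiagonal_succ, expTerm, sqExpCoeff, add_comm]
    | N + 2 =>
      have hN : ((N + 2 : ℕ) : ℂ) ≠ 0 := Nat.cast_ne_zero.mpr (by omega)
      have hL : ((N + 2 : ℕ) : ℂ) •
          ∑ p ∈ Finset.HasAntidiagonal.antidiagonal (N + 2), expTerm x p.1 * expTerm y p.2 =
          (x + y) * (∑ p ∈ Finset.HasAntidiagonal.antidiagonal (N + 1), expTerm x p.1 * expTerm y p.2) +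
            κ • ∑ p ∈ Finset.HasAntidiagonal.antidiagonal N, expTerm x p.1 * expTerm y p.2 := by
        rw [add_smul_sum_antidiagonal (fun i j => expTerm x i * expTerm y j) (N + 1)]
        have h1 : ∀ p : ℕ × ℕ, ((p.1 + 1 : ℕ) : ℂ) • (expTerm x (p.1 + 1) * expTerm y p.2) =
            x * (expTerm x p.1 * expTerm y p.2) := fun p => by
          rw [← smul_mul_assoc, succ_smul_expTerm, mul_assoc]
        have h2 : ∀ p : ℕ × ℕ, ((p.2 + 1 : ℕ) : ℂ) • (expTerm x p.1 * expTerm y (p.2 + 1)) =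
            expTerm x p.1 * y * expTerm y p.2 := fun p => by
          rw [← mul_smul_comm, succ_smul_expTerm, mul_assoc]
        simp only [h1, h2]
        rw [Finset.sum_add_distrib, add_mul, Finset.mul_sum, Finset.mul_sum, add_assoc]
        congr 1
        -- Moving `y` to the left past `expTerm x (i + 1)` costs `κ • expTerm x i`, which produces
        -- the sum in degree `N`. The index `0` is split off, where nothing has to be commuted.
        rw [Finset.Nat.sum_antidiagonal_succ, Finset.Nat.sum_antidiagonal_succ]
        simp only [expTerm_succ_mul h, add_mul, Finset.sum_add_distrib, smul_mul_assoc,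
          Finset.smul_sum, mul_assoc]
        have h3 : expTerm x 0 = 1 := by simp [expTerm]
        rw [h3, one_mul, one_mul, add_assoc]
      have hR : ((N + 2 : ℕ) : ℂ) •
          ∑ p ∈ Finset.HasAntidiagonal.antidiagonal (N + 2), sqExpCoeff κ p.1 • expTerm (x + y) p.2 =
          (x + y) * (∑ p ∈ Finset.HasAntidiagonal.antidiagonal (N + 1), sqExpCoeff κ p.1 • expTerm (x + y) p.2) +
            κ • ∑ p ∈ Finset.HasAntidiagonal.antidiagonal N, sqExpCoeff κ p.1 • expTerm (x + y) p.2 := by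
        rw [add_smul_sum_antidiagonal (fun i j => sqExpCoeff κ i • expTerm (x + y) j) (N + 1)]
        rw [Finset.sum_add_distrib, add_comm]
        congr 1
        · rw [Finset.mul_sum]
          refine Finset.sum_congr rfl fun p _ => ?_
          rw [smul_comm, succ_smul_expTerm, mul_smul_comm]
        · rw [Finset.Nat.sum_antidiagonal_succ, Finset.smul_sum]
          have h1 : sqExpCoeff κ (0 + 1) = 0 := by simp [sqExpCoeff]
          rw [h1, zero_smul, smul_zero, zero_add]
          refine Finset.sum_congr rfl fun p _ => ?_
          rw [smul_smul, smul_smul, ← sqExpCoeff_add_two]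
      rw [ih (N + 1) (by omega), ih N (by omega), ← hR] at hL
      have h5 := congrArg (fun w => (((N + 2 : ℕ) : ℂ)⁻¹) • w) hL
      simpa only [smul_smul, inv_mul_cancel₀ hN, one_smul] using h5

end Exponential

/-! ### Convergence of the displacement series -/

theorem sum_update_succ (k : Fin n → ℕ) (j : Fin n) :
    ∑ i, Function.update k j (k j + 1) i = ∑ i, k i + 1 := by
  rw [Finset.sum_update_of_mem (Finset.mem_univ j), ← Finset.sum_erase_add _ _ (Finset.mem_univ j),
    Finset.sdiff_singleton_eq_erase]
  ring

theorem sum_update_pred_le (k : Fin n → ℕ) (j : Fin n) :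
    ∑ i, Function.update k j (k j - 1) i ≤ ∑ i, k i := by
  refine Finset.sum_le_sum fun i _ => ?_
  rcases eq_or_ne i j with rfl | h
  · simp
  · simp [Function.update_of_ne h]

/-- Each generator raises the photon number by at most one and costs at most `2 ∑ ‖z j‖` times the
square root of the current bound plus one; the product of these roots is the root of an ascending
factorial. The bound `N` is free, rather than equal to `∑ k i`, because annihilation lowers the sum.
-/
theorem norm_incl_gen_pow_single_le (z : Fin n → ℂ) (m : ℕ) (k : Fin n → ℕ) (N : ℕ)
    (hk : ∑ i, k i ≤ N) :
    ‖incl ((gen z ^ m) (Finsupp.single k 1))‖ ≤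
      (2 * ∑ j, ‖z j‖) ^ m * Real.sqrt ((N + 1).ascFactorial m) := by
  induction m generalizing k N with
  | zero => simp [norm_numberState]
  | succ m ih =>
    have hs : ∀ (l : Fin n → ℕ) (a : ℂ), (Finsupp.single l a : FiniteVectors n) =
        a • Finsupp.single l 1 := fun l a => by simp
    have hB : ∀ l : Fin n → ℕ, ∑ i, l i ≤ N + 1 →
        ‖incl ((gen z ^ m) (Finsupp.single l 1))‖ ≤
          (2 * ∑ j, ‖z j‖) ^ m * Real.sqrt ((N + 1 + 1).ascFactorial m) := fun l hl => ih l _ hl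
    set B := (2 * ∑ j, ‖z j‖) ^ m * Real.sqrt ((N + 1 + 1).ascFactorial m) with hBdef
    have hB0 : 0 ≤ B := by positivity
    have hkj : ∀ j, (k j : ℝ) + 1 ≤ (N + 1 : ℕ) := fun j => by
      have : k j ≤ N := (Finset.single_le_sum (fun i _ => Nat.zero_le (k i))
        (Finset.mem_univ j)).trans hk
      exact_mod_cast Nat.succ_le_succ this
    have h1 : ∀ j, ‖incl ((gen z ^ m) (creat j (Finsupp.single k 1)))‖ ≤
        Real.sqrt (N + 1 : ℕ) * B := fun j => by
      rw [creat_single, hs, map_smul, map_smul, norm_smul, one_mul, Complex.norm_real,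
        Real.norm_of_nonneg (Real.sqrt_nonneg _)]
      refine mul_le_mul (Real.sqrt_le_sqrt (hkj j)) (hB _ ?_) (norm_nonneg _) (Real.sqrt_nonneg _)
      rw [sum_update_succ]
      omega
    have h2 : ∀ j, ‖incl ((gen z ^ m) (annih j (Finsupp.single k 1)))‖ ≤
        Real.sqrt (N + 1 : ℕ) * B := fun j => by
      rw [annih_single, hs, map_smul, map_smul, norm_smul, one_mul, Complex.norm_real,
        Real.norm_of_nonneg (Real.sqrt_nonneg _)]
      refine mul_le_mul (Real.sqrt_le_sqrt (by linarith [hkj j])) (hB _ ?_) (norm_nonneg _)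
        (Real.sqrt_nonneg _)
      have := sum_update_pred_le k j
      omega
    have h3 : incl ((gen z ^ (m + 1)) (Finsupp.single k 1)) =
        ∑ j, (z j • incl ((gen z ^ m) (creat j (Finsupp.single k 1))) -
          conj (z j) • incl ((gen z ^ m) (annih j (Finsupp.single k 1)))) := by
      rw [pow_succ, Module.End.mul_apply]
      conv_lhs => enter [2, 2]; rw [gen]
      simp only [creatAt, annihAt, LinearMap.sub_apply, LinearMap.sum_apply, LinearMap.smul_apply,
        map_sub, map_sum, map_smul, Finset.sum_sub_distrib]
    rw [h3]
    refine (norm_sum_le _ _).trans ?_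
    have h4 : ∀ j, ‖z j • incl ((gen z ^ m) (creat j (Finsupp.single k 1))) -
          conj (z j) • incl ((gen z ^ m) (annih j (Finsupp.single k 1)))‖ ≤
        ‖z j‖ * (2 * (Real.sqrt (N + 1 : ℕ) * B)) := fun j => by
      refine (norm_sub_le _ _).trans ?_
      rw [norm_smul, norm_smul, RCLike.norm_conj, ← mul_add]
      exact mul_le_mul_of_nonneg_left (by linarith [h1 j, h2 j]) (norm_nonneg _)
    refine (Finset.sum_le_sum fun j _ => h4 j).trans (le_of_eq ?_)
    rw [← Finset.sum_mul, hBdef]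
    have h5 : (((N + 1).ascFactorial (m + 1) : ℕ) : ℝ) =
        ((N + 1 : ℕ) : ℝ) * ((N + 1 + 1).ascFactorial m : ℕ) := by
      rw [Nat.ascFactorial_succ, ← Nat.succ_ascFactorial]
      push_cast
      ring
    rw [h5, Real.sqrt_mul (Nat.cast_nonneg _), pow_succ]
    ring

/-- The terms of the displacement series. -/
def dispTerm (z : Fin n → ℂ) (v : FiniteVectors n) (m : ℕ) : FockSpace n :=
  ((m ! : ℂ)⁻¹) • incl ((gen z ^ m) v)

/-- A summable bound for the terms of the displacement series. -/
def dispBound (C : ℝ) (N m : ℕ) : ℝ := 2 ^ N * (((8 * C) ^ 2) ^ m / m ! + (1 / 4) ^ m)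

theorem summable_dispBound (C : ℝ) (N : ℕ) : Summable (dispBound C N) :=
  ((Real.summable_pow_div_factorial _).add
    (summable_geometric_of_lt_one (by norm_num) (by norm_num))).mul_left _

theorem ascFactorial_le (N m : ℕ) : (N + 1).ascFactorial m ≤ m ! * 2 ^ (N + m) := by
  rw [Nat.ascFactorial_eq_factorial_mul_choose]
  exact Nat.mul_le_mul_left _ (Nat.choose_le_two_pow _ _)

/-- The term is at most `2^N a b` with `a = (8C)^m / √(m!)` and `b = 2^(-m)`, and `ab ≤ a² + b²`
trades the square root of the factorial for an exponential plus a geometric series. The bound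
depends on `z` only through `C`, as local uniform convergence requires. -/
theorem norm_dispTerm_single_le {z : Fin n → ℂ} {C : ℝ} (hC : ∑ j, ‖z j‖ ≤ C)
    (k : Fin n → ℕ) (m : ℕ) :
    ‖dispTerm z (Finsupp.single k 1) m‖ ≤ dispBound C (∑ i, k i) m := by
  set N := ∑ i, k i
  have hs : 0 ≤ ∑ j, ‖z j‖ := Finset.sum_nonneg fun _ _ => norm_nonneg _
  have hC0 : 0 ≤ C := hs.trans hC
  have hf : (0 : ℝ) < m ! := Nat.cast_pos.mpr (Nat.factorial_pos m)
  rw [dispTerm, norm_smul, norm_inv, Complex.norm_natCast]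
  have h1 : Real.sqrt ((N + 1).ascFactorial m) ≤ Real.sqrt (m !) * 2 ^ (N + m) := by
    -- The extra square is deliberately wasteful: it lets the root of this factor be taken exactly.
    have h2 : (((N + 1).ascFactorial m : ℕ) : ℝ) ≤ (m ! : ℝ) * (2 ^ (N + m)) ^ 2 := by
      have h3 : (((N + 1).ascFactorial m : ℕ) : ℝ) ≤ (m ! : ℝ) * 2 ^ (N + m) := by
        exact_mod_cast ascFactorial_le N m
      have h4 : (1 : ℝ) ≤ 2 ^ (N + m) := one_le_pow₀ (by norm_num)
      nlinarith [mul_nonneg hf.le (mul_nonneg (zero_le_one.trans h4) (sub_nonneg.mpr h4))]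
    refine (Real.sqrt_le_sqrt h2).trans (le_of_eq ?_)
    rw [Real.sqrt_mul hf.le, Real.sqrt_sq (by positivity)]
  have h2 := (norm_incl_gen_pow_single_le z m k N le_rfl).trans
    (mul_le_mul (pow_le_pow_left₀ (by positivity) (mul_le_mul_of_nonneg_left hC zero_le_two) m) h1
      (Real.sqrt_nonneg _) (by positivity))
  refine (mul_le_mul_of_nonneg_left h2 (inv_nonneg.mpr hf.le)).trans ?_
  set r := Real.sqrt (m !) with hr
  have hr0 : 0 < r := Real.sqrt_pos.mpr hf
  have hrr : (m ! : ℝ) = r ^ 2 := (Real.sq_sqrt hf.le).symm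
  rw [dispBound, hrr]
  set a := (8 * C) ^ m / r
  set b : ℝ := (1 / 2) ^ m
  have e1 : (r ^ 2)⁻¹ * ((2 * C) ^ m * (r * 2 ^ (N + m))) = 2 ^ N * (a * b) := by
    have : (8 * C) ^ m * (1 / 2 : ℝ) ^ m = (2 * C) ^ m * 2 ^ m := by
      rw [← mul_pow, ← mul_pow]; congr 1; ring
    rw [show a * b = (8 * C) ^ m * (1 / 2 : ℝ) ^ m / r by ring, this, pow_add]
    field_simp
  have e2 : ((8 * C) ^ 2) ^ m / r ^ 2 + (1 / 4 : ℝ) ^ m = a ^ 2 + b ^ 2 := by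
    have : (1 / 4 : ℝ) ^ m = b ^ 2 := by
      rw [← pow_mul, mul_comm m 2, pow_mul]; norm_num
    rw [this, show a ^ 2 = ((8 * C) ^ m) ^ 2 / r ^ 2 from div_pow _ _ _, ← pow_mul, ← pow_mul,
      ← pow_mul, mul_comm 2 m]
  rw [e1, e2]
  refine mul_le_mul_of_nonneg_left ?_ (by positivity)
  nlinarith [sq_nonneg (a - b), sq_nonneg a, sq_nonneg b]

theorem dispTerm_add (z : Fin n → ℂ) (u v : FiniteVectors n) :
    dispTerm z (u + v) = dispTerm z u + dispTerm z v := by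
  funext m
  simp [dispTerm]

theorem dispTerm_smul (z : Fin n → ℂ) (a : ℂ) (v : FiniteVectors n) :
    dispTerm z (a • v) = a • dispTerm z v := by
  funext m
  simp only [dispTerm, map_smul, Pi.smul_apply]
  rw [smul_comm]

theorem summable_norm_dispTerm (z : Fin n → ℂ) (v : FiniteVectors n) :
    Summable fun m => ‖dispTerm z v m‖ := by
  induction v using Finsupp.induction_linear with
  | zero => simp [dispTerm, summable_zero]
  | add u v hu hv =>
    rw [dispTerm_add]
    exact Summable.of_nonneg_of_le (fun _ => norm_nonneg _) (fun _ => norm_add_le _ _) (hu.add hv)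
  | single k a =>
    have h : (Finsupp.single k a : FiniteVectors n) = a • Finsupp.single k 1 := by simp
    rw [h, dispTerm_smul]
    simp only [Pi.smul_apply, norm_smul]
    refine Summable.mul_left _ ?_
    exact Summable.of_nonneg_of_le (fun _ => norm_nonneg _)
      (fun m => norm_dispTerm_single_le le_rfl k m) (summable_dispBound _ _)

theorem hasSum_displacement (z : Fin n → ℂ) (v : FiniteVectors n) :
    HasSum (dispTerm z v) (displacement z v) :=
  (summable_norm_dispTerm z v).of_norm.hasSum

theorem displacement_add (z : Fin n → ℂ) (u v : FiniteVectors n) :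
    displacement z (u + v) = displacement z u + displacement z v := by
  refine (hasSum_displacement z (u + v)).unique ?_
  rw [dispTerm_add]
  exact (hasSum_displacement z u).add (hasSum_displacement z v)

theorem displacement_smul (z : Fin n → ℂ) (a : ℂ) (v : FiniteVectors n) :
    displacement z (a • v) = a • displacement z v := by
  refine (hasSum_displacement z (a • v)).unique ?_
  rw [dispTerm_smul]
  exact (hasSum_displacement z v).const_smul a

theorem displacement_zero_left (v : FiniteVectors n) : displacement 0 v = incl v := by
  refine (hasSum_displacement 0 v).unique ?_
  have h0 : gen (0 : Fin n → ℂ) = 0 := by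
    have := gen_real_smul 0 (0 : Fin n → ℂ)
    simpa using this
  have h : dispTerm 0 v = fun m => if m = 0 then incl v else 0 := by
    funext m
    rcases Nat.eq_zero_or_pos m with rfl | hm
    · simp [dispTerm]
    · simp [dispTerm, h0, zero_pow hm.ne', hm.ne']
  rw [h]
  exact hasSum_ite_eq 0 _

/-! ### The Weyl relations -/

theorem hasSum_inner_mul {E : Type*} [NormedAddCommGroup E] [InnerProductSpace ℂ E]
    {p q : ℕ → E} {x y : E} (hp : HasSum p x) (hq : HasSum q y) (hp' : Summable fun i => ‖p i‖)
    (hq' : Summable fun i => ‖q i‖) :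
    HasSum (fun N => ∑ i ∈ Finset.HasAntidiagonal.antidiagonal N, inner ℂ (p i.1) (q i.2))
      (inner ℂ x y) := by
  have hs : Summable fun i : ℕ × ℕ => inner ℂ (p i.1) (q i.2) := by
    refine Summable.of_norm_bounded (g := fun i : ℕ × ℕ => ‖p i.1‖ * ‖q i.2‖) ?_
      fun i => norm_inner_le_norm _ _
    exact hp'.mul_of_nonneg hq' (fun _ => norm_nonneg _) fun _ => norm_nonneg _
  have h1 : HasSum (fun i : ℕ × ℕ => inner ℂ (p i.1) (q i.2)) (inner ℂ x y) := by
    have h2 : ∀ i, HasSum (fun j => inner ℂ (p i) (q j)) (inner ℂ (p i) y) := fun i =>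
      hq.mapL (innerSL ℂ (p i))
    have h3 : HasSum (fun i => inner ℂ (p i) y) (inner ℂ x y) := by
      have := hp.mapL (innerSLFlip ℂ y)
      simpa using this
    have h4 := hs.hasSum.prod_fiberwise h2
    rw [← h4.unique h3]
    exact hs.hasSum
  have h5 := (Finset.HasAntidiagonal.sigmaAntidiagonalEquivProd (A := ℕ)).hasSum_iff.mpr h1
  refine h5.sigma fun N => ?_
  have := hasSum_fintype (fun c : Finset.HasAntidiagonal.antidiagonal N =>
    inner ℂ (p c.1.1) (q c.1.2))
  rw [Finset.univ_eq_attach, Finset.sum_attach _ (fun c : ℕ × ℕ => inner ℂ (p c.1) (q c.2))] at this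
  exact this

/-- The Weyl relation in weak form. The series defines `D` on finite vectors only, so `D(z)D(w)`
cannot be composed yet; `D(z)` is moved to the other argument as `D(-z)`, and the Cauchy product of
the two series is evaluated degree by degree. -/
theorem inner_displacement_displacement (z w : Fin n → ℂ) (u v : FiniteVectors n) :
    inner ℂ (displacement (-z) u) (displacement w v) =
      Complex.exp (symp z w / 2) * inner ℂ (incl u) (displacement (z + w) v) := by
  have h1 := hasSum_inner_mul (hasSum_displacement (-z) u) (hasSum_displacement w v)
    (summable_norm_dispTerm _ _) (summable_norm_dispTerm _ _)
  have h2 : HasSum (fun j => inner ℂ (incl u) (dispTerm (z + w) v j))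
      (inner ℂ (incl u) (displacement (z + w) v)) :=
    (hasSum_displacement (z + w) v).mapL (innerSL ℂ (incl u))
  have h3 : Summable fun j => ‖inner ℂ (incl u) (dispTerm (z + w) v j)‖ := h2.summable.norm
  have h4 := tsum_mul_tsum_eq_tsum_sum_antidiagonal_of_summable_norm
    (summable_norm_sqExpCoeff (symp z w)) h3
  rw [(hasSum_sqExpCoeff _).tsum_eq, h2.tsum_eq] at h4
  rw [h4, ← h1.tsum_eq]
  congr 1
  funext N
  have h5 := congrArg (fun A => inner ℂ (incl u) (incl (A v)))
    (sum_expTerm_mul_expTerm (gen_mul_gen z w) N)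
  simp only [LinearMap.sum_apply, map_sum, inner_sum] at h5
  convert h5 using 2 with p hp p hp
  · simp only [dispTerm, inner_smul_left, inner_smul_right, inner_gen_pow_left, neg_neg, expTerm,
      Module.End.mul_apply, LinearMap.smul_apply, map_smul, map_inv₀, Complex.conj_natCast]
  · simp only [dispTerm, inner_smul_right, expTerm, LinearMap.smul_apply, map_smul, gen_add]

theorem inner_displacement_self (z : Fin n → ℂ) (u v : FiniteVectors n) :
    inner ℂ (displacement z u) (displacement z v) = inner ℂ (incl u) (incl v) := by
  have h := inner_displacement_displacement (-z) z u v
  rw [neg_neg, neg_add_cancel, displacement_zero_left] at h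
  have h2 : symp (-z) z = 0 := by
    refine Finset.sum_eq_zero fun j _ => ?_
    simp only [Pi.neg_apply, map_neg]
    ring
  rw [h, h2, zero_div, Complex.exp_zero, one_mul]

theorem orthonormal_displacement (z : Fin n → ℂ) :
    Orthonormal ℂ fun k : Fin n → ℕ => displacement z (Finsupp.single k 1) := by
  rw [orthonormal_iff_ite]
  intro k l
  rw [inner_displacement_self]
  simp only [incl_single, one_smul, inner_numberState_left, numberState_apply]

/-- The unitary displacement operators. -/
def weyl (z : Fin n → ℂ) : FockSpace n →ₗᵢ[ℂ] FockSpace n :=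
  (orthonormal_displacement z).orthogonalFamily.linearIsometry

theorem weyl_numberState (z : Fin n → ℂ) (k : Fin n → ℕ) :
    weyl z (numberState k) = displacement z (Finsupp.single k 1) := by
  unfold weyl numberState
  rw [OrthogonalFamily.linearIsometry_apply_single]
  simp

theorem weyl_incl (z : Fin n → ℂ) (v : FiniteVectors n) : weyl z (incl v) = displacement z v := by
  induction v using Finsupp.induction_linear with
  | zero =>
    have := displacement_smul z 0 0
    rw [zero_smul, zero_smul] at this
    simp [this]
  | add u v hu hv => rw [map_add, map_add, hu, hv, displacement_add]
  | single k a =>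
    have h : (Finsupp.single k a : FiniteVectors n) = a • Finsupp.single k 1 := by simp
    rw [h, displacement_smul, map_smul, map_smul, incl_single, one_smul, weyl_numberState]

theorem inner_weyl_neg_weyl (z w : Fin n → ℂ) (x y : FockSpace n) :
    inner ℂ (weyl (-z) x) (weyl w y) =
      Complex.exp (symp z w / 2) * inner ℂ x (weyl (z + w) y) := by
  have h : (ContinuousLinearMap.adjoint (weyl (-z)).toContinuousLinearMap).comp
      (weyl w).toContinuousLinearMap =
      Complex.exp (symp z w / 2) • (weyl (z + w)).toContinuousLinearMap := by
    refine clm_ext fun k => fock_ext fun l => ?_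
    have h1 := inner_displacement_displacement z w (Finsupp.single l 1) (Finsupp.single k 1)
    simp only [← weyl_incl, incl_single, one_smul] at h1
    simpa [ContinuousLinearMap.adjoint_inner_right, inner_smul_right] using h1
  have h2 := congrArg (fun A => inner ℂ x (A y)) h
  simpa [ContinuousLinearMap.adjoint_inner_right, inner_smul_right] using h2

@[simp]
theorem weyl_zero (x : FockSpace n) : weyl 0 x = x := by
  have h : (weyl (0 : Fin n → ℂ)).toContinuousLinearMap = ContinuousLinearMap.id ℂ _ := by
    refine clm_ext fun k => ?_
    simp [weyl_numberState, displacement_zero_left]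
  exact congrArg (fun A => A x) h

@[simp]
theorem symp_zero_right (z : Fin n → ℂ) : symp z 0 = 0 := by simp [symp]

/-- The weak Weyl relation with `w = 0`: the adjoint of `D(z)` is `D(-z)`. -/
theorem inner_weyl_left (z : Fin n → ℂ) (x y : FockSpace n) :
    inner ℂ (weyl z x) y = inner ℂ x (weyl (-z) y) := by
  have h := inner_weyl_neg_weyl (-z) 0 x y
  simpa using h

theorem weyl_weyl (z w : Fin n → ℂ) (x : FockSpace n) :
    weyl z (weyl w x) = Complex.exp (symp z w / 2) • weyl (z + w) x := by
  refine fock_ext fun k => ?_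
  have h := inner_weyl_neg_weyl z w (numberState k) x
  rw [inner_weyl_left, neg_neg] at h
  rw [h, inner_smul_right]

theorem weyl_add (z w : Fin n → ℂ) (x : FockSpace n) :
    weyl (z + w) x = Complex.exp (-symp z w / 2) • weyl z (weyl w x) := by
  rw [weyl_weyl, smul_smul, ← Complex.exp_add]
  ring_nf
  simp

/-! ### Strong continuity -/

theorem continuous_incl_gen_pow (m : ℕ) (v : FiniteVectors n) :
    Continuous fun z : Fin n → ℂ => incl ((gen z ^ m) v) := by
  induction m generalizing v with
  | zero => simpa using continuous_const
  | succ m ih =>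
    have h3 : ∀ z : Fin n → ℂ, incl ((gen z ^ (m + 1)) v) =
        ∑ j, (z j • incl ((gen z ^ m) (creat j v)) -
          conj (z j) • incl ((gen z ^ m) (annih j v))) := by
      intro z
      rw [pow_succ, Module.End.mul_apply]
      conv_lhs => enter [2, 2]; rw [gen]
      simp only [creatAt, annihAt, LinearMap.sub_apply, LinearMap.sum_apply, LinearMap.smul_apply,
        map_sub, map_sum, map_smul, Finset.sum_sub_distrib]
    simp only [h3]
    refine continuous_finsetSum _ fun j _ => ?_
    have h1 : Continuous fun z : Fin n → ℂ => z j := continuous_apply j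
    exact (h1.smul (ih _)).sub ((Complex.continuous_conj.comp h1).smul (ih _))

theorem continuous_displacement_single (k : Fin n → ℕ) :
    Continuous fun z : Fin n → ℂ => displacement z (Finsupp.single k 1) := by
  rw [continuous_iff_continuousAt]
  intro z₀
  set U : Set (Fin n → ℂ) := {z | ∑ j, ‖z j‖ < ∑ j, ‖z₀ j‖ + 1}
  have hU : IsOpen U := isOpen_lt (by fun_prop) continuous_const
  have h : ContinuousOn (fun z => ∑' m, dispTerm z (Finsupp.single k 1) m) U := by
    refine continuousOn_tsum (u := dispBound (∑ j, ‖z₀ j‖ + 1) (∑ i, k i)) (fun m => ?_)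
      (summable_dispBound _ _) fun m z hz => norm_dispTerm_single_le (le_of_lt hz) k m
    exact ((continuous_incl_gen_pow m (Finsupp.single k 1)).const_smul ((m ! : ℂ)⁻¹)).continuousOn
  exact h.continuousAt (hU.mem_nhds (by simp [U]))

theorem continuous_displacement (v : FiniteVectors n) :
    Continuous fun z : Fin n → ℂ => displacement z v := by
  induction v using Finsupp.induction_linear with
  | zero =>
    have : ∀ z : Fin n → ℂ, displacement z 0 = 0 := fun z => by rw [← weyl_incl]; simp
    simpa only [this] using continuous_const
  | add u v hu hv =>
    simp only [displacement_add]
    exact hu.add hv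
  | single k a =>
    have h : (Finsupp.single k a : FiniteVectors n) = a • Finsupp.single k 1 := by simp
    simp only [h, displacement_smul]
    exact (continuous_displacement_single k).const_smul a

/-- Since every `D(z)` is an isometry, approximating `x` by a finite vector approximates `D(z)x`
uniformly in `z`, and continuity survives uniform limits. -/
theorem continuous_weyl (x : FockSpace n) : Continuous fun z : Fin n → ℂ => weyl z x := by
  refine continuous_of_uniform_approx_of_continuous fun u hu => ?_
  obtain ⟨ε, hε, hεu⟩ := Metric.mem_uniformity_dist.mp hu
  obtain ⟨v, hv⟩ := Metric.denseRange_iff.mp denseRange_incl x ε hε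
  refine ⟨fun z => displacement z v, continuous_displacement v, fun z => ?_⟩
  refine hεu ?_
  beta_reduce
  rw [← weyl_incl, (weyl z).dist_map]
  exact hv

/-! ### Truncation to finitely many photons -/

/-- The occupation numbers with at most `M` photons in total. -/
def cutoff (n M : ℕ) : Finset (Fin n → ℕ) :=
  (Fintype.piFinset fun _ => Finset.range (M + 1)).filter fun k => ∑ i, k i ≤ M

theorem mem_cutoff {M : ℕ} {k : Fin n → ℕ} : k ∈ cutoff n M ↔ ∑ i, k i ≤ M := by
  simp only [cutoff, Finset.mem_filter, Fintype.mem_piFinset, Finset.mem_range,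
    and_iff_right_iff_imp]
  intro h i
  have := Finset.single_le_sum (fun i _ => Nat.zero_le (k i)) (Finset.mem_univ i)
  omega

theorem tendsto_cutoff : Tendsto (cutoff n) atTop atTop := by
  refine tendsto_atTop_finset_of_monotone (fun M N h k hk => ?_) fun k => ⟨∑ i, k i, ?_⟩
  · exact mem_cutoff.mpr ((mem_cutoff.mp hk).trans h)
  · exact mem_cutoff.mpr le_rfl

/-- The finite vector with the coefficients of `f` up to `M` photons. -/
def trunc (M : ℕ) (f : (Fin n → ℕ) → ℂ) : FiniteVectors n :=
  ∑ k ∈ cutoff n M, Finsupp.single k (f k)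

theorem trunc_apply (M : ℕ) (f : (Fin n → ℕ) → ℂ) (k : Fin n → ℕ) :
    trunc M f k = if ∑ i, k i ≤ M then f k else 0 := by
  rw [trunc, Finsupp.finsetSum_apply]
  simp only [Finsupp.single_apply, Finset.sum_ite_eq', mem_cutoff]

theorem incl_trunc (M : ℕ) (f : (Fin n → ℕ) → ℂ) :
    incl (trunc M f) = ∑ k ∈ cutoff n M, lp.single 2 k (f k) := by
  rw [trunc, map_sum]
  refine Finset.sum_congr rfl fun k _ => ?_
  rw [incl_single, numberState, ← lp.single_smul, smul_eq_mul, mul_one]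

theorem tendsto_incl_trunc (ψ : FockSpace n) :
    Tendsto (fun M => incl (trunc M ψ)) atTop (𝓝 ψ) := by
  simp only [incl_trunc]
  exact (lp.hasSum_single (by norm_num) ψ).comp tendsto_cutoff

theorem norm_incl_trunc_sq (M : ℕ) (f : (Fin n → ℕ) → ℂ) :
    ‖incl (trunc M f)‖ ^ 2 = ∑ k ∈ cutoff n M, ‖f k‖ ^ 2 := by
  have h := lp.norm_sum_single (E := fun _ : Fin n → ℕ => ℂ) (p := 2) (by norm_num) f (cutoff n M)
  rw [incl_trunc]
  simpa using h

theorem norm_incl_trunc_le (M : ℕ) (ψ : FockSpace n) : ‖incl (trunc M ψ)‖ ≤ ‖ψ‖ := by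
  refine le_of_sq_le_sq ?_ (norm_nonneg _)
  rw [norm_incl_trunc_sq]
  exact sum_le_hasSum _ (fun _ _ => sq_nonneg _) (hasSum_norm_sq ψ)

theorem inner_incl_left (v : FiniteVectors n) (ψ : FockSpace n) :
    inner ℂ (incl v) ψ = ∑ k ∈ v.support, conj (v k) * ψ k := by
  conv_lhs => rw [incl, Finsupp.linearCombination_apply, Finsupp.sum, sum_inner]
  simp only [inner_smul_left, inner_numberState_left]

theorem inner_incl_trunc_of_le {v : FiniteVectors n} {M : ℕ}
    (hv : ∀ k ∈ v.support, ∑ i, k i ≤ M) (ψ : FockSpace n) :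
    inner ℂ (incl v) (incl (trunc M ψ)) = inner ℂ (incl v) ψ := by
  rw [inner_incl_left, inner_incl_left]
  refine Finset.sum_congr rfl fun k hk => ?_
  rw [incl_apply, trunc_apply, if_pos (hv k hk)]

theorem inner_incl_trunc_of_lt {v : FiniteVectors n} {M : ℕ}
    (hv : ∀ k ∈ v.support, M < ∑ i, k i) (ψ : FockSpace n) :
    inner ℂ (incl v) (incl (trunc M ψ)) = 0 := by
  rw [inner_incl_left]
  refine Finset.sum_eq_zero fun k hk => ?_
  rw [incl_apply, trunc_apply, if_neg (not_le.mpr (hv k hk)), mul_zero]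

/-! ### Ladder operators and the photon-number cutoff -/

theorem sum_update_pred (k : Fin n → ℕ) (j : Fin n) (h : k j ≠ 0) :
    ∑ i, Function.update k j (k j - 1) i + 1 = ∑ i, k i := by
  have h1 := sum_update_succ (Function.update k j (k j - 1)) j
  rw [← h1]
  congr 1
  funext i
  simp [Nat.sub_add_cancel (Nat.one_le_iff_ne_zero.mpr h)]

theorem sum_of_mem_support_annihAt {c : Fin n → ℂ} {k l : Fin n → ℕ}
    (hl : l ∈ (annihAt c (Finsupp.single k 1)).support) : ∑ i, l i + 1 = ∑ i, k i := by
  rw [Finsupp.mem_support_iff, annihAt, LinearMap.sum_apply, Finsupp.finsetSum_apply] at hl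
  obtain ⟨j, -, hj⟩ := Finset.exists_ne_zero_of_sum_ne_zero hl
  rw [LinearMap.smul_apply, annih_single, Finsupp.smul_apply, Finsupp.single_apply] at hj
  split_ifs at hj with h
  · rw [← h]
    refine sum_update_pred k j fun h0 => hj ?_
    simp [h0]
  · simp at hj

theorem sum_of_mem_support_creatAt {c : Fin n → ℂ} {k l : Fin n → ℕ}
    (hl : l ∈ (creatAt c (Finsupp.single k 1)).support) : ∑ i, l i = ∑ i, k i + 1 := by
  rw [Finsupp.mem_support_iff, creatAt, LinearMap.sum_apply, Finsupp.finsetSum_apply] at hl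
  obtain ⟨j, -, hj⟩ := Finset.exists_ne_zero_of_sum_ne_zero hl
  rw [LinearMap.smul_apply, creat_single, Finsupp.smul_apply, Finsupp.single_apply] at hj
  split_ifs at hj with h
  · rw [← h, sum_update_succ]
  · simp at hj

/-- The coefficients of the image of `ψ` under the adjoint of `A`. -/
def adjCoeff (A : Module.End ℂ (FiniteVectors n)) (ψ : FockSpace n) (k : Fin n → ℕ) : ℂ :=
  inner ℂ (incl (A (Finsupp.single k 1))) ψ

/-- The cutoff is on the total photon number, which `a†(c)` raises by exactly one whichever modes
`c` mixes. So truncating and then creating is the same as creating weakly and truncating one level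
higher. -/
theorem creatAt_trunc (c : Fin n → ℂ) (M : ℕ) (ψ : FockSpace n) :
    creatAt c (trunc M ψ) = trunc (M + 1) (adjCoeff (annihAt c) ψ) := by
  ext k
  have h : creatAt c (trunc M ψ) k =
      inner ℂ (incl (annihAt c (Finsupp.single k 1))) (incl (trunc M ψ)) := by
    rw [inner_annihAt_left, incl_single, one_smul, inner_numberState_left, incl_apply]
  rw [h, trunc_apply]
  split_ifs with hk
  · refine inner_incl_trunc_of_le (fun l hl => ?_) ψ
    have := sum_of_mem_support_annihAt hl
    omega
  · refine inner_incl_trunc_of_lt (fun l hl => ?_) ψ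
    have := sum_of_mem_support_annihAt hl
    omega

theorem annihAt_trunc (c : Fin n → ℂ) (M : ℕ) (ψ : FockSpace n) :
    annihAt c (trunc (M + 1) ψ) = trunc M (adjCoeff (creatAt c) ψ) := by
  ext k
  have h : annihAt c (trunc (M + 1) ψ) k =
      inner ℂ (incl (creatAt c (Finsupp.single k 1))) (incl (trunc (M + 1) ψ)) := by
    rw [inner_creatAt_left, incl_single, one_smul, inner_numberState_left, incl_apply]
  rw [h, trunc_apply]
  split_ifs with hk
  · refine inner_incl_trunc_of_le (fun l hl => ?_) ψ
    have := sum_of_mem_support_creatAt hl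
    omega
  · refine inner_incl_trunc_of_lt (fun l hl => ?_) ψ
    have := sum_of_mem_support_creatAt hl
    omega

theorem sum_conj_mul_self (c : Fin n → ℂ) :
    ∑ j, conj (c j) * c j = ((∑ j, ‖c j‖ ^ 2 : ℝ) : ℂ) := by
  push_cast
  refine Finset.sum_congr rfl fun j _ => ?_
  rw [mul_comm, Complex.mul_conj, Complex.normSq_eq_norm_sq]
  push_cast
  rfl

/-- The expectation of the commutation relation in `v`. It lets each of `a†(c)` and `a(c)` control
the other, which is why one finite trace provides both images. -/
theorem norm_incl_creatAt_sq (c : Fin n → ℂ) (v : FiniteVectors n) :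
    ‖incl (creatAt c v)‖ ^ 2 = ‖incl (annihAt c v)‖ ^ 2 + (∑ j, ‖c j‖ ^ 2) * ‖incl v‖ ^ 2 := by
  have h1 := congrArg (fun A => inner ℂ (incl v) (incl (A v))) (annihAt_mul_creatAt c c)
  simp only [Module.End.mul_apply, LinearMap.add_apply, LinearMap.smul_apply,
    Module.End.one_apply, map_add, map_smul, inner_add_right, inner_smul_right,
    ← inner_creatAt_left, ← inner_annihAt_left, inner_self_eq_norm_sq_to_K, sum_conj_mul_self] at h1
  refine Complex.ofReal_injective ?_
  push_cast at h1 ⊢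
  exact h1

/-- `up = a†(c) ψ` and `down = a(c) ψ`, both square summable. -/
structure LadderPair (c : Fin n → ℂ) (ψ up down : FockSpace n) : Prop where
  up_apply : ∀ k, up k = adjCoeff (annihAt c) ψ k
  down_apply : ∀ k, down k = adjCoeff (creatAt c) ψ k

theorem sum_le_of_sum_cutoff_le {f : (Fin n → ℕ) → ℝ} (hf : ∀ k, 0 ≤ f k) {C : ℝ}
    (h : ∀ M, ∑ k ∈ cutoff n M, f k ≤ C) (s : Finset (Fin n → ℕ)) : ∑ k ∈ s, f k ≤ C := by
  obtain ⟨M, hM⟩ := (tendsto_cutoff.eventually (eventually_ge_atTop s)).exists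
  exact (Finset.sum_le_sum_of_subset_of_nonneg hM fun k _ _ => hf k).trans (h M)

theorem exists_of_sum_cutoff_le {f : (Fin n → ℕ) → ℂ} {C : ℝ}
    (h : ∀ M, ∑ k ∈ cutoff n M, ‖f k‖ ^ 2 ≤ C) :
    ∃ ψ : FockSpace n, (∀ k, ψ k = f k) ∧ ‖ψ‖ ^ 2 ≤ C := by
  have h1 := sum_le_of_sum_cutoff_le (fun k => sq_nonneg ‖f k‖) h
  have h2 : Memℓp f 2 := memℓp_gen' (C := C) fun s => by simpa using h1 s
  refine ⟨⟨f, h2⟩, fun k => rfl, ?_⟩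
  refine hasSum_le_of_sum_le (hasSum_norm_sq (⟨f, h2⟩ : FockSpace n)) h1

/-- The norm identity is applied to truncations, whose images are truncations of the coefficient
families; the bounds are uniform in the cutoff and pass to the full sums. -/
theorem exists_ladderPair_of_up {c : Fin n → ℂ} {ψ up : FockSpace n}
    (h : ∀ k, up k = adjCoeff (annihAt c) ψ k) :
    ∃ down, LadderPair c ψ up down ∧ ‖down‖ ^ 2 ≤ ‖up‖ ^ 2 := by
  have hf : adjCoeff (annihAt c) ψ = up := funext fun k => (h k).symm
  obtain ⟨down, h1, h2⟩ := exists_of_sum_cutoff_le (f := adjCoeff (creatAt c) ψ)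
    (C := ‖up‖ ^ 2) fun M => by
      have h3 := norm_incl_creatAt_sq c (trunc (M + 1) ψ)
      rw [annihAt_trunc, creatAt_trunc, hf, norm_incl_trunc_sq M] at h3
      have h4 := pow_le_pow_left₀ (norm_nonneg _) (norm_incl_trunc_le (M + 1 + 1) up) 2
      have h5 : 0 ≤ (∑ j, ‖c j‖ ^ 2) * ‖incl (trunc (M + 1) ψ)‖ ^ 2 := by positivity
      linarith
  exact ⟨down, ⟨h, h1⟩, h2⟩

theorem exists_ladderPair_of_down {c : Fin n → ℂ} {ψ down : FockSpace n}
    (h : ∀ k, down k = adjCoeff (creatAt c) ψ k) :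
    ∃ up, LadderPair c ψ up down ∧ ‖up‖ ^ 2 ≤ ‖down‖ ^ 2 + (∑ j, ‖c j‖ ^ 2) * ‖ψ‖ ^ 2 := by
  have hf : adjCoeff (creatAt c) ψ = down := funext fun k => (h k).symm
  obtain ⟨up, h1, h2⟩ := exists_of_sum_cutoff_le (f := adjCoeff (annihAt c) ψ)
    (C := ‖down‖ ^ 2 + (∑ j, ‖c j‖ ^ 2) * ‖ψ‖ ^ 2) fun M => by
      have h3 := norm_incl_creatAt_sq c (trunc (M + 1) ψ)
      rw [annihAt_trunc, creatAt_trunc, hf, norm_incl_trunc_sq (M + 1 + 1)] at h3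
      have h4 := pow_le_pow_left₀ (norm_nonneg _) (norm_incl_trunc_le M down) 2
      have h5 := pow_le_pow_left₀ (norm_nonneg _) (norm_incl_trunc_le (M + 1) ψ) 2
      -- The identity bounds the sum at level `M + 2`, because lowering loses one level and raising
      -- gains one; the sum at level `M` is smaller.
      have h6 : cutoff n M ⊆ cutoff n (M + 1 + 1) := fun k hk =>
        mem_cutoff.mpr ((mem_cutoff.mp hk).trans (by omega))
      have h7 := Finset.sum_le_sum_of_subset_of_nonneg h6
        (f := fun k => ‖adjCoeff (annihAt c) ψ k‖ ^ 2) fun k _ _ => sq_nonneg _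
      have h8 := mul_le_mul_of_nonneg_left h5
        (Finset.sum_nonneg fun j (_ : j ∈ Finset.univ) => sq_nonneg ‖c j‖)
      linarith
  exact ⟨up, ⟨h1, h⟩, h2⟩

theorem ladderPair_incl (c : Fin n → ℂ) (v : FiniteVectors n) :
    LadderPair c (incl v) (incl (creatAt c v)) (incl (annihAt c v)) where
  up_apply k := by
    rw [adjCoeff, inner_annihAt_left, incl_single, one_smul, inner_numberState_left]
  down_apply k := by
    rw [adjCoeff, inner_creatAt_left, incl_single, one_smul, inner_numberState_left]

/-- The image of a truncation is a truncation of the image, so truncations approximate `ψ` in graph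
norm. The same sequence `trunc (M + 1) ψ` serves for annihilation, as a limit of `a†(c) ± a(c)`
demands. -/
theorem LadderPair.tendsto_creatAt {c : Fin n → ℂ} {ψ up down : FockSpace n}
    (h : LadderPair c ψ up down) :
    Tendsto (fun M => incl (creatAt c (trunc (M + 1) ψ))) atTop (𝓝 up) := by
  have hf : adjCoeff (annihAt c) ψ = up := funext fun k => (h.up_apply k).symm
  simp only [creatAt_trunc, hf]
  exact (tendsto_incl_trunc up).comp (tendsto_add_atTop_nat 2)

theorem LadderPair.tendsto_annihAt {c : Fin n → ℂ} {ψ up down : FockSpace n}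
    (h : LadderPair c ψ up down) :
    Tendsto (fun M => incl (annihAt c (trunc (M + 1) ψ))) atTop (𝓝 down) := by
  have hf : adjCoeff (creatAt c) ψ = down := funext fun k => (h.down_apply k).symm
  simp only [annihAt_trunc, hf]
  exact tendsto_incl_trunc down

/-! ### The generators of the displacement groups -/

theorem symp_real_smul_self (s t : ℝ) (w : Fin n → ℂ) : symp (s • w) (t • w) = 0 := by
  refine Finset.sum_eq_zero fun j _ => ?_
  simp only [Pi.smul_apply, Complex.real_smul, map_mul, Complex.conj_ofReal]
  ring

theorem weyl_add_smul (s t : ℝ) (w : Fin n → ℂ) (x : FockSpace n) :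
    weyl ((s + t) • w) x = weyl (s • w) (weyl (t • w) x) := by
  rw [weyl_weyl, symp_real_smul_self, add_smul]
  simp

/-- On a finite vector `D(hw)` is a norm-convergent power series in `h`; after its first two terms,
the remainder is `O(h²)`. -/
theorem hasDerivAt_weyl_incl_zero (w : Fin n → ℂ) (v : FiniteVectors n) :
    HasDerivAt (fun t : ℝ => weyl (t • w) (incl v)) (incl (gen w v)) 0 := by
  rw [hasDerivAt_iff_isLittleO_nhds_zero]
  have hS := summable_norm_dispTerm w v
  have hO : (fun h : ℝ => weyl ((0 + h) • w) (incl v) - weyl ((0 : ℝ) • w) (incl v) -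
      h • incl (gen w v)) =O[𝓝 0] fun h : ℝ => h ^ 2 := by
    refine Asymptotics.IsBigO.of_bound (∑' m, ‖dispTerm w v m‖) ?_
    filter_upwards [Metric.ball_mem_nhds (0 : ℝ) one_pos] with h hh
    have hh1 : |h| ≤ 1 := by
      have : dist h 0 < 1 := hh
      rw [Real.dist_0_eq_abs] at this
      exact this.le
    have h1 : HasSum (fun m => ((h : ℂ) ^ m) • dispTerm w v m) (weyl (h • w) (incl v)) := by
      have h2 := hasSum_displacement (h • w) v
      rw [← weyl_incl] at h2
      convert h2 using 2 with m
      rw [dispTerm, dispTerm, gen_real_smul, smul_pow, LinearMap.smul_apply, map_smul, smul_comm]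
    have h3 := (hasSum_nat_add_iff' 2).mpr h1
    have h4 : weyl ((0 + h) • w) (incl v) - weyl ((0 : ℝ) • w) (incl v) - h • incl (gen w v) =
        weyl (h • w) (incl v) - ∑ i ∈ Finset.range 2, ((h : ℂ) ^ i) • dispTerm w v i := by
      rw [Finset.sum_range_succ, Finset.sum_range_one, zero_add, zero_smul, weyl_zero]
      simp only [dispTerm, pow_zero, pow_one, Nat.factorial_zero, Nat.factorial_one, Nat.cast_one,
        inv_one, one_smul, Module.End.one_apply]
      rw [sub_sub]
      rfl
    rw [h4, ← h3.tsum_eq, Real.norm_of_nonneg (sq_nonneg h), mul_comm, ← tsum_mul_left]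
    refine tsum_of_norm_bounded (g := fun m => h ^ 2 * ‖dispTerm w v (m + 2)‖)
      (((summable_nat_add_iff 2).mpr hS).mul_left _).hasSum (fun m => ?_) |>.trans ?_
    · rw [norm_smul, norm_pow, Complex.norm_real, Real.norm_eq_abs, pow_add, sq_abs]
      refine mul_le_mul_of_nonneg_right ?_ (norm_nonneg _)
      exact mul_le_of_le_one_left (sq_nonneg h) (pow_le_one₀ (abs_nonneg h) hh1)
    · rw [tsum_mul_left, tsum_mul_left]
      refine mul_le_mul_of_nonneg_left ?_ (sq_nonneg h)
      rw [← hS.sum_add_tsum_nat_add 2]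
      exact le_add_of_nonneg_left (Finset.sum_nonneg fun _ _ => norm_nonneg _)
  refine hO.trans_isLittleO ?_
  simpa using Asymptotics.isLittleO_pow_pow (𝕜 := ℝ) (m := 1) (n := 2) (by norm_num)

theorem hasDerivAt_weyl_incl (w : Fin n → ℂ) (v : FiniteVectors n) (t : ℝ) :
    HasDerivAt (fun t : ℝ => weyl (t • w) (incl v)) (weyl (t • w) (incl (gen w v))) t := by
  have h1 : HasDerivAt (fun s : ℝ => weyl (s • w) (incl v)) (incl (gen w v)) (t - t) := by
    rw [sub_self]
    exact hasDerivAt_weyl_incl_zero w v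
  have h2 := h1.comp_sub_const t t
  have h3 := ((weyl (t • w)).toContinuousLinearMap.restrictScalars ℝ).hasFDerivAt.comp_hasDerivAt
    t h2
  refine h3.congr_of_eventuallyEq (Eventually.of_forall fun s => ?_)
  change weyl (s • w) (incl v) = weyl (t • w) (weyl ((s - t) • w) (incl v))
  rw [← weyl_add_smul, add_sub_cancel]

/-- The generator is closed: since the `D(tw)` are isometries, the derivatives of the approximants
converge uniformly in `t`, so the limit may be differentiated. -/
theorem hasDerivAt_weyl_of_tendsto {w : Fin n → ℂ} {ψ η : FockSpace n} {v : ℕ → FiniteVectors n}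
    (h1 : Tendsto (fun M => incl (v M)) atTop (𝓝 ψ))
    (h2 : Tendsto (fun M => incl (gen w (v M))) atTop (𝓝 η)) (t : ℝ) :
    HasDerivAt (fun t : ℝ => weyl (t • w) ψ) (weyl (t • w) η) t := by
  refine hasDerivAt_of_tendstoUniformly (l := atTop)
    (f := fun M t => weyl (t • w) (incl (v M)))
    (f' := fun M t => weyl (t • w) (incl (gen w (v M)))) (g' := fun t => weyl (t • w) η) ?_
    (Eventually.of_forall fun M x => hasDerivAt_weyl_incl w (v M) x)
    (fun x => ((weyl (x • w)).continuous.tendsto ψ).comp h1) t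
  rw [Metric.tendstoUniformly_iff]
  intro ε hε
  filter_upwards [Metric.tendsto_nhds.mp h2 ε hε] with M hM x
  rw [(weyl (x • w)).dist_map, dist_comm]
  exact hM

theorem LadderPair.hasDerivAt_weyl {c : Fin n → ℂ} {ψ up down : FockSpace n}
    (h : LadderPair c ψ up down) (t : ℝ) :
    HasDerivAt (fun t : ℝ => weyl (t • c) ψ) (weyl (t • c) (up - down)) t := by
  refine hasDerivAt_weyl_of_tendsto ((tendsto_incl_trunc ψ).comp (tendsto_add_atTop_nat 1)) ?_ t
  refine (h.tendsto_creatAt.sub h.tendsto_annihAt).congr fun M => ?_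
  rw [gen, LinearMap.sub_apply, map_sub]

/-- As `a(z)` is antilinear in `z`, the generator along `ic` is `i(a†(c) + a(c))`. The sum and the
difference of the ladder operators are thus both derivatives. -/
theorem LadderPair.hasDerivAt_weyl_I {c : Fin n → ℂ} {ψ up down : FockSpace n}
    (h : LadderPair c ψ up down) (t : ℝ) :
    HasDerivAt (fun t : ℝ => weyl (t • (Complex.I • c)) ψ)
      (weyl (t • (Complex.I • c)) (Complex.I • (up + down))) t := by
  refine hasDerivAt_weyl_of_tendsto ((tendsto_incl_trunc ψ).comp (tendsto_add_atTop_nat 1)) ?_ t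
  refine ((h.tendsto_creatAt.add h.tendsto_annihAt).const_smul Complex.I).congr fun M => ?_
  rw [gen, creatAt_smul, annihAt_smul, LinearMap.sub_apply, LinearMap.smul_apply,
    LinearMap.smul_apply, map_sub, map_smul, map_smul, Complex.conj_I, smul_add, neg_smul,
    sub_neg_eq_add]

/-! ### Matrix coefficients of the displacement operators -/

section MatrixCoefficients

variable {ι : Type*}

/-- Families of vectors with summable squared norms. -/
def SqSummable (ψ : ι → FockSpace n) : Prop := Summable fun l => ‖ψ l‖ ^ 2

theorem SqSummable.summable_mul {η ψ : ι → FockSpace n} (hη : SqSummable η) (hψ : SqSummable ψ) :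
    Summable fun l => ‖η l‖ * ‖ψ l‖ := by
  refine Summable.of_nonneg_of_le (fun l => by positivity) (fun l => ?_) (hη.add hψ)
  nlinarith [sq_nonneg (‖η l‖ - ‖ψ l‖), sq_nonneg ‖η l‖, sq_nonneg ‖ψ l‖]

theorem SqSummable.add {η ψ : ι → FockSpace n} (hη : SqSummable η) (hψ : SqSummable ψ) :
    SqSummable fun l => η l + ψ l := by
  refine Summable.of_nonneg_of_le (fun l => by positivity) (fun l => ?_)
    ((Summable.add hη hψ).mul_left 2)
  have := pow_le_pow_left₀ (norm_nonneg _) (norm_add_le (η l) (ψ l)) 2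
  nlinarith [sq_nonneg (‖η l‖ - ‖ψ l‖)]

theorem SqSummable.const_smul {ψ : ι → FockSpace n} (hψ : SqSummable ψ) (a : ℂ) :
    SqSummable fun l => a • ψ l := by
  simp only [SqSummable, norm_smul, mul_pow]
  exact hψ.mul_left _

theorem SqSummable.neg {ψ : ι → FockSpace n} (hψ : SqSummable ψ) : SqSummable fun l => -ψ l := by
  simpa [SqSummable] using hψ

theorem SqSummable.sub {η ψ : ι → FockSpace n} (hη : SqSummable η) (hψ : SqSummable ψ) :
    SqSummable fun l => η l - ψ l := by
  simpa only [sub_eq_add_neg] using hη.add hψ.neg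

theorem SqSummable.weyl {ψ : ι → FockSpace n} (hψ : SqSummable ψ) (z : Fin n → ℂ) :
    SqSummable fun l => weyl z (ψ l) := by
  simpa [SqSummable] using hψ

/-- The matrix coefficient `∑ ⟨η_l, D(z) ψ_l⟩`. -/
def matCoeff (η ψ : ι → FockSpace n) (z : Fin n → ℂ) : ℂ := ∑' l, inner ℂ (η l) (weyl z (ψ l))

theorem norm_inner_weyl_le (x y : FockSpace n) (z : Fin n → ℂ) :
    ‖inner ℂ x (weyl z y)‖ ≤ ‖x‖ * ‖y‖ := by
  refine (norm_inner_le_norm _ _).trans (le_of_eq ?_)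
  rw [(weyl z).norm_map]

theorem hasSum_matCoeff {η ψ : ι → FockSpace n} (hη : SqSummable η) (hψ : SqSummable ψ)
    (z : Fin n → ℂ) :
    HasSum (fun l => inner ℂ (η l) (weyl z (ψ l))) (matCoeff η ψ z) :=
  (Summable.of_norm_bounded (hη.summable_mul hψ) fun _ => norm_inner_weyl_le _ _ z).hasSum

theorem matCoeff_sub_right {η ψ θ : ι → FockSpace n} (hη : SqSummable η) (hψ : SqSummable ψ)
    (hθ : SqSummable θ) (z : Fin n → ℂ) :
    matCoeff η (fun l => ψ l - θ l) z = matCoeff η ψ z - matCoeff η θ z := by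
  rw [← ((hasSum_matCoeff hη hψ z).sub (hasSum_matCoeff hη hθ z)).tsum_eq]
  simp [matCoeff]

theorem matCoeff_add_right {η ψ θ : ι → FockSpace n} (hη : SqSummable η) (hψ : SqSummable ψ)
    (hθ : SqSummable θ) (z : Fin n → ℂ) :
    matCoeff η (fun l => ψ l + θ l) z = matCoeff η ψ z + matCoeff η θ z := by
  rw [← ((hasSum_matCoeff hη hψ z).add (hasSum_matCoeff hη hθ z)).tsum_eq]
  simp [matCoeff]

theorem matCoeff_smul_right (η ψ : ι → FockSpace n) (a : ℂ) (z : Fin n → ℂ) :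
    matCoeff η (fun l => a • ψ l) z = a * matCoeff η ψ z := by
  simp [matCoeff, tsum_mul_left]

theorem matCoeff_neg_right (η ψ : ι → FockSpace n) (z : Fin n → ℂ) :
    matCoeff η (fun l => -ψ l) z = -matCoeff η ψ z := by
  simp [matCoeff, tsum_neg]

theorem matCoeff_neg_left (η ψ : ι → FockSpace n) (z : Fin n → ℂ) :
    matCoeff (fun l => -η l) ψ z = -matCoeff η ψ z := by
  simp [matCoeff, tsum_neg]

theorem matCoeff_eq_conj (η ψ : ι → FockSpace n) (z : Fin n → ℂ) :
    matCoeff η ψ z = conj (matCoeff ψ η (-z)) := by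
  rw [matCoeff, matCoeff, Complex.conj_tsum]
  refine tsum_congr fun l => ?_
  rw [inner_conj_symm, inner_weyl_left, neg_neg]

theorem conj_symp (z w : Fin n → ℂ) : conj (symp z w) = -symp z w := by
  simp only [symp, map_sum, map_sub, map_mul, Complex.conj_conj, ← Finset.sum_neg_distrib]
  refine Finset.sum_congr rfl fun j _ => ?_
  ring

theorem symp_neg_left (z w : Fin n → ℂ) : symp (-z) w = -symp z w := by
  simp only [symp, ← Finset.sum_neg_distrib, Pi.neg_apply, map_neg]
  refine Finset.sum_congr rfl fun j _ => ?_
  ring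

theorem symp_real_smul_right (t : ℝ) (z w : Fin n → ℂ) : symp z (t • w) = t * symp z w := by
  simp only [symp, Finset.mul_sum, Pi.smul_apply, Complex.real_smul, map_mul, Complex.conj_ofReal]
  refine Finset.sum_congr rfl fun j _ => ?_
  ring

/-- `θ` is the image of `ψ` under the generator of the displacements along `w`. -/
def HasGenerator (w : Fin n → ℂ) (ψ θ : ι → FockSpace n) : Prop :=
  ∀ l, ∀ t : ℝ, HasDerivAt (fun t : ℝ => weyl (t • w) (ψ l)) (weyl (t • w) (θ l)) t

/-- Split `D(z + tw) = exp(-t symp(z,w)/2) D(z) D(tw)`. The phase contributes the `symp` term. With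
`D(z)` moved onto `η`, the termwise derivatives are dominated by `‖η l‖ ‖θ l‖` for all `t`, so the
series may be differentiated. -/
theorem hasLineDerivAt_matCoeff_right {η ψ θ : ι → FockSpace n} {w : Fin n → ℂ}
    (hη : SqSummable η) (hψ : SqSummable ψ) (hθ : SqSummable θ) (h : HasGenerator w ψ θ)
    (z : Fin n → ℂ) :
    HasLineDerivAt ℝ (matCoeff η ψ) (matCoeff η θ z - symp z w / 2 * matCoeff η ψ z) z w := by
  set ζ : ι → FockSpace n := fun l => weyl (-z) (η l) with hζdef
  have hζ : SqSummable ζ := hη.weyl (-z)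
  have h1 : ∀ t : ℝ, matCoeff η ψ (z + t • w) =
      Complex.exp (-(t * symp z w) / 2) * ∑' l, inner ℂ (ζ l) (weyl (t • w) (ψ l)) := fun t => by
    rw [← tsum_mul_left, matCoeff]
    refine tsum_congr fun l => ?_
    rw [weyl_add, symp_real_smul_right, inner_smul_right, hζdef, inner_weyl_left, neg_neg]
  have h2 : HasDerivAt (fun t : ℝ => ∑' l, inner ℂ (ζ l) (weyl (t • w) (ψ l)))
      (∑' l, inner ℂ (ζ l) (weyl ((0 : ℝ) • w) (θ l))) 0 := by
    refine hasDerivAt_tsum (𝕜 := ℝ) (u := fun l => ‖ζ l‖ * ‖θ l‖)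
      (g := fun l (t : ℝ) => inner ℂ (ζ l) (weyl (t • w) (ψ l)))
      (g' := fun l (t : ℝ) => inner ℂ (ζ l) (weyl (t • w) (θ l)))
      (hζ.summable_mul hθ) (fun l t => ?_) (fun l t => norm_inner_weyl_le _ _ _) (y₀ := 0) ?_ 0
    · exact ((innerSL ℂ (ζ l)).restrictScalars ℝ).hasFDerivAt.comp_hasDerivAt t (h l t)
    · exact (hasSum_matCoeff hζ hψ _).summable
  have h3 : HasDerivAt (fun t : ℝ => Complex.exp (-((t : ℂ) * symp z w) / 2))
      (Complex.exp (-(((0 : ℝ) : ℂ) * symp z w) / 2) * (-(1 * symp z w) / 2)) 0 :=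
    (((HasDerivAt.ofReal_comp (hasDerivAt_id (0 : ℝ))).mul_const (symp z w)).neg.div_const 2).cexp
  have h4 := h3.mul h2
  have h5 : ∑' l, inner ℂ (ζ l) (weyl ((0 : ℝ) • w) (θ l)) = matCoeff η θ z := by
    rw [matCoeff]
    refine tsum_congr fun l => ?_
    rw [zero_smul, weyl_zero, hζdef, inner_weyl_left, neg_neg]
  have h6 : ∑' l, inner ℂ (ζ l) (weyl ((0 : ℝ) • w) (ψ l)) = matCoeff η ψ z := by
    rw [matCoeff]
    refine tsum_congr fun l => ?_
    rw [zero_smul, weyl_zero, hζdef, inner_weyl_left, neg_neg]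
  rw [h5, h6] at h4
  refine HasDerivAt.congr_deriv (h4.congr_of_eventuallyEq (Eventually.of_forall h1)) ?_
  simp only [Complex.ofReal_zero, zero_mul, neg_zero, zero_div, Complex.exp_zero]
  ring

/-- The adjoint symmetry `f_{η,ψ}(z) = conj f_{ψ,η}(-z)` transfers the previous derivative to the
left vector; the reflection of `z` reverses both signs. -/
theorem hasLineDerivAt_matCoeff_left {η ψ ζ : ι → FockSpace n} {w : Fin n → ℂ}
    (hη : SqSummable η) (hψ : SqSummable ψ) (hζ : SqSummable ζ) (h : HasGenerator w η ζ)
    (z : Fin n → ℂ) :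
    HasLineDerivAt ℝ (matCoeff η ψ) (-matCoeff ζ ψ z + symp z w / 2 * matCoeff η ψ z) z w := by
  have h1 := hasLineDerivAt_matCoeff_right hψ hη hζ h (-z)
  unfold HasLineDerivAt at h1 ⊢
  have h2 : HasDerivAt (fun t : ℝ => matCoeff ψ η (-z + t • w))
      (matCoeff ψ ζ (-z) - symp (-z) w / 2 * matCoeff ψ η (-z)) (-0) := by
    rwa [neg_zero]
  have h3 := h2.scomp (0 : ℝ) (hasDerivAt_neg' (0 : ℝ))
  have h4 := Complex.conjCLE.toContinuousLinearMap.hasFDerivAt.comp_hasDerivAt (0 : ℝ) h3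
  have h5 : ∀ t : ℝ, matCoeff η ψ (z + t • w) = conj (matCoeff ψ η (-z + (-t) • w)) := fun t => by
    rw [matCoeff_eq_conj, neg_add, neg_smul]
  simp only [h5]
  refine h4.congr_deriv ?_
  rw [matCoeff_eq_conj ζ ψ z, matCoeff_eq_conj η ψ z]
  have h6 : conj (2 : ℂ) = 2 := Complex.conj_ofNat 2
  simp [symp_neg_left, conj_symp, h6]
  ring

theorem dz_of_hasLineDerivAt {f : (Fin n → ℂ) → ℂ} {a b : ℂ} {z c : Fin n → ℂ}
    (h1 : HasLineDerivAt ℝ f a z c) (h2 : HasLineDerivAt ℝ f b z (Complex.I • c)) :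
    dz c f z = (a - Complex.I * b) / 2 := by
  rw [dz, h1.lineDeriv, h2.lineDeriv]

theorem dzbar_of_hasLineDerivAt {f : (Fin n → ℂ) → ℂ} {a b : ℂ} {z c : Fin n → ℂ}
    (h1 : HasLineDerivAt ℝ f a z c) (h2 : HasLineDerivAt ℝ f b z (Complex.I • c)) :
    dzbar c f z = (a + Complex.I * b) / 2 := by
  rw [dzbar, h1.lineDeriv, h2.lineDeriv]

theorem symp_eq (z c : Fin n → ℂ) :
    symp z c = ∑ j, conj (c j) * z j - ∑ j, c j * conj (z j) := by
  rw [symp, Finset.sum_sub_distrib]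
  simp only [mul_comm]

theorem symp_I_smul (z c : Fin n → ℂ) :
    symp z (Complex.I • c) = -Complex.I * (∑ j, conj (c j) * z j + ∑ j, c j * conj (z j)) := by
  rw [symp, ← Finset.sum_add_distrib, Finset.mul_sum]
  refine Finset.sum_congr rfl fun j _ => ?_
  simp only [Pi.smul_apply, smul_eq_mul, map_mul, Complex.conj_I]
  ring

/-- Families of vectors on which `a(c)` and `a†(c)` act, with square summable images. -/
structure LadderFamily (c : Fin n → ℂ) (ψ up down : ι → FockSpace n) : Prop where
  pair : ∀ l, LadderPair c (ψ l) (up l) (down l)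
  sq : SqSummable ψ
  sq_up : SqSummable up
  sq_down : SqSummable down

theorem LadderFamily.hasGenerator {c : Fin n → ℂ} {ψ up down : ι → FockSpace n}
    (h : LadderFamily c ψ up down) : HasGenerator c ψ fun l => up l - down l :=
  fun l t => (h.pair l).hasDerivAt_weyl t

theorem LadderFamily.hasGenerator_I {c : Fin n → ℂ} {ψ up down : ι → FockSpace n}
    (h : LadderFamily c ψ up down) :
    HasGenerator (Complex.I • c) ψ fun l => Complex.I • (up l + down l) :=
  fun l t => (h.pair l).hasDerivAt_weyl_I t

section Right

variable {c : Fin n → ℂ} {η ψ up down : ι → FockSpace n}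

/-- The derivatives along `c` and `ic` bring `up - down` and `i(up + down)`; the Wirtinger
combination cancels `down` here, and cancels `up` for the conjugate derivative. -/
theorem dz_matCoeff_right (hη : SqSummable η) (h : LadderFamily c ψ up down)
    (z : Fin n → ℂ) :
    dz c (matCoeff η ψ) z = matCoeff η up z + (∑ j, c j * conj (z j)) / 2 * matCoeff η ψ z := by
  rw [dz_of_hasLineDerivAt
    (hasLineDerivAt_matCoeff_right hη h.sq (h.sq_up.sub h.sq_down) h.hasGenerator z)
    (hasLineDerivAt_matCoeff_right hη h.sq ((h.sq_up.add h.sq_down).const_smul _)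
      h.hasGenerator_I z), matCoeff_smul_right, matCoeff_sub_right hη h.sq_up h.sq_down,
    matCoeff_add_right hη h.sq_up h.sq_down, symp_eq, symp_I_smul]
  ring_nf
  simp only [Complex.I_sq]
  ring

theorem dzbar_matCoeff_right (hη : SqSummable η) (h : LadderFamily c ψ up down)
    (z : Fin n → ℂ) :
    dzbar c (matCoeff η ψ) z =
      -matCoeff η down z - (∑ j, conj (c j) * z j) / 2 * matCoeff η ψ z := by
  rw [dzbar_of_hasLineDerivAt
    (hasLineDerivAt_matCoeff_right hη h.sq (h.sq_up.sub h.sq_down) h.hasGenerator z)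
    (hasLineDerivAt_matCoeff_right hη h.sq ((h.sq_up.add h.sq_down).const_smul _)
      h.hasGenerator_I z), matCoeff_smul_right, matCoeff_sub_right hη h.sq_up h.sq_down,
    matCoeff_add_right hη h.sq_up h.sq_down, symp_eq, symp_I_smul]
  ring_nf
  simp only [Complex.I_sq]
  ring

theorem dirDifferentiable_matCoeff_right (hη : SqSummable η) (h : LadderFamily c ψ up down) :
    DirDifferentiable c (matCoeff η ψ) := fun z =>
  ⟨(hasLineDerivAt_matCoeff_right hη h.sq (h.sq_up.sub h.sq_down)
      h.hasGenerator z).lineDifferentiableAt,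
    (hasLineDerivAt_matCoeff_right hη h.sq ((h.sq_up.add h.sq_down).const_smul _)
      h.hasGenerator_I z).lineDifferentiableAt⟩

end Right

section Left

variable {c : Fin n → ℂ} {η ψ up down : ι → FockSpace n}

theorem matCoeff_sub_left (hψ : SqSummable ψ) (h : LadderFamily c η up down)
    (z : Fin n → ℂ) :
    matCoeff (fun l => up l - down l) ψ z =
    matCoeff up ψ z - matCoeff down ψ z := by
  rw [matCoeff_eq_conj, matCoeff_sub_right hψ h.sq_up h.sq_down, map_sub, ← matCoeff_eq_conj,
    ← matCoeff_eq_conj]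

theorem matCoeff_I_smul_left (hψ : SqSummable ψ) (h : LadderFamily c η up down)
    (z : Fin n → ℂ) :
    matCoeff (fun l => Complex.I • (up l + down l)) ψ z =
    -Complex.I * (matCoeff up ψ z + matCoeff down ψ z) := by
  rw [matCoeff_eq_conj, matCoeff_smul_right, matCoeff_add_right hψ h.sq_up h.sq_down, map_mul,
    map_add, ← matCoeff_eq_conj, ← matCoeff_eq_conj, Complex.conj_I]

theorem dz_matCoeff_left (hψ : SqSummable ψ) (h : LadderFamily c η up down)
    (z : Fin n → ℂ) :
    dz c (matCoeff η ψ) z = matCoeff down ψ z - (∑ j, c j * conj (z j)) / 2 * matCoeff η ψ z := by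
  rw [dz_of_hasLineDerivAt
    (hasLineDerivAt_matCoeff_left h.sq hψ (h.sq_up.sub h.sq_down) h.hasGenerator z)
    (hasLineDerivAt_matCoeff_left h.sq hψ ((h.sq_up.add h.sq_down).const_smul _)
      h.hasGenerator_I z), matCoeff_I_smul_left hψ h, matCoeff_sub_left hψ h, symp_eq, symp_I_smul]
  ring_nf
  simp only [Complex.I_sq]
  ring

theorem dzbar_matCoeff_left (hψ : SqSummable ψ) (h : LadderFamily c η up down)
    (z : Fin n → ℂ) :
    dzbar c (matCoeff η ψ) z =
      -matCoeff up ψ z + (∑ j, conj (c j) * z j) / 2 * matCoeff η ψ z := by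
  rw [dzbar_of_hasLineDerivAt
    (hasLineDerivAt_matCoeff_left h.sq hψ (h.sq_up.sub h.sq_down) h.hasGenerator z)
    (hasLineDerivAt_matCoeff_left h.sq hψ ((h.sq_up.add h.sq_down).const_smul _)
      h.hasGenerator_I z), matCoeff_I_smul_left hψ h, matCoeff_sub_left hψ h, symp_eq, symp_I_smul]
  ring_nf
  simp only [Complex.I_sq]
  ring

theorem dirDifferentiable_matCoeff_left (hψ : SqSummable ψ) (h : LadderFamily c η up down) :
    DirDifferentiable c (matCoeff η ψ) := fun z =>
  ⟨(hasLineDerivAt_matCoeff_left h.sq hψ (h.sq_up.sub h.sq_down)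
      h.hasGenerator z).lineDifferentiableAt,
    (hasLineDerivAt_matCoeff_left h.sq hψ ((h.sq_up.add h.sq_down).const_smul _)
      h.hasGenerator_I z).lineDifferentiableAt⟩

end Left

/-- The images under the operator that acts on state vectors: `a†(c)` under addition, `a(c)` under
subtraction. -/
def PhotonProcess.pick {α : Type*} (s : PhotonProcess) (up down : α) : α :=
  match s with
  | .addition => up
  | .subtraction => down

section Both

variable {c : Fin n → ℂ} {η ηup ηdown ψ up down : ι → FockSpace n}

/-- The same derivative can be charged to either vector, with opposite phase terms. The sign in
`charOpBar` selects the side on which the phase term cancels: the left for addition, the right for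
subtraction. -/
theorem charOpBar_matCoeff (s : PhotonProcess) (hη : LadderFamily c η ηup ηdown)
    (hψ : LadderFamily c ψ up down) :
    charOpBar s c (matCoeff η ψ) =
      s.pick (matCoeff (fun l => -ηup l) ψ) (matCoeff η fun l => -down l) := by
  funext z
  cases s with
  | addition =>
    rw [charOpBar, dzbar_matCoeff_left hψ.sq hη, PhotonProcess.sign, PhotonProcess.pick,
      matCoeff_neg_left]
    ring
  | subtraction =>
    rw [charOpBar, dzbar_matCoeff_right hη.sq hψ, PhotonProcess.sign, PhotonProcess.pick,
      matCoeff_neg_right]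
    ring

/-- The second operator acts on the vector that the first one left untouched. No second-order ladder
image occurs, so square summability of the first-order images suffices. -/
theorem charOp_charOpBar_matCoeff (s : PhotonProcess) (hη : LadderFamily c η ηup ηdown)
    (hψ : LadderFamily c ψ up down) (z : Fin n → ℂ) :
    charOp s c (charOpBar s c (matCoeff η ψ)) z =
      -matCoeff (s.pick ηup ηdown) (s.pick up down) z := by
  rw [charOpBar_matCoeff s hη hψ]
  cases s with
  | addition =>
    simp only [charOp, PhotonProcess.pick, PhotonProcess.sign]
    rw [dz_matCoeff_right hη.sq_up.neg hψ, matCoeff_neg_left, matCoeff_neg_left]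
    ring
  | subtraction =>
    simp only [charOp, PhotonProcess.pick, PhotonProcess.sign]
    rw [dz_matCoeff_left hψ.sq_down.neg hη, matCoeff_neg_right, matCoeff_neg_right]
    ring

theorem dirDifferentiable_charOpBar_matCoeff (s : PhotonProcess) (hη : LadderFamily c η ηup ηdown)
    (hψ : LadderFamily c ψ up down) : DirDifferentiable c (charOpBar s c (matCoeff η ψ)) := by
  rw [charOpBar_matCoeff s hη hψ]
  cases s with
  | addition => exact dirDifferentiable_matCoeff_right hη.sq_up.neg hψ
  | subtraction => exact dirDifferentiable_matCoeff_left hψ.sq_down.neg hη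

end Both

end MatrixCoefficients

/-! ### States as mixtures of vectors -/

section Mixtures

variable {ι : Type*}

theorem hasSum_of_eq {E : Type*} [AddCommMonoid E] [TopologicalSpace E] {f g : ι → E} {a : E}
    (h : HasSum f a) (hfg : ∀ l, f l = g l) : HasSum g a :=
  funext hfg ▸ h

/-- The operator `ρ` is the sum of the operators `|ψ_l⟩⟨ψ_l|`, and its trace is finite. -/
structure Mixture (ρ : FockSpace n →L[ℂ] FockSpace n) (ψ : ι → FockSpace n) : Prop where
  sq : SqSummable ψ
  hasSum : ∀ u v, HasSum (fun l => inner ℂ u (ψ l) * inner ℂ (ψ l) v) (inner ℂ u (ρ v))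

theorem SqSummable.summable_apply {ψ : ι → FockSpace n} (hψ : SqSummable ψ) :
    Summable fun p : ι × (Fin n → ℕ) => ‖ψ p.1 p.2‖ ^ 2 := by
  rw [summable_prod_of_nonneg fun p => sq_nonneg _]
  refine ⟨fun l => (hasSum_norm_sq (ψ l)).summable, ?_⟩
  simp only [(hasSum_norm_sq (ψ _)).tsum_eq]
  exact hψ

/-- Summing the double family over `l` first gives the trace in the number basis; over `k` first,
Parseval gives the matrix coefficients. The products are dominated by the sum of two square summable
families, so the order is immaterial. -/
theorem Mixture.hasSum_weyl {ρ : FockSpace n →L[ℂ] FockSpace n} {ψ : ι → FockSpace n}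
    (h : Mixture ρ ψ) (z : Fin n → ℂ) :
    HasSum (fun k => inner ℂ (numberState k) (ρ (weyl z (numberState k)))) (matCoeff ψ ψ z) := by
  set F : ι × (Fin n → ℕ) → ℂ := fun p =>
    inner ℂ (numberState p.2) (ψ p.1) * inner ℂ (ψ p.1) (weyl z (numberState p.2)) with hF
  have hs : Summable F := by
    refine Summable.of_norm_bounded
      (h.sq.summable_apply.add (h.sq.weyl (-z)).summable_apply) fun p => ?_
    have h1 : ‖inner ℂ (ψ p.1) (weyl z (numberState p.2))‖ = ‖weyl (-z) (ψ p.1) p.2‖ := by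
      rw [← norm_inner_symm, inner_weyl_left, inner_numberState_left]
    rw [hF, norm_mul, h1, inner_numberState_left]
    nlinarith [sq_nonneg (‖ψ p.1 p.2‖ - ‖weyl (-z) (ψ p.1) p.2‖), sq_nonneg ‖ψ p.1 p.2‖,
      sq_nonneg ‖weyl (-z) (ψ p.1) p.2‖]
  have h1 : HasSum (fun k => inner ℂ (numberState k) (ρ (weyl z (numberState k)))) (∑' p, F p) := by
    have h2 : HasSum (fun p : (Fin n → ℕ) × ι => F p.swap) (∑' p, F p) :=
      (Equiv.prodComm _ _).hasSum_iff.mpr hs.hasSum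
    exact h2.prod_fiberwise fun k => h.hasSum (numberState k) (weyl z (numberState k))
  have h3 : HasSum (fun l => inner ℂ (ψ l) (weyl z (ψ l))) (∑' p, F p) := by
    refine hs.hasSum.prod_fiberwise fun l => ?_
    have h4 := hasSum_inner_mul_inner (weyl (-z) (ψ l)) (ψ l)
    simp only [inner_weyl_left, neg_neg] at h4
    simpa only [mul_comm] using h4
  rw [← h3.unique (hasSum_matCoeff h.sq h.sq z)]
  exact h1

theorem Mixture.charFn_eq {ρ : FockSpace n →L[ℂ] FockSpace n} {ψ : ι → FockSpace n}
    (h : Mixture ρ ψ) : charFn ρ = matCoeff ψ ψ := by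
  funext z
  rw [← (h.hasSum_weyl z).tsum_eq, charFn]
  simp only [weyl_numberState]

theorem matCoeff_self_zero (ψ : ι → FockSpace n) :
    matCoeff ψ ψ 0 = ((∑' l, ‖ψ l‖ ^ 2 : ℝ) : ℂ) := by
  rw [matCoeff, Complex.ofReal_tsum]
  refine tsum_congr fun l => ?_
  rw [weyl_zero, inner_self_eq_norm_sq_to_K]
  norm_cast

theorem Mixture.hasSum_trace {ρ : FockSpace n →L[ℂ] FockSpace n} {ψ : ι → FockSpace n}
    (h : Mixture ρ ψ) :
    HasSum (fun k => inner ℂ (numberState k) (ρ (numberState k)))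
      ((∑' l, ‖ψ l‖ ^ 2 : ℝ) : ℂ) := by
  have h1 := h.hasSum_weyl 0
  rw [matCoeff_self_zero] at h1
  simpa using h1

theorem Mixture.isPositive {ρ : FockSpace n →L[ℂ] FockSpace n} {ψ : ι → FockSpace n}
    (h : Mixture ρ ψ) : ρ.IsPositive := by
  have hconj : ∀ u v, inner ℂ u (ρ v) = conj (inner ℂ v (ρ u)) := fun u v => by
    refine (h.hasSum u v).unique ?_
    have h1 := (h.hasSum v u).mapL Complex.conjCLE.toContinuousLinearMap
    refine hasSum_of_eq h1 fun l => ?_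
    simp [mul_comm]
  refine ⟨fun u v => ?_, fun u => ?_⟩
  · change inner ℂ (ρ u) v = inner ℂ u (ρ v)
    rw [hconj u v, inner_conj_symm]
  · have h1 := (h.hasSum u u).mapL Complex.reCLM
    rw [ContinuousLinearMap.reApplyInnerSelf_apply, ← inner_conj_symm, RCLike.conj_re]
    refine h1.nonneg fun l => ?_
    rw [← inner_conj_symm u, ← Complex.normSq_eq_conj_mul_self]
    simpa using Complex.normSq_nonneg _

theorem exists_sqrt_of_isPositive {H : Type*} [NormedAddCommGroup H] [InnerProductSpace ℂ H]
    [CompleteSpace H] {T : H →L[ℂ] H} (hT : T.IsPositive) :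
    ∃ S : H →L[ℂ] H, S.IsPositive ∧ S * S = T := by
  have h0 : 0 ≤ T := (ContinuousLinearMap.nonneg_iff_isPositive T).mpr hT
  exact ⟨CFC.sqrt T, (ContinuousLinearMap.nonneg_iff_isPositive _).mp (CFC.sqrt_nonneg T),
    CFC.sqrt_mul_sqrt_self T h0⟩

/-- Take `ψ_l = √ρ |l⟩`. These need not be eigenvectors or orthogonal: Parseval for `√ρ u` and `√ρ
v` resolves `ρ`, and the trace is the sum of the squared norms. No spectral decomposition enters. -/
theorem IsDensityOperator.exists_mixture {ρ : FockSpace n →L[ℂ] FockSpace n}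
    (hρ : IsDensityOperator ρ) : ∃ ψ : (Fin n → ℕ) → FockSpace n, Mixture ρ ψ := by
  obtain ⟨S, hS', hS⟩ := exists_sqrt_of_isPositive hρ.pos
  have hsym : ∀ u v, inner ℂ (S u) v = inner ℂ u (S v) := fun u v => hS'.isSymmetric u v
  have hin : ∀ u v, inner ℂ (S u) (S v) = inner ℂ u (ρ v) := fun u v => by
    rw [hsym, ← hS]
    rfl
  refine ⟨fun l => S (numberState l), ?_, fun u v => ?_⟩
  · have h1 := (hρ.trace_one.mapL Complex.reCLM).summable
    refine h1.congr fun l => ?_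
    rw [← hin, inner_self_eq_norm_sq_to_K]
    norm_cast
  · have h1 := hasSum_inner_mul_inner (S u) (S v)
    rw [hin] at h1
    refine hasSum_of_eq h1 fun l => ?_
    rw [hsym, hsym]

theorem exists_mixture_of_sqSummable {χ : ι → FockSpace n} (hχ : SqSummable χ) :
    ∃ σ : FockSpace n →L[ℂ] FockSpace n, Mixture σ χ := by
  have hs : Summable fun l => InnerProductSpace.rankOne ℂ (χ l) (χ l) := by
    refine Summable.of_norm_bounded hχ fun l => ?_
    rw [InnerProductSpace.norm_rankOne, sq]
  refine ⟨∑' l, InnerProductSpace.rankOne ℂ (χ l) (χ l), hχ, fun u v => ?_⟩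
  have h1 := (hs.hasSum.mapL (ContinuousLinearMap.apply ℂ (FockSpace n) v)).mapL (innerSL ℂ u)
  refine hasSum_of_eq h1 fun l => ?_
  change inner ℂ u (inner ℂ (χ l) v • χ l) = _
  rw [inner_smul_right, mul_comm]

/-! ### The processed states -/

theorem inner_incl_of_adjCoeff {A : Module.End ℂ (FiniteVectors n)} {ψ χ : FockSpace n}
    (h : ∀ k, χ k = adjCoeff A ψ k) (u : FiniteVectors n) :
    inner ℂ (incl (A u)) ψ = inner ℂ (incl u) χ := by
  induction u using Finsupp.induction_linear with
  | zero => simp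
  | add u v hu hv => simp only [map_add, inner_add_left, hu, hv]
  | single k a =>
    have hk : (Finsupp.single k a : FiniteVectors n) = a • Finsupp.single k 1 := by simp
    rw [hk, map_smul, map_smul, map_smul, inner_smul_left, inner_smul_left, incl_single, one_smul,
      inner_numberState_left, h k, adjCoeff]

theorem LadderPair.norm_sq {c : Fin n → ℂ} {ψ up down : FockSpace n}
    (h : LadderPair c ψ up down) :
    ‖up‖ ^ 2 = ‖down‖ ^ 2 + (∑ j, ‖c j‖ ^ 2) * ‖ψ‖ ^ 2 := by
  refine tendsto_nhds_unique (h.tendsto_creatAt.norm.pow 2) ?_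
  simp only [norm_incl_creatAt_sq]
  exact (h.tendsto_annihAt.norm.pow 2).add
    ((((tendsto_incl_trunc ψ).comp (tendsto_add_atTop_nat 1)).norm.pow 2).const_mul _)

/-- All terms are nonnegative, so the exchange of sums is legitimate in `[0, ∞]` before finiteness
is known. -/
theorem Mixture.processTrace_eq {ρ : FockSpace n →L[ℂ] FockSpace n} {ψ : ι → FockSpace n}
    (h : Mixture ρ ψ) (s : PhotonProcess) (c : Fin n → ℂ) :
    processTrace s c ρ =
      ∑' l, ∑' k, ENNReal.ofReal (‖adjCoeff (s.rightOp c) (ψ l) k‖ ^ 2) := by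
  rw [processTrace, ENNReal.tsum_comm]
  refine tsum_congr fun k => ?_
  set u := incl (s.rightOp c (Finsupp.single k 1)) with hu
  have h1 : HasSum (fun l => ‖adjCoeff (s.rightOp c) (ψ l) k‖ ^ 2) (inner ℂ u (ρ u)).re := by
    have h2 := (h.hasSum u u).mapL Complex.reCLM
    refine hasSum_of_eq h2 fun l => ?_
    rw [← inner_conj_symm (ψ l) u, Complex.mul_conj, Complex.normSq_eq_norm_sq, adjCoeff]
    exact Complex.ofReal_re _
  rw [← h1.tsum_eq, ENNReal.ofReal_tsum_of_nonneg (fun l => sq_nonneg _) h1.summable]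

theorem exists_of_tsum_ne_top {f : ι → (Fin n → ℕ) → ℂ}
    (h : ∑' l, ∑' k, ENNReal.ofReal (‖f l k‖ ^ 2) ≠ ∞) :
    ∃ χ : ι → FockSpace n, (∀ l k, χ l k = f l k) ∧
      HasSum (fun l => ‖χ l‖ ^ 2) (∑' l, ∑' k, ENNReal.ofReal (‖f l k‖ ^ 2)).toReal := by
  have h1 : ∀ l, ∑' k, ENNReal.ofReal (‖f l k‖ ^ 2) ≠ ∞ := ENNReal.ne_top_of_tsum_ne_top h
  have h2 : ∀ l, ∃ χ : FockSpace n, (∀ k, χ k = f l k) := fun l => by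
    have h3 := ENNReal.summable_toReal (h1 l)
    simp only [ENNReal.toReal_ofReal (sq_nonneg _)] at h3
    exact ⟨⟨f l, memℓp_gen (by simpa using h3)⟩, fun k => rfl⟩
  choose χ hχ using h2
  have h4 : ∀ l, (∑' k, ENNReal.ofReal (‖f l k‖ ^ 2)).toReal = ‖χ l‖ ^ 2 := fun l => by
    rw [ENNReal.tsum_toReal_eq fun k => ENNReal.ofReal_ne_top]
    simp only [ENNReal.toReal_ofReal (sq_nonneg _), ← hχ l, (hasSum_norm_sq (χ l)).tsum_eq]
  refine ⟨χ, hχ, ?_⟩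
  rw [ENNReal.tsum_toReal_eq h1]
  simp only [h4]
  have h5 := ENNReal.summable_toReal h
  simp only [h4] at h5
  exact h5.hasSum

/-- The finite trace supplies the images under the operator of the process; the norm comparison
between `a†(c)` and `a(c)` supplies those under the other one. -/
theorem Mixture.exists_ladderFamily {ρ : FockSpace n →L[ℂ] FockSpace n} {ψ : ι → FockSpace n}
    (h : Mixture ρ ψ) {s : PhotonProcess} {c : Fin n → ℂ} (hfin : processTrace s c ρ ≠ ∞) :
    ∃ up down, LadderFamily c ψ up down ∧
      HasSum (fun l => ‖s.pick up down l‖ ^ 2) (processTrace s c ρ).toReal := by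
  rw [h.processTrace_eq] at hfin ⊢
  obtain ⟨χ, h1, h2⟩ := exists_of_tsum_ne_top hfin
  cases s with
  | addition =>
    choose down h3 h4 using fun l => exists_ladderPair_of_up (h1 l)
    exact ⟨χ, down, ⟨h3, h.sq, h2.summable,
      Summable.of_nonneg_of_le (fun l => sq_nonneg _) h4 h2.summable⟩, h2⟩
  | subtraction =>
    choose up h3 h4 using fun l => exists_ladderPair_of_down (h1 l)
    exact ⟨up, χ, ⟨h3, h.sq, Summable.of_nonneg_of_le (fun l => sq_nonneg _) h4
      (h2.summable.add (h.sq.mul_left _)), h2.summable⟩, h2⟩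

theorem LadderFamily.pick_apply {c : Fin n → ℂ} {ψ up down : ι → FockSpace n}
    (h : LadderFamily c ψ up down) (s : PhotonProcess) (l : ι) (k : Fin n → ℕ) :
    s.pick up down l k = adjCoeff (s.rightOp c) (ψ l) k := by
  cases s with
  | addition => exact (h.pair l).up_apply k
  | subtraction => exact (h.pair l).down_apply k

theorem LadderFamily.sq_pick {c : Fin n → ℂ} {ψ up down : ι → FockSpace n}
    (h : LadderFamily c ψ up down) (s : PhotonProcess) : SqSummable (s.pick up down) := by
  cases s with
  | addition => exact h.sq_up
  | subtraction => exact h.sq_down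

theorem isProcessed_unique {s : PhotonProcess} {c : Fin n → ℂ}
    {ρ σ σ' : FockSpace n →L[ℂ] FockSpace n} (h : IsProcessed s c ρ σ)
    (h' : IsProcessed s c ρ σ') : σ = σ' := by
  refine clm_ext fun k => fock_ext fun l => ?_
  have h1 := (h (Finsupp.single l 1) (Finsupp.single k 1)).trans
    (h' (Finsupp.single l 1) (Finsupp.single k 1)).symm
  simpa only [incl_single, one_smul] using h1

theorem normConst_nonneg (s : PhotonProcess) (c : Fin n → ℂ)
    (ρ : FockSpace n →L[ℂ] FockSpace n) : 0 ≤ normConst s c ρ :=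
  inv_nonneg.mpr ENNReal.toReal_nonneg

/-- The vectors of the normalized processed state. -/
def processedFamily (N : ℝ) (χ : ι → FockSpace n) (l : ι) : FockSpace n :=
  ((Real.sqrt N : ℝ) : ℂ) • χ l

theorem Mixture.isProcessed {ρ σ : FockSpace n →L[ℂ] FockSpace n} {ψ χ : ι → FockSpace n}
    (h : Mixture ρ ψ) {s : PhotonProcess} {c : Fin n → ℂ}
    (hχ : ∀ l k, χ l k = adjCoeff (s.rightOp c) (ψ l) k)
    (hσ : Mixture σ (processedFamily (normConst s c ρ) χ)) : IsProcessed s c ρ σ := by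
  intro u v
  refine (hσ.hasSum _ _).unique ?_
  refine hasSum_of_eq ((h.hasSum (incl (s.rightOp c u))
    (incl (s.rightOp c v))).mul_left (normConst s c ρ : ℂ)) fun l => ?_
  have hN : ((normConst s c ρ : ℝ) : ℂ) = ((Real.sqrt (normConst s c ρ) : ℝ) : ℂ) *
      ((Real.sqrt (normConst s c ρ) : ℝ) : ℂ) := by
    rw [← Complex.ofReal_mul, Real.mul_self_sqrt (normConst_nonneg _ _ _)]
  rw [inner_incl_of_adjCoeff (hχ l), ← inner_conj_symm (ψ l), inner_incl_of_adjCoeff (hχ l),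
    inner_conj_symm, hN, processedFamily, inner_smul_right, inner_smul_left, Complex.conj_ofReal]
  ring

theorem Mixture.exists_processed {ρ : FockSpace n →L[ℂ] FockSpace n} {ψ up down : ι → FockSpace n}
    (h : Mixture ρ ψ) (s : PhotonProcess) {c : Fin n → ℂ} (hL : LadderFamily c ψ up down) :
    ∃ σ, Mixture σ (processedFamily (normConst s c ρ) (s.pick up down)) ∧
      IsProcessed s c ρ σ := by
  obtain ⟨σ, hσ⟩ := exists_mixture_of_sqSummable
    ((hL.sq_pick s).const_smul ((Real.sqrt (normConst s c ρ) : ℝ) : ℂ))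
  exact ⟨σ, hσ, h.isProcessed (hL.pick_apply s) hσ⟩

theorem matCoeff_processedFamily {N : ℝ} (hN : 0 ≤ N) (χ : ι → FockSpace n) (z : Fin n → ℂ) :
    matCoeff (processedFamily N χ) (processedFamily N χ) z = N * matCoeff χ χ z := by
  have h : ((N : ℝ) : ℂ) = ((Real.sqrt N : ℝ) : ℂ) * ((Real.sqrt N : ℝ) : ℂ) := by
    rw [← Complex.ofReal_mul, Real.mul_self_sqrt hN]
  rw [h, matCoeff, matCoeff, ← tsum_mul_left]
  refine tsum_congr fun l => ?_
  rw [processedFamily, map_smul, inner_smul_right, inner_smul_left, Complex.conj_ofReal, mul_assoc]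

/-- Under addition `‖up l‖² = ‖down l‖² + ‖ψ l‖²`, so a vanishing trace would kill every `ψ l`,
against trace one. Subtraction can annihilate a state, such as the vacuum; there nonvanishing is
assumed. -/
theorem Mixture.processTrace_ne_zero {ρ : FockSpace n →L[ℂ] FockSpace n}
    (hρ : IsDensityOperator ρ) {ψ up down : ι → FockSpace n} (h : Mixture ρ ψ)
    {s : PhotonProcess} {c : Fin n → ℂ} (hc : ∑ j, ‖c j‖ ^ 2 = 1)
    (hs : s = PhotonProcess.subtraction → processTrace s c ρ ≠ 0)
    (hL : LadderFamily c ψ up down) : processTrace s c ρ ≠ 0 := by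
  cases s with
  | subtraction => exact hs rfl
  | addition =>
    intro h0
    rw [h.processTrace_eq, ENNReal.tsum_eq_zero] at h0
    have h1 : ∀ l, ‖ψ l‖ ^ 2 = 0 := fun l => by
      have h2 := ENNReal.tsum_eq_zero.mp (h0 l)
      have h3 : up l = 0 := by
        ext k
        have h4 := h2 k
        rw [ENNReal.ofReal_eq_zero] at h4
        have h5 : adjCoeff (annihAt c) (ψ l) k = 0 := by
          rw [← norm_eq_zero, ← sq_eq_zero_iff]
          exact le_antisymm h4 (sq_nonneg _)
        rw [(hL.pair l).up_apply k, h5]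
        rfl
      have h6 := (hL.pair l).norm_sq
      rw [h3, norm_zero, hc] at h6
      nlinarith [sq_nonneg ‖down l‖, sq_nonneg ‖ψ l‖]
    have h7 := h.hasSum_trace.unique hρ.trace_one
    simp [h1] at h7

theorem Mixture.isDensityOperator_processed {ρ σ : FockSpace n →L[ℂ] FockSpace n}
    (hρ : IsDensityOperator ρ) {ψ up down : ι → FockSpace n} (h : Mixture ρ ψ)
    {s : PhotonProcess} {c : Fin n → ℂ} (hc : ∑ j, ‖c j‖ ^ 2 = 1)
    (hs : s = PhotonProcess.subtraction → processTrace s c ρ ≠ 0)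
    (hfin : processTrace s c ρ ≠ ∞)
    (hL : LadderFamily c ψ up down)
    (hsum : HasSum (fun l => ‖s.pick up down l‖ ^ 2) (processTrace s c ρ).toReal)
    (hσ : Mixture σ (processedFamily (normConst s c ρ) (s.pick up down))) :
    IsDensityOperator σ := by
  refine ⟨hσ.isPositive, ?_⟩
  have h1 := hσ.hasSum_trace
  have h2 : ∑' l, ‖processedFamily (normConst s c ρ) (s.pick up down) l‖ ^ 2 = 1 := by
    simp only [processedFamily, norm_smul, mul_pow, Complex.norm_real, Real.norm_eq_abs, sq_abs,
      Real.sq_sqrt (normConst_nonneg s c ρ), tsum_mul_left, hsum.tsum_eq]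
    refine inv_mul_cancel₀ ?_
    rw [ENNReal.toReal_ne_zero]
    exact ⟨h.processTrace_ne_zero hρ hc hs hL, hfin⟩
  rw [h2] at h1
  simpa using h1

end Mixtures

/-! ### Gaussian averages of the displacement operators -/

/-- The Gaussian convergence factor. -/
def weight (ε : ℝ) (z : Fin n → ℂ) : ℝ := Real.exp (-ε * ∑ j, ‖z j‖ ^ 2)

theorem continuous_weight (ε : ℝ) : Continuous (weight (n := n) ε) := by
  unfold weight
  fun_prop

theorem weight_pos (ε : ℝ) (z : Fin n → ℂ) : 0 < weight ε z := Real.exp_pos _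

theorem weight_neg (ε : ℝ) (z : Fin n → ℂ) : weight ε (-z) = weight ε z := by simp [weight]

theorem integrable_weight {ε : ℝ} (hε : 0 < ε) : Integrable (weight (n := n) ε) := by
  have h1 : Integrable fun z : ℂ => Real.exp (-ε * ‖z‖ ^ 2) := by
    have h := GaussianFourier.integrable_cexp_neg_mul_sq_norm_add (V := ℂ) (b := (ε : ℂ))
      (by simpa using hε) 0 0
    refine h.norm.congr (Eventually.of_forall fun z => ?_)
    simp only [Complex.norm_exp]
    congr 1
    simp only [inner_zero_left, Complex.ofReal_zero, mul_zero, add_zero]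
    norm_cast
  have h2 := Integrable.fintype_prod (fun _ : Fin n => h1)
  refine h2.congr (Eventually.of_forall fun z => ?_)
  simp only [weight, Finset.mul_sum, Real.exp_sum]

/-- Continuous functions of at most quadratic growth. -/
def QuadBounded (G : (Fin n → ℂ) → ℂ) : Prop :=
  Continuous G ∧ ∃ A, ∀ z, ‖G z‖ ≤ A * (1 + ∑ j, ‖z j‖ ^ 2)

/-- Half of the Gaussian decay is spent on absorbing the quadratic factor. -/
theorem one_add_mul_weight_le {ε : ℝ} (hε : 0 < ε) (z : Fin n → ℂ) :
    (1 + ∑ j, ‖z j‖ ^ 2) * weight ε z ≤ (1 + 2 / ε) * weight (ε / 2) z := by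
  have hS : 0 ≤ ∑ j, ‖z j‖ ^ 2 := Finset.sum_nonneg fun j _ => sq_nonneg _
  unfold weight
  set S := ∑ j, ‖z j‖ ^ 2
  have h1 : Real.exp (-ε * S) = Real.exp (-(ε / 2) * S) * Real.exp (-(ε / 2) * S) := by
    rw [← Real.exp_add]; congr 1; ring
  have h2 : (1 + S) * Real.exp (-(ε / 2) * S) ≤ 1 + 2 / ε := by
    have h3 : ε / 2 * S + 1 ≤ Real.exp (ε / 2 * S) := Real.add_one_le_exp _
    have h4 : 1 + S ≤ (1 + 2 / ε) * Real.exp (ε / 2 * S) := by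
      have h5 : S = 2 / ε * (ε / 2 * S) := by field_simp
      have h6 : 0 < 2 / ε := by positivity
      have h7 : 0 ≤ ε / 2 * S := by positivity
      nlinarith [mul_le_mul_of_nonneg_left h3 h6.le]
    rw [neg_mul, Real.exp_neg]
    rw [← div_eq_mul_inv, div_le_iff₀ (Real.exp_pos _)]
    exact h4
  rw [h1, ← mul_assoc]
  exact mul_le_mul_of_nonneg_right h2 (Real.exp_pos _).le

theorem QuadBounded.integrable {G : (Fin n → ℂ) → ℂ} (hG : QuadBounded G) {ε : ℝ} (hε : 0 < ε) :
    Integrable fun z => (weight ε z : ℂ) * G z := by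
  obtain ⟨hc, A, hA⟩ := hG
  have h1 := ((integrable_weight (n := n) (half_pos hε)).const_mul (1 + 2 / ε)).const_mul |A|
  refine h1.mono' ?_ (Eventually.of_forall fun z => ?_)
  · exact ((Complex.continuous_ofReal.comp (continuous_weight ε)).mul hc).aestronglyMeasurable
  · have hS : 0 ≤ ∑ j, ‖z j‖ ^ 2 := Finset.sum_nonneg fun j _ => sq_nonneg _
    rw [norm_mul, Complex.norm_real, Real.norm_of_nonneg (weight_pos ε z).le]
    calc weight ε z * ‖G z‖ ≤ weight ε z * (|A| * (1 + ∑ j, ‖z j‖ ^ 2)) := by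
          refine mul_le_mul_of_nonneg_left ((hA z).trans ?_) (weight_pos ε z).le
          exact mul_le_mul_of_nonneg_right (le_abs_self A) (by positivity)
      _ = |A| * ((1 + ∑ j, ‖z j‖ ^ 2) * weight ε z) := by ring
      _ ≤ _ := mul_le_mul_of_nonneg_left (one_add_mul_weight_le hε z) (abs_nonneg A)

theorem QuadBounded.add {G H : (Fin n → ℂ) → ℂ} (hG : QuadBounded G) (hH : QuadBounded H) :
    QuadBounded fun z => G z + H z := by
  obtain ⟨hc, A, hA⟩ := hG
  obtain ⟨hc', B, hB⟩ := hH
  refine ⟨hc.add hc', A + B, fun z => (norm_add_le _ _).trans ?_⟩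
  rw [add_mul]
  exact add_le_add (hA z) (hB z)

theorem QuadBounded.const_mul {G : (Fin n → ℂ) → ℂ} (hG : QuadBounded G) (a : ℂ) :
    QuadBounded fun z => a * G z := by
  obtain ⟨hc, A, hA⟩ := hG
  refine ⟨continuous_const.mul hc, ‖a‖ * A, fun z => ?_⟩
  rw [norm_mul, mul_assoc]
  exact mul_le_mul_of_nonneg_left (hA z) (norm_nonneg _)

theorem QuadBounded.of_bounded {G : (Fin n → ℂ) → ℂ} (hc : Continuous G) {A : ℝ}
    (hA : ∀ z, ‖G z‖ ≤ A) : QuadBounded G := by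
  refine ⟨hc, A, fun z => (hA z).trans ?_⟩
  have hA0 : 0 ≤ A := (norm_nonneg _).trans (hA 0)
  exact le_mul_of_one_le_right hA0
    (le_add_of_nonneg_right (Finset.sum_nonneg fun j _ => sq_nonneg _))

theorem norm_sum_mul_le (c z : Fin n → ℂ) :
    ‖∑ j, conj (c j) * z j‖ ≤ (∑ j, ‖c j‖) * (1 + ∑ j, ‖z j‖ ^ 2) := by
  refine (norm_sum_le _ _).trans ?_
  rw [Finset.sum_mul]
  refine Finset.sum_le_sum fun j _ => ?_
  rw [norm_mul, RCLike.norm_conj]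
  refine mul_le_mul_of_nonneg_left ?_ (norm_nonneg _)
  have h := Finset.single_le_sum (fun j _ => sq_nonneg ‖z j‖) (Finset.mem_univ j)
  nlinarith [sq_nonneg (‖z j‖ - 1), sq_nonneg ‖z j‖]

theorem sum_mul_conj_eq (c z : Fin n → ℂ) :
    ∑ j, c j * conj (z j) = conj (∑ j, conj (c j) * z j) := by
  simp

theorem QuadBounded.linear_mul {G : (Fin n → ℂ) → ℂ} (hc : Continuous G) {A : ℝ}
    (hA : ∀ z, ‖G z‖ ≤ A) (c : Fin n → ℂ) :
    QuadBounded fun z => (∑ j, conj (c j) * z j) * G z := by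
  refine ⟨by fun_prop, (∑ j, ‖c j‖) * A, fun z => ?_⟩
  rw [norm_mul, mul_right_comm]
  exact mul_le_mul (norm_sum_mul_le c z) (hA z) (norm_nonneg _) (by positivity)

theorem QuadBounded.linear_conj_mul {G : (Fin n → ℂ) → ℂ} (hc : Continuous G) {A : ℝ}
    (hA : ∀ z, ‖G z‖ ≤ A) (c : Fin n → ℂ) :
    QuadBounded fun z => (∑ j, c j * conj (z j)) * G z := by
  refine ⟨by fun_prop, (∑ j, ‖c j‖) * A, fun z => ?_⟩
  rw [norm_mul, mul_right_comm, sum_mul_conj_eq, RCLike.norm_conj]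
  exact mul_le_mul (norm_sum_mul_le c z) (hA z) (norm_nonneg _) (by positivity)

/-! ### Integration by parts against the Gaussian weight -/

theorem hasLineDerivAt_weight (ε : ℝ) (z v : Fin n → ℂ) :
    HasLineDerivAt ℝ (fun z : Fin n → ℂ => (weight ε z : ℂ))
      (-ε * (∑ j, conj (v j) * z j + ∑ j, v j * conj (z j)) * weight ε z) z v := by
  have hw : ∀ z : Fin n → ℂ, (weight ε z : ℂ) = Complex.exp (-ε * ∑ j, z j * conj (z j)) := by
    intro z
    rw [weight, Complex.ofReal_exp]
    push_cast
    simp only [Complex.mul_conj, Complex.normSq_eq_norm_sq]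
    push_cast
    rfl
  unfold HasLineDerivAt
  simp only [hw]
  have h1 : ∀ j, HasDerivAt (fun t : ℝ => (z + t • v) j * conj ((z + t • v) j))
      (conj (v j) * z j + v j * conj (z j)) 0 := fun j => by
    have h2 : HasDerivAt (fun t : ℝ => z j + (t : ℂ) * v j) (1 * v j) 0 :=
      ((hasDerivAt_id (0 : ℝ)).ofReal_comp.mul_const (v j)).const_add (z j)
    have h3 : HasDerivAt (fun t : ℝ => conj (z j) + (t : ℂ) * conj (v j)) (1 * conj (v j)) 0 :=
      ((hasDerivAt_id (0 : ℝ)).ofReal_comp.mul_const (conj (v j))).const_add (conj (z j))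
    refine ((h2.mul h3).congr_of_eventuallyEq (Eventually.of_forall fun t => ?_)).congr_deriv ?_
    · simp
    · simp only [Complex.ofReal_zero]
      ring
  have h4 := ((HasDerivAt.fun_sum fun j (_ : j ∈ Finset.univ) => h1 j).const_mul (-(ε : ℂ))).cexp
  refine h4.congr_deriv ?_
  simp only [zero_smul, add_zero, Finset.sum_add_distrib]
  ring

theorem integral_weight_mul_lineDeriv {ε : ℝ} (hε : 0 < ε) {F F' : (Fin n → ℂ) → ℂ}
    {v : Fin n → ℂ} (hF : ∀ z, HasLineDerivAt ℝ F (F' z) z v) (hc : Continuous F) {A : ℝ}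
    (hA : ∀ z, ‖F z‖ ≤ A) (hF' : QuadBounded F') :
    ∫ z, (weight ε z : ℂ) * F' z =
      ε * ∫ z, (weight ε z : ℂ) * ((∑ j, conj (v j) * z j) * F z + (∑ j, v j * conj (z j)) * F z) := by
  have hq := (QuadBounded.linear_mul hc hA v).add (QuadBounded.linear_conj_mul hc hA v)
  have e : ∀ z, (-ε * (∑ j, conj (v j) * z j + ∑ j, v j * conj (z j)) * weight ε z) * F z =
      -ε * ((weight ε z : ℂ) *
        ((∑ j, conj (v j) * z j) * F z + (∑ j, v j * conj (z j)) * F z)) := fun z => by ring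
  have h := integral_bilinear_hasLineDerivAt_right_eq_neg_left_of_integrable
    (μ := (volume : Measure (Fin n → ℂ)))
    (B := ContinuousLinearMap.mul ℝ ℂ) (f := fun z : Fin n → ℂ => (weight ε z : ℂ)) (g := F)
    (g' := F') (v := v)
    (f' := fun z => -ε * (∑ j, conj (v j) * z j + ∑ j, v j * conj (z j)) * weight ε z)
    (by simp only [ContinuousLinearMap.mul_apply', e]; exact (hq.integrable hε).const_mul _)
    (hF'.integrable hε) ((QuadBounded.of_bounded hc hA).integrable hε)
    (fun z _ => hasLineDerivAt_weight ε z v) fun z _ => hF z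
  simp only [ContinuousLinearMap.mul_apply', e] at h
  rw [h, integral_const_mul]
  ring

theorem integral_weight_mul_dzbar {ε : ℝ} (hε : 0 < ε) {F F₁ F₂ : (Fin n → ℂ) → ℂ}
    {c : Fin n → ℂ} (h1 : ∀ z, HasLineDerivAt ℝ F (F₁ z) z c)
    (h2 : ∀ z, HasLineDerivAt ℝ F (F₂ z) z (Complex.I • c)) (hc : Continuous F) {A : ℝ}
    (hA : ∀ z, ‖F z‖ ≤ A) (hF₁ : QuadBounded F₁) (hF₂ : QuadBounded F₂) :
    ∫ z, (weight ε z : ℂ) * dzbar c F z =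
      ε * ∫ z, (weight ε z : ℂ) * ((∑ j, conj (c j) * z j) * F z) := by
  have e1 := integral_weight_mul_lineDeriv hε h1 hc hA hF₁
  have e2 := integral_weight_mul_lineDeriv hε h2 hc hA hF₂
  have hL := (QuadBounded.linear_mul hc hA c).integrable hε
  have hL' := (QuadBounded.linear_conj_mul hc hA c).integrable hε
  have a1 : ∀ z : Fin n → ℂ, ∑ j, conj ((Complex.I • c) j) * z j =
      -Complex.I * ∑ j, conj (c j) * z j := fun z => by
    simp [Finset.mul_sum, mul_assoc]
  have a2 : ∀ z : Fin n → ℂ, ∑ j, (Complex.I • c) j * conj (z j) =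
      Complex.I * ∑ j, c j * conj (z j) := fun z => by
    simp [Finset.mul_sum, mul_assoc]
  have e3 : ∀ z, (weight ε z : ℂ) * dzbar c F z = (1 / 2) * ((weight ε z : ℂ) * F₁ z) +
      (Complex.I / 2) * ((weight ε z : ℂ) * F₂ z) := fun z => by
    rw [dzbar_of_hasLineDerivAt (h1 z) (h2 z)]
    ring
  have e4 : ∀ z, (weight ε z : ℂ) * ((∑ j, conj ((Complex.I • c) j) * z j) * F z +
      (∑ j, (Complex.I • c) j * conj (z j)) * F z) =
      -Complex.I * ((weight ε z : ℂ) * ((∑ j, conj (c j) * z j) * F z)) +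
        Complex.I * ((weight ε z : ℂ) * ((∑ j, c j * conj (z j)) * F z)) := fun z => by
    rw [a1, a2]
    ring
  simp only [mul_add] at e1
  simp only [e4] at e2
  rw [integral_add hL hL'] at e1
  rw [integral_add (hL.const_mul _) (hL'.const_mul _), integral_const_mul, integral_const_mul] at e2
  simp only [e3]
  rw [integral_add ((hF₁.integrable hε).const_mul _) ((hF₂.integrable hε).const_mul _),
    integral_const_mul, integral_const_mul, e1, e2]
  ring_nf
  simp only [Complex.I_sq]
  ring

/-! ### Matrix coefficients of single vectors and their averages -/

theorem matCoeff_unit (x y : FockSpace n) (z : Fin n → ℂ) :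
    matCoeff (fun _ : Unit => x) (fun _ : Unit => y) z = inner ℂ x (weyl z y) := by
  simp [matCoeff]

theorem sqSummable_unit (x : FockSpace n) : SqSummable fun _ : Unit => x :=
  (hasSum_fintype _).summable

theorem continuous_inner_weyl (x y : FockSpace n) :
    Continuous fun z : Fin n → ℂ => inner ℂ x (weyl z y) :=
  continuous_const.inner (continuous_weyl y)

theorem ladderFamily_unit (c : Fin n → ℂ) (v : FiniteVectors n) :
    LadderFamily c (fun _ : Unit => incl v) (fun _ => incl (creatAt c v))
      (fun _ => incl (annihAt c v)) :=
  ⟨fun _ => ladderPair_incl c v, sqSummable_unit _, sqSummable_unit _, sqSummable_unit _⟩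

theorem matCoeff_unit_eq (x y : FockSpace n) :
    matCoeff (fun _ : Unit => x) (fun _ : Unit => y) = fun z => inner ℂ x (weyl z y) :=
  funext fun z => matCoeff_unit x y z

theorem quadBounded_lineDeriv (x y θ : FockSpace n) (w : Fin n → ℂ) :
    QuadBounded fun z => inner ℂ x (weyl z θ) - symp z w / 2 * inner ℂ x (weyl z y) := by
  have hA := fun z => norm_inner_weyl_le x y z
  have hc := continuous_inner_weyl x y
  have h1 := QuadBounded.of_bounded (continuous_inner_weyl x θ) fun z => norm_inner_weyl_le x θ z
  have h2 := (QuadBounded.linear_mul hc hA w).const_mul (-1 / 2)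
  have h3 := (QuadBounded.linear_conj_mul hc hA w).const_mul (1 / 2)
  have h4 := (h1.add h2).add h3
  convert h4 using 2 with z
  rw [symp_eq]
  ring

/-- The averaged `∂_{conj z}` derivative has three expressions: charged to the left vector, charged
to the right one, and integrated by parts. Besides the two integrals compared here, they involve
only one moment `J`, which is eliminated. No Gaussian integral has to be evaluated. -/
theorem integral_weight_creatAt_left {ε : ℝ} (hε : 0 < ε) (c : Fin n → ℂ)
    (u v : FiniteVectors n) :
    (ε + 1 / 2) * ∫ z, (weight ε z : ℂ) * inner ℂ (incl (creatAt c u)) (weyl z (incl v)) =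
      (ε - 1 / 2) * ∫ z, (weight ε z : ℂ) * inner ℂ (incl u) (weyl z (incl (annihAt c v))) := by
  have hL := ladderFamily_unit c v
  have hL' := ladderFamily_unit c u
  have hη := sqSummable_unit (incl u)
  have hψ := sqSummable_unit (incl v)
  have d1 := hasLineDerivAt_matCoeff_right hη hL.sq (hL.sq_up.sub hL.sq_down) hL.hasGenerator
  have d2 := hasLineDerivAt_matCoeff_right hη hL.sq ((hL.sq_up.add hL.sq_down).const_smul Complex.I)
    hL.hasGenerator_I
  have r := dzbar_matCoeff_right hη hL
  have l := dzbar_matCoeff_left hψ hL'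
  simp only [matCoeff_unit_eq] at d1 d2 r l
  have hA := fun z => norm_inner_weyl_le (incl u) (incl v) z
  have hcont := continuous_inner_weyl (incl u) (incl v)
  have key := integral_weight_mul_dzbar hε d1 d2 hcont hA (quadBounded_lineDeriv _ _ _ _)
    (quadBounded_lineDeriv _ _ _ _)
  have hJ := (QuadBounded.linear_mul hcont hA c).integrable hε
  set J := ∫ z, (weight ε z : ℂ) * ((∑ j, conj (c j) * z j) * inner ℂ (incl u) (weyl z (incl v)))
  have i1 := (QuadBounded.of_bounded (continuous_inner_weyl (incl (creatAt c u)) (incl v))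
    fun z => norm_inner_weyl_le _ _ z).integrable hε
  have i2 := (QuadBounded.of_bounded (continuous_inner_weyl (incl u) (incl (annihAt c v)))
    fun z => norm_inner_weyl_le _ _ z).integrable hε
  have k1 := key
  have k2 := key
  simp only [l] at k1
  simp only [r] at k2
  have e1 : ∀ z, (weight ε z : ℂ) * (-inner ℂ (incl (creatAt c u)) (weyl z (incl v)) +
      (∑ j, conj (c j) * z j) / 2 * inner ℂ (incl u) (weyl z (incl v))) =
      (-1) * ((weight ε z : ℂ) * inner ℂ (incl (creatAt c u)) (weyl z (incl v))) + (1 / 2) *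
        ((weight ε z : ℂ) * ((∑ j, conj (c j) * z j) * inner ℂ (incl u) (weyl z (incl v)))) :=
    fun z => by ring
  have e2 : ∀ z, (weight ε z : ℂ) * (-inner ℂ (incl u) (weyl z (incl (annihAt c v))) -
      (∑ j, conj (c j) * z j) / 2 * inner ℂ (incl u) (weyl z (incl v))) =
      (-1) * ((weight ε z : ℂ) * inner ℂ (incl u) (weyl z (incl (annihAt c v)))) + (-1 / 2) *
        ((weight ε z : ℂ) * ((∑ j, conj (c j) * z j) * inner ℂ (incl u) (weyl z (incl v)))) :=
    fun z => by ring
  simp only [e1] at k1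
  simp only [e2] at k2
  rw [integral_add (i1.const_mul _) (hJ.const_mul _), integral_const_mul, integral_const_mul] at k1
  rw [integral_add (i2.const_mul _) (hJ.const_mul _), integral_const_mul, integral_const_mul] at k2
  -- With `A`, `B` the left and right integrals, `k1` and `k2` say `-A + J/2 = εJ` and `-B - J/2 =
  -- εJ`.
  linear_combination (-(ε : ℂ) - 1 / 2) * k1 + ((ε : ℂ) - 1 / 2) * k2

/-- The Gaussian average of the displaced vectors. -/
def smear (ε : ℝ) (x : FockSpace n) : FockSpace n := ∫ z, (weight ε z : ℂ) • weyl z x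

theorem integrable_weight_smul_weyl {ε : ℝ} (hε : 0 < ε) (x : FockSpace n) :
    Integrable fun z => (weight ε z : ℂ) • weyl z x := by
  refine ((integrable_weight hε).mul_const ‖x‖).mono' ?_ (Eventually.of_forall fun z => ?_)
  · exact ((Complex.continuous_ofReal.comp (continuous_weight ε)).smul
      (continuous_weyl x)).aestronglyMeasurable
  · rw [norm_smul, (weyl z).norm_map, Complex.norm_real, Real.norm_of_nonneg (weight_pos ε z).le]

theorem inner_smear {ε : ℝ} (hε : 0 < ε) (x y : FockSpace n) :
    inner ℂ x (smear ε y) = ∫ z, (weight ε z : ℂ) * inner ℂ x (weyl z y) := by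
  have h := (innerSL ℂ x).integral_comp_comm (integrable_weight_smul_weyl hε y)
  simp only [innerSL_apply_apply, inner_smul_right] at h
  exact h.symm

/-- The weight is even and the adjoint of `D(z)` is `D(-z)`, so the average is self-adjoint. -/
theorem inner_smear_conj {ε : ℝ} (hε : 0 < ε) (x y : FockSpace n) :
    inner ℂ x (smear ε y) = conj (inner ℂ y (smear ε x)) := by
  rw [inner_smear hε, inner_smear hε, ← integral_conj, ← integral_neg_eq_self]
  refine integral_congr_ae (Eventually.of_forall fun z => ?_)
  simp only [map_mul, Complex.conj_ofReal, inner_conj_symm, weight_neg, inner_weyl_left]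

/-- The Gaussian average in the vacuum. -/
def smearVac (n : ℕ) (ε : ℝ) : ℂ := inner ℂ (numberState (0 : Fin n → ℕ)) (smear ε (numberState 0))

/-- The ratio of successive eigenvalues of the Gaussian average. -/
def smearRatio (ε : ℝ) : ℝ := (ε - 1 / 2) / (ε + 1 / 2)

/-! ### Diagonalization of the Gaussian average -/

theorem inner_creat_smear {ε : ℝ} (hε : 0 < ε) (j : Fin n) (u v : FiniteVectors n) :
    inner ℂ (incl (creat j u)) (smear ε (incl v)) =
      smearRatio ε * inner ℂ (incl u) (smear ε (incl (annih j v))) := by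
  have h := integral_weight_creatAt_left hε (Pi.single j 1) u v
  have h1 : creatAt (Pi.single j 1) = creat j := by
    rw [creatAt, Finset.sum_eq_single j (fun i _ hi => by simp [hi]) (by simp)]
    simp
  have h2 : annihAt (Pi.single j 1) = annih j := by
    rw [annihAt, Finset.sum_eq_single j (fun i _ hi => by simp [hi]) (by simp)]
    simp
  rw [h1, h2, ← inner_smear hε, ← inner_smear hε] at h
  have h0 : (ε : ℂ) + 1 / 2 ≠ 0 := by
    have h3 : ((ε + 1 / 2 : ℝ) : ℂ) ≠ 0 := Complex.ofReal_ne_zero.mpr (by positivity)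
    push_cast at h3
    exact h3
  rw [smearRatio]
  push_cast
  rw [div_mul_eq_mul_div, eq_div_iff h0]
  linear_combination h

theorem inner_smear_smul {ε : ℝ} (hε : 0 < ε) (a : ℂ) (x y : FockSpace n) :
    inner ℂ x (smear ε (a • y)) = a * inner ℂ x (smear ε y) := by
  rw [inner_smear hε, inner_smear hε, ← integral_const_mul]
  refine integral_congr_ae (Eventually.of_forall fun z => ?_)
  simp only [map_smul, inner_smul_right]
  ring

theorem inner_numberState_succ_smear {ε : ℝ} (hε : 0 < ε) (j : Fin n) (k l : Fin n → ℕ) :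
    ((Real.sqrt (k j + 1) : ℝ) : ℂ) *
        inner ℂ (numberState (Function.update k j (k j + 1))) (smear ε (numberState l)) =
      smearRatio ε * (((Real.sqrt (l j) : ℝ) : ℂ) *
        inner ℂ (numberState k) (smear ε (numberState (Function.update l j (l j - 1))))) := by
  have h := inner_creat_smear hε j (Finsupp.single k 1) (Finsupp.single l 1)
  rw [creat_single, annih_single] at h
  simpa only [incl_single, one_smul, one_mul, inner_smul_left, Complex.conj_ofReal,
    inner_smear_smul hε] using h

theorem exists_update_succ {k : Fin n → ℕ} (hk : k ≠ 0) :
    ∃ j, ∃ k' : Fin n → ℕ, k = Function.update k' j (k' j + 1) := by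
  obtain ⟨j, hj⟩ := Function.ne_iff.mp hk
  refine ⟨j, Function.update k j (k j - 1), ?_⟩
  have : k j - 1 + 1 = k j := Nat.sub_add_cancel (Nat.one_le_iff_ne_zero.mpr hj)
  simp [this]

/-- Each photon removed from both arguments costs one factor `smearRatio`, so induction on the
photon number ends at the vacuum. Vacuum entries off the diagonal vanish because annihilation kills
the vacuum, on either side by self-adjointness. -/
theorem inner_numberState_smear {ε : ℝ} (hε : 0 < ε) (k l : Fin n → ℕ) :
    inner ℂ (numberState k) (smear ε (numberState l)) =
      if k = l then (smearRatio ε : ℂ) ^ (∑ i, k i) * smearVac n ε else 0 := by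
  have hsq : ∀ m : ℕ, ((Real.sqrt (m + 1) : ℝ) : ℂ) ≠ 0 := fun m =>
    Complex.ofReal_ne_zero.mpr (Real.sqrt_ne_zero'.mpr (by positivity))
  have hzero : ∀ k : Fin n → ℕ, k ≠ 0 →
      inner ℂ (numberState k) (smear ε (numberState 0)) = 0 := fun k hk => by
    obtain ⟨j, k', rfl⟩ := exists_update_succ hk
    have h := inner_numberState_succ_smear hε j k' 0
    simp only [Pi.zero_apply, Nat.cast_zero, Real.sqrt_zero, Complex.ofReal_zero, zero_mul,
      mul_zero] at h
    exact (mul_eq_zero.mp h).resolve_left (hsq _)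
  induction hN : ∑ i, k i generalizing k l with
  | zero =>
    have hk : k = 0 := by
      funext i
      exact Finset.sum_eq_zero_iff.mp hN i (Finset.mem_univ i)
    subst hk
    split_ifs with h
    · subst h
      simp [smearVac]
    · rw [inner_smear_conj hε, hzero l (Ne.symm h), map_zero]
  | succ N ih =>
    have hk : k ≠ 0 := by
      rintro rfl
      simp at hN
    obtain ⟨j, k', rfl⟩ := exists_update_succ hk
    rw [sum_update_succ] at hN
    have hN' : ∑ i, k' i = N := by omega
    have h := inner_numberState_succ_smear hε j k' l
    refine mul_left_cancel₀ (hsq (k' j)) (h.trans ?_)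
    rw [ih k' _ hN']
    by_cases hl : l j = 0
    · have : ¬ Function.update k' j (k' j + 1) = l := by
        rintro rfl
        simp at hl
      rw [if_neg this, hl]
      simp
    · simp only [update_eq_update_iff hl]
      split_ifs with h1
      · have h2 : ((l j : ℕ) : ℝ) = k' j + 1 := by
          have : l j = k' j + 1 := by
            rw [h1, Function.update_self]
            omega
          exact_mod_cast this
        rw [h2]
        ring
      · simp

theorem norm_smearRatio_le {ε : ℝ} (hε : 0 < ε) : ‖(smearRatio ε : ℂ)‖ ≤ 1 := by
  have h0 : 0 < ε + 1 / 2 := by linarith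
  rw [Complex.norm_real, Real.norm_eq_abs, smearRatio, abs_div, abs_of_pos h0, div_le_one h0,
    abs_le]
  constructor <;> linarith

theorem conj_smearVac {ε : ℝ} (hε : 0 < ε) : conj (smearVac n ε) = smearVac n ε := by
  rw [smearVac, ← inner_smear_conj hε]

theorem smear_apply {ε : ℝ} (hε : 0 < ε) (x : FockSpace n) (k : Fin n → ℕ) :
    smear ε x k = (smearRatio ε : ℂ) ^ (∑ i, k i) * smearVac n ε * x k := by
  have h : smear ε (numberState k) =
      ((smearRatio ε : ℂ) ^ (∑ i, k i) * smearVac n ε) • numberState k := by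
    refine fock_ext fun l => ?_
    rw [inner_numberState_smear hε, inner_smul_right, inner_numberState_left, numberState_apply]
    split_ifs with h
    · rw [h, mul_one]
    · simp
  rw [← inner_numberState_left, inner_smear_conj hε, h, inner_smul_right, inner_numberState_right]
  simp only [map_mul, map_pow, Complex.conj_ofReal, conj_smearVac hε, Complex.conj_conj]

/-! ### The vacuum expectation -/

theorem annihAt_vacuum (c : Fin n → ℂ) :
    annihAt c (Finsupp.single (0 : Fin n → ℕ) 1) = 0 := by
  rw [annihAt, LinearMap.sum_apply]
  refine Finset.sum_eq_zero fun j _ => ?_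
  rw [LinearMap.smul_apply, annih_single]
  simp

theorem lineDeriv_eq_dz_add_dzbar (c : Fin n → ℂ) (f : (Fin n → ℂ) → ℂ) (z : Fin n → ℂ) :
    lineDeriv ℝ f z c = dz c f z + dzbar c f z := by
  rw [dz, dzbar]
  ring

/-- Charge `∂_z` to the left vacuum and `∂_{conj z}` to the right one: both ladder terms are
annihilation terms and vanish. Along the ray this leaves `F'(t) = -t |w|² F(t)` with `F(0) = 1`. -/
theorem inner_vacuum_weyl (w : Fin n → ℂ) :
    inner ℂ (numberState 0) (weyl w (numberState 0)) =
      ((Real.exp (-(1 / 2) * ∑ j, ‖w j‖ ^ 2) : ℝ) : ℂ) := by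
  have hL := ladderFamily_unit w (Finsupp.single (0 : Fin n → ℕ) 1)
  rw [annihAt_vacuum] at hL
  have r := dzbar_matCoeff_right hL.sq hL
  have l := dz_matCoeff_left hL.sq hL
  have hd := dirDifferentiable_matCoeff_right hL.sq hL
  simp only [matCoeff_unit_eq, incl_single, one_smul, map_zero, inner_zero_right,
    inner_zero_left] at r l hd
  set F : (Fin n → ℂ) → ℂ := fun z => inner ℂ (numberState 0) (weyl z (numberState 0)) with hF
  set S : ℂ := ((∑ j, ‖w j‖ ^ 2 : ℝ) : ℂ) with hS
  have h1 : ∀ t : ℝ, HasDerivAt (fun t : ℝ => F (t • w)) (-(t * S) * F (t • w)) t := fun t => by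
    have h2 := (hd (t • w)).1.hasLineDerivAt
    rw [lineDeriv_eq_dz_add_dzbar, r, l] at h2
    have e1 : ∑ j, w j * conj ((t • w) j) = t * S := by
      rw [hS, ← sum_conj_mul_self, Finset.mul_sum]
      refine Finset.sum_congr rfl fun j _ => ?_
      simp
      ring
    have e2 : ∑ j, conj (w j) * (t • w) j = t * S := by
      rw [hS, ← sum_conj_mul_self, Finset.mul_sum]
      refine Finset.sum_congr rfl fun j _ => ?_
      simp
      ring
    rw [e1, e2] at h2
    have h3 : HasDerivAt (fun s : ℝ => F (t • w + s • w)) (-(t * S) * F (t • w)) (t - t) := by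
      rw [sub_self]
      refine HasDerivAt.congr_deriv h2 ?_
      rw [hF]
      ring
    refine (h3.comp_sub_const t t).congr_of_eventuallyEq (Eventually.of_forall fun s => ?_)
    simp only [← add_smul, add_sub_cancel]
  have h5 : ∀ t : ℝ, HasDerivAt (fun t : ℝ => F (t • w) * Complex.exp ((t : ℂ) ^ 2 * (S / 2))) 0 t :=
    fun t => by
      have h6 : HasDerivAt (fun t : ℝ => Complex.exp ((t : ℂ) ^ 2 * (S / 2)))
          (Complex.exp ((t : ℂ) ^ 2 * (S / 2)) * ((2 * (t : ℂ) ^ 1 * 1) * (S / 2))) t :=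
        (((hasDerivAt_id t).ofReal_comp.pow 2).mul_const (S / 2)).cexp
      refine ((h1 t).mul h6).congr_deriv ?_
      ring
  have h7 := is_const_of_deriv_eq_zero (fun t => (h5 t).differentiableAt) (fun t => (h5 t).deriv) 1 0
  have h8 : F 0 = 1 := by simp [hF, inner_numberState_left, numberState_apply]
  simp only [one_smul, zero_smul, h8, Complex.ofReal_one, Complex.ofReal_zero, one_pow, one_mul,
    ne_eq, OfNat.ofNat_ne_zero, not_false_eq_true, zero_pow, zero_mul, Complex.exp_zero] at h7
  have h9 : F w = Complex.exp (-(S / 2)) := by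
    rw [Complex.exp_neg]
    exact eq_inv_of_mul_eq_one_left h7
  change F w = _
  rw [h9, hS, Complex.ofReal_exp]
  push_cast
  ring_nf

/-- The limit of the Gaussian averages in the vacuum. -/
def vacIntegral (n : ℕ) : ℂ := ∫ z : Fin n → ℂ, ((weight (1 / 2) z : ℝ) : ℂ)

theorem tendsto_smearVac : Tendsto (smearVac n) (𝓝[>] 0) (𝓝 (vacIntegral n)) := by
  have h1 : ∀ᶠ ε in 𝓝[>] (0 : ℝ), smearVac n ε =
      ∫ z : Fin n → ℂ, (weight ε z : ℂ) * ((weight (1 / 2) z : ℝ) : ℂ) := by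
    filter_upwards [self_mem_nhdsWithin] with ε hε
    rw [smearVac, inner_smear hε]
    simp only [inner_vacuum_weyl, weight]
  refine Tendsto.congr' (EventuallyEq.symm h1) ?_
  refine tendsto_integral_filter_of_dominated_convergence (fun z => weight (1 / 2) z) ?_ ?_
    (integrable_weight (by norm_num)) ?_
  · refine Eventually.of_forall fun ε => ?_
    exact ((Complex.continuous_ofReal.comp (continuous_weight ε)).mul
      (Complex.continuous_ofReal.comp (continuous_weight _))).aestronglyMeasurable
  · filter_upwards [self_mem_nhdsWithin] with ε hε
    refine Eventually.of_forall fun z => ?_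
    have h0 : 0 ≤ ∑ j, ‖z j‖ ^ 2 := Finset.sum_nonneg fun j _ => sq_nonneg _
    have h2 : weight ε z ≤ 1 := by
      have hε' : 0 < ε := hε
      rw [weight, Real.exp_le_one_iff]
      nlinarith
    rw [norm_mul, Complex.norm_real, Complex.norm_real, Real.norm_of_nonneg (weight_pos _ _).le,
      Real.norm_of_nonneg (weight_pos _ _).le]
    exact mul_le_of_le_one_left (weight_pos _ _).le h2
  · refine Eventually.of_forall fun z => ?_
    have hc : Continuous fun ε : ℝ => (weight ε z : ℂ) * ((weight (1 / 2) z : ℝ) : ℂ) := by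
      unfold weight
      fun_prop
    have h3 := (hc.tendsto 0).mono_left (nhdsWithin_le_nhds (s := Set.Ioi 0))
    have h4 : weight 0 z = 1 := by simp [weight]
    simpa [h4] using h3

/-- The origin of parity: the relative eigenvalues of the average become `(-1)` to the photon
number. -/
theorem tendsto_smearRatio : Tendsto (fun ε => (smearRatio ε : ℂ)) (𝓝[>] 0) (𝓝 (-1)) := by
  have h : ContinuousAt (fun ε : ℝ => (smearRatio ε : ℂ)) 0 := by
    refine Complex.continuous_ofReal.continuousAt.comp ?_
    unfold smearRatio
    refine ContinuousAt.div (by fun_prop) (by fun_prop) (by norm_num)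
  have h2 := h.tendsto.mono_left (nhdsWithin_le_nhds (s := Set.Ioi 0))
  have h3 : ((smearRatio 0 : ℝ) : ℂ) = -1 := by
    norm_num [smearRatio]
  rwa [h3] at h2

/-! ### Parity -/

/-- The parity of finite vectors. -/
def parityFin (n : ℕ) : Module.End ℂ (FiniteVectors n) :=
  Finsupp.linearCombination ℂ fun k : Fin n → ℕ => Finsupp.single k ((-1 : ℂ) ^ (∑ i, k i))

theorem parityFin_single (k : Fin n → ℕ) (a : ℂ) :
    parityFin n (Finsupp.single k a) = Finsupp.single k (a * (-1 : ℂ) ^ (∑ i, k i)) := by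
  simp [parityFin]

theorem orthonormal_parity :
    Orthonormal ℂ fun k : Fin n → ℕ => ((-1 : ℂ) ^ (∑ i, k i)) • (numberState k : FockSpace n) := by
  rw [orthonormal_iff_ite]
  intro k l
  rw [inner_smul_left, inner_smul_right, inner_numberState_left, numberState_apply]
  split_ifs with h
  · subst h
    simp only [map_pow, map_neg, map_one, mul_one, ← mul_pow, neg_mul_neg, one_pow]
  · simp

/-- The parity operator. -/
def parity : FockSpace n →ₗᵢ[ℂ] FockSpace n := orthonormal_parity.orthogonalFamily.linearIsometry

theorem parity_numberState (k : Fin n → ℕ) :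
    parity (numberState k) = ((-1 : ℂ) ^ (∑ i, k i)) • (numberState k : FockSpace n) := by
  unfold parity
  conv_lhs => enter [2]; unfold numberState
  rw [OrthogonalFamily.linearIsometry_apply_single]
  simp

theorem parity_incl (v : FiniteVectors n) : parity (incl v) = incl (parityFin n v) := by
  induction v using Finsupp.induction_linear with
  | zero => simp
  | add u v hu hv => simp only [map_add, hu, hv]
  | single k a =>
    rw [parityFin_single, incl_single, incl_single, map_smul, parity_numberState, smul_smul]

theorem neg_one_pow_mul_self (m : ℕ) : (-1 : ℂ) ^ m * (-1 : ℂ) ^ m = 1 := by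
  rw [← mul_pow, neg_mul_neg, one_mul, one_pow]

theorem parity_apply (x : FockSpace n) (k : Fin n → ℕ) :
    parity x k = (-1 : ℂ) ^ (∑ i, k i) * x k := by
  have h := (parity (n := n)).inner_map_map (numberState k) x
  rw [parity_numberState, inner_smul_left, inner_numberState_left, inner_numberState_left] at h
  rw [← h]
  simp only [map_pow, map_neg, map_one, ← mul_assoc, neg_one_pow_mul_self, one_mul]

theorem annihAt_parityFin (c : Fin n → ℂ) (v : FiniteVectors n) :
    annihAt c (parityFin n v) = -parityFin n (annihAt c v) := by
  induction v using Finsupp.induction_linear with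
  | zero => simp
  | add u v hu hv => simp only [map_add, hu, hv, neg_add]
  | single k a =>
    rw [parityFin_single, annihAt, LinearMap.sum_apply, LinearMap.sum_apply, map_sum,
      ← Finset.sum_neg_distrib]
    refine Finset.sum_congr rfl fun j _ => ?_
    rw [LinearMap.smul_apply, LinearMap.smul_apply, map_smul, annih_single, annih_single,
      parityFin_single, ← smul_neg, ← Finsupp.single_neg]
    congr 2
    by_cases h : k j = 0
    · simp [h]
    · rw [← sum_update_pred k j h]
      ring

theorem creatAt_parityFin (c : Fin n → ℂ) (v : FiniteVectors n) :
    creatAt c (parityFin n v) = -parityFin n (creatAt c v) := by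
  induction v using Finsupp.induction_linear with
  | zero => simp
  | add u v hu hv => simp only [map_add, hu, hv, neg_add]
  | single k a =>
    rw [parityFin_single, creatAt, LinearMap.sum_apply, LinearMap.sum_apply, map_sum,
      ← Finset.sum_neg_distrib]
    refine Finset.sum_congr rfl fun j _ => ?_
    rw [LinearMap.smul_apply, LinearMap.smul_apply, map_smul, creat_single, creat_single,
      parityFin_single, ← smul_neg, ← Finsupp.single_neg, sum_update_succ]
    congr 2
    ring

theorem gen_pow_parityFin (z : Fin n → ℂ) (m : ℕ) (v : FiniteVectors n) :
    (gen z ^ m) (parityFin n v) = parityFin n ((gen (-z) ^ m) v) := by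
  induction m generalizing v with
  | zero => simp
  | succ m ih =>
    have h : gen z (parityFin n v) = parityFin n (gen (-z) v) := by
      rw [gen_neg, LinearMap.neg_apply, gen, LinearMap.sub_apply, LinearMap.sub_apply,
        annihAt_parityFin, creatAt_parityFin, map_neg, map_sub]
      abel
    rw [pow_succ, Module.End.mul_apply, h, ih, pow_succ, Module.End.mul_apply]

/-- Parity anticommutes with the generator, hence it carries the exponential series at `-z` to the
one at `z`. -/
theorem parity_weyl (z : Fin n → ℂ) (x : FockSpace n) :
    parity (weyl (-z) x) = weyl z (parity x) := by
  have h : (parity (n := n)).toContinuousLinearMap.comp (weyl (-z)).toContinuousLinearMap =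
      (weyl z).toContinuousLinearMap.comp (parity (n := n)).toContinuousLinearMap := by
    refine clm_ext fun k => ?_
    change parity (weyl (-z) (numberState k)) = weyl z (parity (numberState k))
    have h1 := (hasSum_displacement (-z) (Finsupp.single k 1)).mapL parity.toContinuousLinearMap
    have h2 := hasSum_displacement z (parityFin n (Finsupp.single k 1))
    rw [← weyl_incl, ← parity_incl, incl_single, one_smul] at h2
    rw [weyl_numberState]
    refine h1.unique (hasSum_of_eq h2 fun m => ?_)
    change _ = parity (dispTerm (-z) (Finsupp.single k 1) m)
    rw [dispTerm, dispTerm, map_smul, parity_incl, gen_pow_parityFin]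
  exact congrArg (fun A => A x) h

theorem SqSummable.parity {ι : Type*} {ψ : ι → FockSpace n} (hψ : SqSummable ψ) :
    SqSummable fun l => parity (ψ l) := by
  simpa [SqSummable] using hψ

theorem parityFin_parityFin (v : FiniteVectors n) : parityFin n (parityFin n v) = v := by
  induction v using Finsupp.induction_linear with
  | zero => simp
  | add u v hu hv => simp only [map_add, hu, hv]
  | single k a =>
    rw [parityFin_single, parityFin_single, mul_assoc, neg_one_pow_mul_self, mul_one]

theorem inner_incl_parity (v : FiniteVectors n) (x : FockSpace n) :
    inner ℂ (incl v) (parity x) = inner ℂ (incl (parityFin n v)) x := by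
  rw [← parity.inner_map_map (incl (parityFin n v)) x, parity_incl, parityFin_parityFin]

theorem adjCoeff_parity {A : Module.End ℂ (FiniteVectors n)}
    (hA : ∀ v, A (parityFin n v) = -parityFin n (A v)) (x : FockSpace n) (k : Fin n → ℕ) :
    adjCoeff A (parity x) k = -((-1 : ℂ) ^ (∑ i, k i) * adjCoeff A x k) := by
  have h1 : parityFin n (A (Finsupp.single k 1)) =
      -(((-1 : ℂ) ^ (∑ i, k i)) • A (Finsupp.single k 1)) := by
    have h2 := hA (Finsupp.single k 1)
    rw [parityFin_single, ← mul_one ((-1 : ℂ) ^ _), ← smul_eq_mul (b := (1 : ℂ)),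
      one_mul, ← Finsupp.smul_single, map_smul] at h2
    rw [h2, neg_neg]
  rw [adjCoeff, inner_incl_parity, h1, map_neg, map_smul, inner_neg_left, inner_smul_left, adjCoeff]
  simp

/-- The minus signs come from the anticommutation of parity with the ladder operators. They cancel
the one of `charOp_charOpBar_matCoeff`, so the Wigner formula carries no sign in front. -/
theorem LadderFamily.parity {ι : Type*} {c : Fin n → ℂ} {ψ up down : ι → FockSpace n}
    (h : LadderFamily c ψ up down) :
    LadderFamily c (fun l => parity (ψ l)) (fun l => -parity (up l)) (fun l => -parity (down l)) where
  pair l :=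
    { up_apply := fun k => by
        rw [adjCoeff_parity (annihAt_parityFin c), ← (h.pair l).up_apply k, ← parity_apply]
        rfl
      down_apply := fun k => by
        rw [adjCoeff_parity (creatAt_parityFin c), ← (h.pair l).down_apply k, ← parity_apply]
        rfl }
  sq := h.sq.parity
  sq_up := h.sq_up.parity.neg
  sq_down := h.sq_down.parity.neg

/-! ### The Wigner function as a parity expectation -/

/-- The phase is the scalar in `D(α) D(z) D(-α) = exp(symp(α,z)) D(z)`. The Fourier integral at `α`
becomes an integral without a phase for displaced vectors. -/
theorem phase_mul_inner_weyl (α z : Fin n → ℂ) (x : FockSpace n) :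
    phase α z * inner ℂ x (weyl z x) = inner ℂ (weyl (-α) x) (weyl z (weyl (-α) x)) := by
  have e : α + z + -α = z := by abel
  have h1 : phase α z = Complex.exp (symp α z) := by
    rw [phase, symp]
    congr 1
    refine Finset.sum_congr rfl fun j _ => ?_
    ring
  have h2 : symp (α + z) (-α) = symp α z := by
    simp only [symp]
    refine Finset.sum_congr rfl fun j _ => ?_
    simp only [Pi.add_apply, Pi.neg_apply, map_add, map_neg]
    ring
  rw [inner_weyl_left, neg_neg, weyl_weyl, weyl_weyl, e, h2, inner_smul_right,
    inner_smul_right, h1, ← mul_assoc, ← Complex.exp_add, add_halves]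

theorem inner_smear_self {ε : ℝ} (hε : 0 < ε) (x : FockSpace n) :
    inner ℂ x (smear ε x) =
      smearVac n ε * ∑' k : Fin n → ℕ, (smearRatio ε : ℂ) ^ (∑ i, k i) * (conj (x k) * x k) := by
  rw [← (hasSum_inner_mul_inner x (smear ε x)).tsum_eq, ← tsum_mul_left]
  refine tsum_congr fun k => ?_
  rw [inner_numberState_right, inner_numberState_left, smear_apply hε]
  ring

theorem norm_tsum_pow_mul_le {r : ℂ} (hr : ‖r‖ ≤ 1) (x : FockSpace n) :
    ‖∑' k : Fin n → ℕ, r ^ (∑ i, k i) * (conj (x k) * x k)‖ ≤ ‖x‖ ^ 2 := by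
  refine tsum_of_norm_bounded (hasSum_norm_sq x) fun k => ?_
  rw [norm_mul, norm_mul, RCLike.norm_conj, ← sq, norm_pow]
  exact mul_le_of_le_one_left (sq_nonneg _) (pow_le_one₀ (norm_nonneg _) hr)

theorem tendsto_tsum_pow_mul (x : FockSpace n) :
    Tendsto (fun ε => ∑' k : Fin n → ℕ, (smearRatio ε : ℂ) ^ (∑ i, k i) * (conj (x k) * x k))
      (𝓝[>] 0) (𝓝 (inner ℂ x (parity x))) := by
  have h1 : inner ℂ x (parity x) =
      ∑' k : Fin n → ℕ, (-1 : ℂ) ^ (∑ i, k i) * (conj (x k) * x k) := by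
    rw [← (hasSum_inner_mul_inner x (parity x)).tsum_eq]
    refine tsum_congr fun k => ?_
    rw [inner_numberState_right, inner_numberState_left, parity_apply]
    ring
  rw [h1]
  refine tendsto_tsum_of_dominated_convergence (bound := fun k => ‖x k‖ ^ 2)
    (hasSum_norm_sq x).summable (fun k => (tendsto_smearRatio.pow _).mul_const _) ?_
  filter_upwards [self_mem_nhdsWithin] with ε hε k
  rw [norm_mul, norm_mul, RCLike.norm_conj, ← sq, norm_pow]
  exact mul_le_of_le_one_left (sq_nonneg _) (pow_le_one₀ (norm_nonneg _) (norm_smearRatio_le hε))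

/-- The normalization of the parity formula for the Wigner function. -/
def wignerConst (n : ℕ) : ℂ := (((Real.pi ^ 2) ^ n : ℝ) : ℂ)⁻¹ * vacIntegral n

section Wigner

variable {ι : Type*} [Countable ι]

theorem regFourier_matCoeff {ψ : ι → FockSpace n} (hψ : SqSummable ψ) {ε : ℝ} (hε : 0 < ε)
    (α : Fin n → ℂ) :
    regFourier (matCoeff ψ ψ) ε α = (((Real.pi ^ 2) ^ n : ℝ) : ℂ)⁻¹ *
      ∑' l, inner ℂ (weyl (-α) (ψ l)) (smear ε (weyl (-α) (ψ l))) := by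
  rw [regFourier]
  congr 1
  set χ : ι → FockSpace n := fun l => weyl (-α) (ψ l) with hχdef
  have hn : ∀ l, ‖χ l‖ = ‖ψ l‖ := fun l => (weyl (-α)).norm_map _
  have hF : ∀ l, Integrable fun z => (weight ε z : ℂ) * inner ℂ (χ l) (weyl z (χ l)) := fun l =>
    (QuadBounded.of_bounded (continuous_inner_weyl (χ l) (χ l))
      fun z => norm_inner_weyl_le _ _ z).integrable hε
  have hS : Summable fun l => ∫ z, ‖(weight ε z : ℂ) * inner ℂ (χ l) (weyl z (χ l))‖ := by
    refine Summable.of_nonneg_of_le (fun l => integral_nonneg fun z => norm_nonneg _) (fun l => ?_)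
      (hψ.mul_left (∫ z : Fin n → ℂ, weight ε z))
    rw [← integral_mul_const]
    refine integral_mono (hF l).norm ((integrable_weight hε).mul_const _) fun z => ?_
    rw [norm_mul, Complex.norm_real, Real.norm_of_nonneg (weight_pos ε z).le, sq, ← hn]
    exact mul_le_mul_of_nonneg_left (norm_inner_weyl_le _ _ z) (weight_pos ε z).le
  have h := hasSum_integral_of_summable_integral_norm hF hS
  have h1 : ∀ z, ((Real.exp (-ε * ∑ j, ‖z j‖ ^ 2) : ℝ) : ℂ) * (matCoeff ψ ψ z * phase α z) =
      ∑' l, (weight ε z : ℂ) * inner ℂ (χ l) (weyl z (χ l)) := fun z => by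
    rw [tsum_mul_left, mul_comm (matCoeff ψ ψ z), matCoeff, ← tsum_mul_left, weight]
    simp only [phase_mul_inner_weyl, hχdef]
  simp only [h1, inner_smear hε]
  exact h.tsum_eq.symm

/-- For every `ε > 0` the ratio has modulus at most one, so `‖ψ l‖²` dominates and the limit passes
through the sum over the mixture. The vacuum factor converges separately; its value is never needed.
-/
theorem tendsto_regFourier_matCoeff {ψ : ι → FockSpace n} (hψ : SqSummable ψ) (α : Fin n → ℂ) :
    Tendsto (fun ε => regFourier (matCoeff ψ ψ) ε α) (𝓝[>] 0)
      (𝓝 (wignerConst n * matCoeff ψ (fun l => parity (ψ l)) ((2 : ℝ) • α))) := by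
  set χ : ι → FockSpace n := fun l => weyl (-α) (ψ l) with hχdef
  have hn : ∀ l, ‖χ l‖ = ‖ψ l‖ := fun l => (weyl (-α)).norm_map _
  have h1 : ∀ᶠ ε in 𝓝[>] (0 : ℝ), regFourier (matCoeff ψ ψ) ε α =
      (((Real.pi ^ 2) ^ n : ℝ) : ℂ)⁻¹ * (smearVac n ε *
        ∑' l, ∑' k : Fin n → ℕ, (smearRatio ε : ℂ) ^ (∑ i, k i) * (conj (χ l k) * χ l k)) := by
    filter_upwards [self_mem_nhdsWithin] with ε hε
    rw [regFourier_matCoeff hψ hε, ← tsum_mul_left (a := smearVac n ε)]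
    simp only [inner_smear_self hε, hχdef]
  refine Tendsto.congr' (EventuallyEq.symm h1) ?_
  rw [wignerConst, mul_assoc]
  refine Tendsto.const_mul _ (tendsto_smearVac.mul ?_)
  -- The argument doubles because `D(α) Π D(-α) = D(α) D(α) Π = D(2α) Π`.
  have h2 : matCoeff ψ (fun l => parity (ψ l)) ((2 : ℝ) • α) =
      ∑' l, inner ℂ (χ l) (parity (χ l)) := by
    refine tsum_congr fun l => ?_
    have h3 := symp_real_smul_self 1 1 α
    rw [one_smul] at h3
    rw [hχdef, parity_weyl, inner_weyl_left, neg_neg, weyl_weyl, h3, two_smul]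
    simp
  rw [h2]
  refine tendsto_tsum_of_dominated_convergence (bound := fun l => ‖ψ l‖ ^ 2) hψ
    (fun l => tendsto_tsum_pow_mul (χ l)) ?_
  filter_upwards [self_mem_nhdsWithin] with ε hε l
  rw [← hn]
  exact norm_tsum_pow_mul_le (norm_smearRatio_le hε) (χ l)

theorem Mixture.wigner_eq {ρ : FockSpace n →L[ℂ] FockSpace n} {ψ : ι → FockSpace n}
    (h : Mixture ρ ψ) (α : Fin n → ℂ) :
    wigner ρ α = wignerConst n * matCoeff ψ (fun l => parity (ψ l)) ((2 : ℝ) • α) := by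
  rw [wigner, h.charFn_eq]
  exact (tendsto_regFourier_matCoeff h.sq α).limUnder_eq

theorem Mixture.tendsto_regFourier {ρ : FockSpace n →L[ℂ] FockSpace n} {ψ : ι → FockSpace n}
    (h : Mixture ρ ψ) (α : Fin n → ℂ) :
    Tendsto (fun ε => regFourier (charFn ρ) ε α) (𝓝[>] 0) (𝓝 (wigner ρ α)) := by
  rw [h.wigner_eq, h.charFn_eq]
  exact tendsto_regFourier_matCoeff h.sq α

end Wigner

/-! ### Rescaling of the phase space -/

theorem hasLineDerivAt_comp_two_smul {F : (Fin n → ℂ) → ℂ} {F' : ℂ} {α v : Fin n → ℂ} (K : ℂ)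
    (h : HasLineDerivAt ℝ F F' ((2 : ℝ) • α) v) :
    HasLineDerivAt ℝ (fun α => K * F ((2 : ℝ) • α)) (K * (2 * F')) α v := by
  unfold HasLineDerivAt at h ⊢
  have h1 : HasDerivAt (fun t : ℝ => F ((2 : ℝ) • α + t • v)) F' (2 * 0) := by
    rwa [mul_zero]
  have h2 := h1.scomp (0 : ℝ) ((hasDerivAt_id (0 : ℝ)).const_mul 2)
  refine ((h2.const_mul K).congr_of_eventuallyEq (Eventually.of_forall fun t => ?_)).congr_deriv ?_
  · simp [smul_add, smul_smul]
  · simp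

section Rescale

variable {F : (Fin n → ℂ) → ℂ} {c : Fin n → ℂ}

theorem DirDifferentiable.comp_two_smul (hF : DirDifferentiable c F) (K : ℂ) :
    DirDifferentiable c fun α => K * F ((2 : ℝ) • α) := fun α =>
  ⟨(hasLineDerivAt_comp_two_smul K (hF ((2 : ℝ) • α)).1.hasLineDerivAt).lineDifferentiableAt,
    (hasLineDerivAt_comp_two_smul K (hF ((2 : ℝ) • α)).2.hasLineDerivAt).lineDifferentiableAt⟩

/-- With `z = 2α`, the chain rule turns `∂_α/2` into `∂_z`, and `conj(α)` is `conj(z)/2`: the two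
kinds of operators are rescalings of each other. -/
theorem wignerOp_comp_two_smul (hF : DirDifferentiable c F) (K : ℂ) (s : PhotonProcess) :
    wignerOp s c (fun α => K * F ((2 : ℝ) • α)) = fun α => K * charOp s c F ((2 : ℝ) • α) := by
  funext α
  rw [wignerOp, charOp, dz_of_hasLineDerivAt
    (hasLineDerivAt_comp_two_smul K (hF ((2 : ℝ) • α)).1.hasLineDerivAt)
    (hasLineDerivAt_comp_two_smul K (hF ((2 : ℝ) • α)).2.hasLineDerivAt), dz]
  have h : ∑ j, c j * conj (((2 : ℝ) • α) j) = 2 * ∑ j, c j * conj (α j) := by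
    rw [Finset.mul_sum]
    refine Finset.sum_congr rfl fun j _ => ?_
    simp only [Pi.smul_apply, Complex.real_smul, map_mul, Complex.ofReal_ofNat, Complex.conj_ofNat]
    ring
  rw [h]
  ring

theorem wignerOpBar_comp_two_smul (hF : DirDifferentiable c F) (K : ℂ) (s : PhotonProcess) :
    wignerOpBar s c (fun α => K * F ((2 : ℝ) • α)) = fun α => K * charOpBar s c F ((2 : ℝ) • α) := by
  funext α
  rw [wignerOpBar, charOpBar, dzbar_of_hasLineDerivAt
    (hasLineDerivAt_comp_two_smul K (hF ((2 : ℝ) • α)).1.hasLineDerivAt)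
    (hasLineDerivAt_comp_two_smul K (hF ((2 : ℝ) • α)).2.hasLineDerivAt), dzbar]
  have h : ∑ j, conj (c j) * ((2 : ℝ) • α) j = 2 * ∑ j, conj (c j) * α j := by
    rw [Finset.mul_sum]
    refine Finset.sum_congr rfl fun j _ => ?_
    simp only [Pi.smul_apply, Complex.real_smul, Complex.ofReal_ofNat]
    ring
  rw [h]
  ring

end Rescale

/-! ### General mother states -/

theorem matCoeff_processedFamily_parity {ι : Type*} {N : ℝ} (hN : 0 ≤ N) (s : PhotonProcess)
    (up down : ι → FockSpace n) (z : Fin n → ℂ) :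
    matCoeff (processedFamily N (s.pick up down))
        (fun l => parity (processedFamily N (s.pick up down) l)) z =
      -(N * matCoeff (s.pick up down) (s.pick (fun l => -parity (up l)) fun l => -parity (down l))
        z) := by
  have h : ((N : ℝ) : ℂ) = ((Real.sqrt N : ℝ) : ℂ) * ((Real.sqrt N : ℝ) : ℂ) := by
    rw [← Complex.ofReal_mul, Real.mul_self_sqrt hN]
  rw [h, matCoeff, matCoeff, ← tsum_mul_left, ← tsum_neg]
  refine tsum_congr fun l => ?_
  cases s <;>
  · simp only [PhotonProcess.pick, processedFamily, map_smul, map_neg, inner_neg_right,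
      inner_smul_left, inner_smul_right, Complex.conj_ofReal]
    ring

theorem processed_of_ne_top (s : PhotonProcess) (c : Fin n → ℂ) (hc : ∑ j, ‖c j‖ ^ 2 = 1)
    (ρ : FockSpace n →L[ℂ] FockSpace n) (hρ : IsDensityOperator ρ)
    (hs : s = PhotonProcess.subtraction → processTrace s c ρ ≠ 0)
    (hfin : processTrace s c ρ ≠ ∞) :
    (∃! σ, IsProcessed s c ρ σ) ∧
      ∀ σ, IsProcessed s c ρ σ →
        IsDensityOperator σ ∧
        DirDifferentiable c (charFn ρ) ∧
        DirDifferentiable c (charOpBar s c (charFn ρ)) ∧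
        (∀ z, charFn σ z = -(normConst s c ρ : ℂ) *
          charOp s c (charOpBar s c (charFn ρ)) z) ∧
        (∀ α, Tendsto (fun ε => regFourier (charFn ρ) ε α) (𝓝[>] 0) (𝓝 (wigner ρ α))) ∧
        (∀ α, Tendsto (fun ε => regFourier (charFn σ) ε α) (𝓝[>] 0) (𝓝 (wigner σ α))) ∧
        DirDifferentiable c (wigner ρ) ∧
        DirDifferentiable c (wignerOpBar s c (wigner ρ)) ∧
        (∀ α, wigner σ α = (normConst s c ρ : ℂ) *
          wignerOp s c (wignerOpBar s c (wigner ρ)) α) := by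
  obtain ⟨ψ, hψ⟩ := hρ.exists_mixture
  obtain ⟨up, down, hL, hsum⟩ := hψ.exists_ladderFamily hfin
  obtain ⟨σ₀, hσ₀, hproc⟩ := hψ.exists_processed s hL
  refine ⟨⟨σ₀, hproc, fun σ hσ => isProcessed_unique hσ hproc⟩, fun σ hσ => ?_⟩
  obtain rfl := isProcessed_unique hσ hproc
  have hN := normConst_nonneg s c ρ
  have hLP := hL.parity
  set F := matCoeff ψ fun l => parity (ψ l) with hF
  have hd1 : DirDifferentiable c F := dirDifferentiable_matCoeff_right hL.sq hLP
  have hd2 := dirDifferentiable_charOpBar_matCoeff s hL hLP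
  have hW : wigner ρ = fun α => wignerConst n * F ((2 : ℝ) • α) := funext hψ.wigner_eq
  have hW2 : wignerOpBar s c (wigner ρ) =
      fun α => wignerConst n * charOpBar s c F ((2 : ℝ) • α) := by
    rw [hW, wignerOpBar_comp_two_smul hd1]
  refine ⟨hψ.isDensityOperator_processed hρ hc hs hfin hL hsum hσ₀, ?_, ?_, fun z => ?_,
    hψ.tendsto_regFourier, hσ₀.tendsto_regFourier, ?_, ?_, fun α => ?_⟩
  · rw [hψ.charFn_eq]
    exact dirDifferentiable_matCoeff_right hL.sq hL
  · rw [hψ.charFn_eq]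
    exact dirDifferentiable_charOpBar_matCoeff s hL hL
  · rw [hσ₀.charFn_eq, hψ.charFn_eq, charOp_charOpBar_matCoeff s hL hL,
      matCoeff_processedFamily hN]
    ring
  · rw [hW]
    exact hd1.comp_two_smul _
  · rw [hW2]
    exact hd2.comp_two_smul _
  · rw [hW2, wignerOp_comp_two_smul hd2, hσ₀.wigner_eq, matCoeff_processedFamily_parity hN]
    beta_reduce
    rw [charOp_charOpBar_matCoeff s hL hLP]
    ring

/-! ### Gaussian states: moments and the covariance matrix -/

section Moments

variable {ι : Type*}

/-- The mean square deviation of `D(z)` from a scalar, as a function of `χ(z)`. With `a = χ(z)` it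
detects common eigenvectors; with `a = 1` it bounds difference quotients. -/
theorem hasSum_norm_weyl_sub_sq {ψ : ι → FockSpace n} (hψ : SqSummable ψ)
    (z : Fin n → ℂ) (a : ℂ) :
    HasSum (fun l => ‖weyl z (ψ l) - a • ψ l‖ ^ 2)
      ((1 + ‖a‖ ^ 2) * (∑' l, ‖ψ l‖ ^ 2) - 2 * (conj a * matCoeff ψ ψ z).re) := by
  have h1 := ((hasSum_matCoeff hψ hψ z).mul_left (conj a)).mapL Complex.reCLM
  have h2 := (hψ.hasSum.mul_left (1 + ‖a‖ ^ 2)).sub (h1.mul_left 2)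
  refine hasSum_of_eq h2 fun l => ?_
  rw [@norm_sub_sq ℂ, (weyl z).norm_map, inner_smul_right, norm_smul, mul_pow,
    ← inner_conj_symm (weyl z (ψ l))]
  simp only [Complex.reCLM_apply, RCLike.re_to_complex, Complex.mul_re, Complex.conj_re,
    Complex.conj_im]
  ring

theorem weyl_comm (z w : Fin n → ℂ) (x : FockSpace n) :
    weyl w (weyl z x) = Complex.exp (symp w z) • weyl z (weyl w x) := by
  have h : symp z w = -symp w z := by
    simp only [symp, ← Finset.sum_neg_distrib]
    refine Finset.sum_congr rfl fun j _ => ?_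
    ring
  rw [weyl_weyl, weyl_weyl, h, add_comm z w, smul_smul, ← Complex.exp_add]
  congr 2
  ring

/-- Conjugation by `D(z)` multiplies `D(w)` by a phase, yet leaves its expectations in eigenvectors
of `D(z)` unchanged. -/
theorem matCoeff_eq_exp_symp_mul {ψ : ι → FockSpace n} {z : Fin n → ℂ} {a : ℂ} (ha : ‖a‖ = 1)
    (h : ∀ l, weyl z (ψ l) = a • ψ l) (w : Fin n → ℂ) :
    matCoeff ψ ψ w = Complex.exp (symp w z) * matCoeff ψ ψ w := by
  rw [matCoeff, ← tsum_mul_left]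
  refine tsum_congr fun l => ?_
  have h1 : inner ℂ (weyl z (ψ l)) (weyl w (weyl z (ψ l))) =
      inner ℂ (ψ l) (weyl w (ψ l)) := by
    rw [h l, map_smul, inner_smul_left, inner_smul_right, ← mul_assoc, Complex.conj_mul', ha]
    simp
  exact h1.symm.trans (by rw [weyl_comm, inner_smul_right, (weyl z).inner_map_map])

/-- If `|χ(z)| = 1`, the deviation of `D(z)` from `χ(z)` vanishes and every `ψ l` is an eigenvector.
For a suitable `w` the phase of the preceding lemma is `-1`, so `χ(w) = 0`, which is excluded. -/
theorem norm_charFn_lt_one {ψ : ι → FockSpace n} (hψ : SqSummable ψ)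
    (h1 : ∑' l, ‖ψ l‖ ^ 2 = 1) (h0 : ∀ w, matCoeff ψ ψ w ≠ 0) {z : Fin n → ℂ} (hz : z ≠ 0) :
    ‖matCoeff ψ ψ z‖ < 1 := by
  set a := matCoeff ψ ψ z with ha
  have hs := hasSum_norm_weyl_sub_sq hψ z a
  have hre : (1 + ‖a‖ ^ 2) * (∑' l, ‖ψ l‖ ^ 2) - 2 * (conj a * matCoeff ψ ψ z).re =
      1 - ‖a‖ ^ 2 := by
    rw [h1, ← ha, Complex.conj_mul', ← Complex.ofReal_pow, Complex.ofReal_re]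
    ring
  rw [hre] at hs
  have hle : 0 ≤ 1 - ‖a‖ ^ 2 := hs.nonneg fun l => sq_nonneg _
  have hle1 : ‖a‖ ≤ 1 := by nlinarith [norm_nonneg a]
  refine lt_of_le_of_ne hle1 fun hone => ?_
  rw [hone, one_pow, sub_self] at hs
  have hzero := (hasSum_zero_iff_of_nonneg fun l => sq_nonneg _).mp hs
  have hw : ∀ l, weyl z (ψ l) = a • ψ l := fun l => by
    have := congrFun hzero l
    simpa [sub_eq_zero] using this
  have hS : 0 < ∑ j, ‖z j‖ ^ 2 := by
    obtain ⟨j, hj⟩ := Function.ne_iff.mp hz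
    exact Finset.sum_pos' (fun _ _ => sq_nonneg _)
      ⟨j, Finset.mem_univ _, pow_pos (norm_pos_iff.mpr hj) 2⟩
  set S := ∑ j, ‖z j‖ ^ 2 with hSdef
  -- For `w = iκz` one has `symp w z = 2iκS`; this `κ` makes it `iπ`.
  set w : Fin n → ℂ := (((Real.pi / (2 * S) : ℝ) : ℂ) * Complex.I) • z with hwdef
  have hsymp : symp w z = Real.pi * Complex.I := by
    have h2 : symp w z = ((Real.pi / (2 * S) : ℝ) : ℂ) * Complex.I * 2 * (S : ℂ) := by
      rw [hSdef, Complex.ofReal_sum, Finset.mul_sum, symp]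
      refine Finset.sum_congr rfl fun j _ => ?_
      rw [Complex.ofReal_pow, ← Complex.mul_conj', hwdef]
      simp only [Pi.smul_apply, smul_eq_mul, map_mul, Complex.conj_ofReal, Complex.conj_I]
      ring
    rw [h2]
    have hS0 : (S : ℂ) ≠ 0 := by exact_mod_cast hS.ne'
    push_cast
    field_simp
  have hfin := matCoeff_eq_exp_symp_mul hone hw w
  rw [hsymp, Complex.exp_pi_mul_I] at hfin
  refine h0 w ?_
  linear_combination hfin / 2

/-! ### Finite second moments from the behaviour of the characteristic function at the origin -/

theorem real_smul_eq (t : ℝ) (x : FockSpace n) : t • x = (t : ℂ) • x :=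
  Subtype.ext (funext fun k => (Complex.coe_smul t (x k)).symm)

/-- A Fatou argument: for each `t ≠ 0` a finite sum of squared coefficients of the difference
quotients is at most `C`, and each coefficient converges as `t → 0`. -/
theorem sum_norm_adjCoeff_gen_le {ψ : ι → FockSpace n} (hψ : SqSummable ψ)
    {v : Fin n → ℂ} {C : ℝ}
    (hC : ∀ t : ℝ, ∑' l, ‖weyl (t • v) (ψ l) - ψ l‖ ^ 2 ≤ C * t ^ 2)
    (F : Finset (ι × (Fin n → ℕ))) :
    ∑ p ∈ F, ‖adjCoeff (gen v) (ψ p.1) p.2‖ ^ 2 ≤ C := by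
  have hlim : ∀ p : ι × (Fin n → ℕ), Tendsto (fun t : ℝ =>
      ‖inner ℂ (t⁻¹ • (weyl (t • v) (numberState p.2) - numberState p.2)) (ψ p.1)‖ ^ 2)
      (𝓝[≠] 0) (𝓝 (‖adjCoeff (gen v) (ψ p.1) p.2‖ ^ 2)) := fun p => by
    -- The quotient is taken on the number state, where the derivative exists; `ψ p.1` is not known
    -- to be in the domain of the generator.
    have h := (hasDerivAt_weyl_incl_zero v (Finsupp.single p.2 1)).tendsto_slope_zero
    simp only [incl_single, one_smul, zero_add, zero_smul, weyl_zero] at h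
    exact ((h.inner tendsto_const_nhds).norm).pow 2
  refine le_of_tendsto (tendsto_finsetSum F fun p _ => hlim p) ?_
  filter_upwards [self_mem_nhdsWithin] with t ht
  have ht0 : t ≠ 0 := ht
  have hsq : SqSummable fun l => weyl ((-t) • v) (ψ l) - ψ l := (hψ.weyl _).sub hψ
  have hterm : ∀ p : ι × (Fin n → ℕ),
      ‖inner ℂ (t⁻¹ • (weyl (t • v) (numberState p.2) - numberState p.2)) (ψ p.1)‖ ^ 2 =
        (t ^ 2)⁻¹ * ‖(weyl ((-t) • v) (ψ p.1) - ψ p.1) p.2‖ ^ 2 := fun p => by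
    have h1 : inner ℂ (weyl (t • v) (numberState p.2) - numberState p.2) (ψ p.1) =
        (weyl ((-t) • v) (ψ p.1) - ψ p.1) p.2 := by
      rw [inner_sub_left, inner_weyl_left, ← neg_smul, inner_numberState_left,
        inner_numberState_left]
      rfl
    have h2 : inner ℂ (t⁻¹ • (weyl (t • v) (numberState p.2) - numberState p.2)) (ψ p.1) =
        (t⁻¹ : ℂ) * (weyl ((-t) • v) (ψ p.1) - ψ p.1) p.2 := by
      rw [← h1, real_smul_eq, inner_smul_left, Complex.conj_ofReal, Complex.ofReal_inv]
    rw [h2, norm_mul, mul_pow, norm_inv, Complex.norm_real, inv_pow, Real.norm_eq_abs, sq_abs]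
  simp only [hterm]
  rw [← Finset.mul_sum]
  have hb : ∑ p ∈ F, ‖(weyl ((-t) • v) (ψ p.1) - ψ p.1) p.2‖ ^ 2 ≤ C * t ^ 2 := by
    refine (hsq.summable_apply.sum_le_tsum F fun _ _ => sq_nonneg _).trans ?_
    rw [hsq.summable_apply.tsum_prod]
    simp only [(hasSum_norm_sq (weyl ((-t) • v) (ψ _) - ψ _)).tsum_eq]
    simpa using hC (-t)
  rw [inv_mul_le_iff₀ (by positivity), mul_comm]
  exact hb

theorem summable_adjCoeff_gen {ψ : ι → FockSpace n} (hψ : SqSummable ψ)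
    {v : Fin n → ℂ} {C : ℝ}
    (hC : ∀ t : ℝ, ∑' l, ‖weyl (t • v) (ψ l) - ψ l‖ ^ 2 ≤ C * t ^ 2) :
    Summable fun p : ι × (Fin n → ℕ) => ‖adjCoeff (gen v) (ψ p.1) p.2‖ ^ 2 :=
  summable_of_sum_le (fun _ => sq_nonneg _) (sum_norm_adjCoeff_gen_le hψ hC)

theorem gen_I_smul (c : Fin n → ℂ) :
    gen (Complex.I • c) = Complex.I • (creatAt c + annihAt c) := by
  refine LinearMap.ext fun v => ?_
  simp only [gen, creatAt_smul, annihAt_smul, Complex.conj_I, LinearMap.sub_apply,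
    LinearMap.smul_apply, LinearMap.add_apply, smul_add, neg_smul, sub_neg_eq_add]

/-- The generators along `c` and `ic` give, up to a phase, the difference and the sum of the two
ladder coefficients; the parallelogram law recovers each of them. -/
theorem norm_adjCoeff_rightOp_sq_le (s : PhotonProcess) (c : Fin n → ℂ) (ψ : FockSpace n)
    (k : Fin n → ℕ) : ‖adjCoeff (s.rightOp c) ψ k‖ ^ 2 ≤
      ‖adjCoeff (gen c) ψ k‖ ^ 2 + ‖adjCoeff (gen (Complex.I • c)) ψ k‖ ^ 2 := by
  have h1 : adjCoeff (gen c) ψ k = adjCoeff (creatAt c) ψ k - adjCoeff (annihAt c) ψ k := by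
    simp only [adjCoeff, gen, LinearMap.sub_apply, map_sub, inner_sub_left]
  have h2 : adjCoeff (gen (Complex.I • c)) ψ k =
      -Complex.I * (adjCoeff (creatAt c) ψ k + adjCoeff (annihAt c) ψ k) := by
    simp only [adjCoeff, gen_I_smul, LinearMap.smul_apply, LinearMap.add_apply, map_smul, map_add,
      inner_smul_left, inner_add_left, Complex.conj_I]
  rw [h1, h2, norm_mul, norm_neg, Complex.norm_I, one_mul]
  have h3 := parallelogram_law_with_norm ℝ (adjCoeff (creatAt c) ψ k) (adjCoeff (annihAt c) ψ k)
  have h4 := sq_nonneg ‖adjCoeff (creatAt c) ψ k‖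
  have h5 := sq_nonneg ‖adjCoeff (annihAt c) ψ k‖
  cases s with
  | addition => simp only [PhotonProcess.rightOp]; nlinarith
  | subtraction => simp only [PhotonProcess.rightOp]; nlinarith

theorem Mixture.processTrace_ne_top {ρ : FockSpace n →L[ℂ] FockSpace n} {ψ : ι → FockSpace n}
    (h : Mixture ρ ψ) (s : PhotonProcess) (c : Fin n → ℂ)
    (hC : ∀ v : Fin n → ℂ, ∃ C : ℝ, ∀ t : ℝ,
      ∑' l, ‖weyl (t • v) (ψ l) - ψ l‖ ^ 2 ≤ C * t ^ 2) : processTrace s c ρ ≠ ∞ := by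
  obtain ⟨C, hC1⟩ := hC c
  obtain ⟨C', hC2⟩ := hC (Complex.I • c)
  have hs : Summable fun p : ι × (Fin n → ℕ) => ‖adjCoeff (s.rightOp c) (ψ p.1) p.2‖ ^ 2 :=
    Summable.of_nonneg_of_le (fun _ => sq_nonneg _)
      (fun p => norm_adjCoeff_rightOp_sq_le s c (ψ p.1) p.2)
      ((summable_adjCoeff_gen h.sq hC1).add (summable_adjCoeff_gen h.sq hC2))
  rw [h.processTrace_eq, ← ENNReal.tsum_prod
    (f := fun l k => ENNReal.ofReal (‖adjCoeff (s.rightOp c) (ψ l) k‖ ^ 2)),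
    ← ENNReal.ofReal_tsum_of_nonneg (fun _ => sq_nonneg _) hs]
  exact ENNReal.ofReal_ne_top

end Moments

/-! ### Differential operators on Gaussian functions -/

/-- The real vector of `z`, with complex entries. -/
def cvec (z : Fin n → ℂ) : Quad n → ℂ := fun q => (realVec z q : ℂ)

theorem realVec_add (z w : Fin n → ℂ) : realVec (z + w) = realVec z + realVec w := by
  funext q
  by_cases h : q.2 = 0 <;> simp [realVec, h]

theorem realVec_smul (t : ℝ) (z : Fin n → ℂ) : realVec (t • z) = t • realVec z := by
  funext q
  by_cases h : q.2 = 0 <;> simp [realVec, h]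

theorem cvec_add_smul (z v : Fin n → ℂ) (t : ℝ) :
    cvec (z + t • v) = cvec z + (t : ℂ) • cvec v := by
  funext q
  simp [cvec, realVec_add, realVec_smul]

theorem mVec_apply_zero (c : Fin n → ℂ) (j : Fin n) :
    mVec c (j, 0) = ((Real.sqrt 2 : ℝ) : ℂ)⁻¹ * c j := by
  simp [mVec, Umat, Matrix.mulVec, dotProduct, Fintype.sum_prod_type, Matrix.one_apply, ite_mul,
    apply_ite (starRingEnd ℂ)]

theorem mVec_apply_one (c : Fin n → ℂ) (j : Fin n) :
    mVec c (j, 1) = -Complex.I * (((Real.sqrt 2 : ℝ) : ℂ)⁻¹ * c j) := by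
  simp [mVec, Umat, Matrix.mulVec, dotProduct, Fintype.sum_prod_type, Matrix.one_apply, ite_mul,
    apply_ite (starRingEnd ℂ)]
  ring

theorem ofReal_sqrt_two_mul_self :
    ((Real.sqrt 2 : ℝ) : ℂ) * ((Real.sqrt 2 : ℝ) : ℂ) = 2 := by
  rw [← Complex.ofReal_mul, Real.mul_self_sqrt (by norm_num)]
  norm_num

theorem ofReal_sqrt_two_ne_zero : ((Real.sqrt 2 : ℝ) : ℂ) ≠ 0 := by
  simp

theorem quad_ext {x y : Quad n → ℂ} (h0 : ∀ j, x (j, 0) = y (j, 0))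
    (h1 : ∀ j, x (j, 1) = y (j, 1)) : x = y := by
  funext ⟨j, i⟩
  fin_cases i
  · exact h0 j
  · exact h1 j

theorem cvec_zero_index (z : Fin n → ℂ) (j : Fin n) : cvec z (j, 0) = ((z j).re : ℂ) := rfl

theorem cvec_one_index (z : Fin n → ℂ) (j : Fin n) : cvec z (j, 1) = ((z j).im : ℂ) := rfl

/-- It exhibits `c·∂_z` as the derivative along the complex direction `m_c/√2` in real coordinates,
which is how `m_c` enters the Gaussian formulas. -/
theorem sqrt_two_smul_mVec (c : Fin n → ℂ) :
    ((Real.sqrt 2 : ℝ) : ℂ) • mVec c = cvec c - Complex.I • cvec (Complex.I • c) := by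
  have h0 := ofReal_sqrt_two_ne_zero
  refine quad_ext (fun j => ?_) fun j => ?_
  · rw [Pi.smul_apply, mVec_apply_zero, Pi.sub_apply, Pi.smul_apply, cvec_zero_index,
      cvec_zero_index, smul_eq_mul, mul_inv_cancel_left₀ h0]
    apply Complex.ext <;> simp
  · rw [Pi.smul_apply, mVec_apply_one, Pi.sub_apply, Pi.smul_apply, cvec_one_index,
      cvec_one_index, smul_eq_mul, mul_left_comm, mul_inv_cancel_left₀ h0]
    apply Complex.ext <;> simp

theorem sqrt_two_smul_mVecBar (c : Fin n → ℂ) :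
    ((Real.sqrt 2 : ℝ) : ℂ) • mVecBar c = cvec c + Complex.I • cvec (Complex.I • c) := by
  funext q
  have h := congrArg conj (congrFun (sqrt_two_smul_mVec c) q)
  simpa [mVecBar, cvec] using h

theorem sqrt_two_mul_mVec_dotProduct_cvec (c z : Fin n → ℂ) :
    ((Real.sqrt 2 : ℝ) : ℂ) * (mVec c ⬝ᵥ cvec z) = ∑ j, c j * conj (z j) := by
  have h0 := ofReal_sqrt_two_ne_zero
  rw [dotProduct, Fintype.sum_prod_type, Finset.mul_sum]
  refine Finset.sum_congr rfl fun j _ => ?_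
  rw [Fin.sum_univ_two, mVec_apply_zero, mVec_apply_one, cvec_zero_index, cvec_one_index]
  have hz : conj (z j) = ((z j).re : ℂ) - (z j).im * Complex.I := by
    apply Complex.ext <;> simp
  rw [hz]
  field_simp
  ring

theorem sqrt_two_mul_mVecBar_dotProduct_cvec (c z : Fin n → ℂ) :
    ((Real.sqrt 2 : ℝ) : ℂ) * (mVecBar c ⬝ᵥ cvec z) = ∑ j, conj (c j) * z j := by
  have h := congrArg conj (sqrt_two_mul_mVec_dotProduct_cvec c z)
  simpa [dotProduct, mVecBar, cvec] using h

theorem mVecBar_dotProduct_mVec {c : Fin n → ℂ} (hc : ∑ j, ‖c j‖ ^ 2 = 1) :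
    mVecBar c ⬝ᵥ mVec c = 1 := by
  have h0 := ofReal_sqrt_two_ne_zero
  have h2 := ofReal_sqrt_two_mul_self
  have hc' : ∑ j, c j * conj (c j) = 1 := by
    simp only [Complex.mul_conj']
    exact_mod_cast hc
  rw [← hc', dotProduct, Fintype.sum_prod_type]
  refine Finset.sum_congr rfl fun j _ => ?_
  simp only [mVecBar, Fin.sum_univ_two, mVec_apply_zero, mVec_apply_one, map_mul, map_neg,
    map_inv₀, Complex.conj_ofReal, Complex.conj_I]
  field_simp
  linear_combination (-(c j * conj (c j))) * Complex.I_sq - c j * conj (c j) * h2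

/-- The Gaussian function `K exp(-½ ξᵀ M ξ + bᵀ ξ)` of the real vector `ξ` of `z`. -/
def quadExp (K : ℂ) (M : Matrix (Quad n) (Quad n) ℂ) (b : Quad n → ℂ) (z : Fin n → ℂ) : ℂ :=
  K * Complex.exp (-(1 / 2) * (cvec z ⬝ᵥ (M *ᵥ cvec z)) + b ⬝ᵥ cvec z)

section QuadExp

variable {K : ℂ} {M : Matrix (Quad n) (Quad n) ℂ} {b : Quad n → ℂ}

theorem dotProduct_mulVec_comm (hM : Mᵀ = M) (x y : Quad n → ℂ) :
    x ⬝ᵥ (M *ᵥ y) = y ⬝ᵥ (M *ᵥ x) := by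
  rw [Matrix.dotProduct_mulVec, ← Matrix.mulVec_transpose, hM, dotProduct_comm]

theorem hasLineDerivAt_quadExp (hM : Mᵀ = M) (z v : Fin n → ℂ) :
    HasLineDerivAt ℝ (quadExp K M b)
      (quadExp K M b z * (cvec v ⬝ᵥ (b - M *ᵥ cvec z))) z v := by
  set x := cvec z with hx
  set y := cvec v with hy
  have hP : HasDerivAt (fun t : ℝ => -(1 / 2) * (x ⬝ᵥ (M *ᵥ x)) + b ⬝ᵥ x +
      (t : ℂ) * (y ⬝ᵥ (b - M *ᵥ x)) - (t : ℂ) ^ 2 * ((1 / 2) * (y ⬝ᵥ (M *ᵥ y))))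
      (y ⬝ᵥ (b - M *ᵥ x)) 0 := by
    have h1 : HasDerivAt (fun t : ℝ => (t : ℂ)) 1 0 := Complex.ofRealCLM.hasDerivAt
    have h2 := ((h1.mul_const (y ⬝ᵥ (b - M *ᵥ x))).const_add
      (-(1 / 2) * (x ⬝ᵥ (M *ᵥ x)) + b ⬝ᵥ x)).sub
      ((h1.pow 2).mul_const ((1 / 2) * (y ⬝ᵥ (M *ᵥ y))))
    exact h2.congr_deriv (by simp)
  have h3 := (hP.cexp).const_mul K
  refine (h3.congr_of_eventuallyEq (Eventually.of_forall fun t => ?_)).congr_deriv ?_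
  · simp only [quadExp, cvec_add_smul, ← hx, ← hy]
    congr 2
    simp only [Matrix.mulVec_add, Matrix.mulVec_smul, dotProduct_add, add_dotProduct,
      smul_dotProduct, dotProduct_smul, dotProduct_sub, smul_eq_mul,
      dotProduct_mulVec_comm hM x y, dotProduct_comm y b]
    ring
  · simp only [quadExp, ← hx, Complex.ofReal_zero, zero_mul, add_zero]
    ring_nf

/-- The logarithmic derivative of `quadExp` under `κ ∂ - τ z`, without the coefficients. -/
def gammaVec (κ τ : ℂ) (M : Matrix (Quad n) (Quad n) ℂ) (b : Quad n → ℂ) (z : Fin n → ℂ) :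
    Quad n → ℂ :=
  (κ / ((Real.sqrt 2 : ℝ) : ℂ)) • (b - M *ᵥ cvec z) - (τ * ((Real.sqrt 2 : ℝ) : ℂ)) • cvec z

theorem dz_eq_of_hasLineDerivAt_dotProduct {f : (Fin n → ℂ) → ℂ} {a : ℂ} {g : Quad n → ℂ}
    {z c : Fin n → ℂ} (h : ∀ v, HasLineDerivAt ℝ f (a * (cvec v ⬝ᵥ g)) z v) :
    dz c f z = a * (mVec c ⬝ᵥ g) / ((Real.sqrt 2 : ℝ) : ℂ) := by
  have h0 := ofReal_sqrt_two_ne_zero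
  have h2 := ofReal_sqrt_two_mul_self
  have h1 := congrArg (fun x => x ⬝ᵥ g) (sqrt_two_smul_mVec c)
  simp only [smul_dotProduct, sub_dotProduct, smul_eq_mul] at h1
  rw [dz, (h c).lineDeriv, (h (Complex.I • c)).lineDeriv, eq_div_iff h0]
  linear_combination (-(a * ((Real.sqrt 2 : ℝ) : ℂ) / 2)) * h1 + (a * (mVec c ⬝ᵥ g) / 2) * h2

theorem dzbar_eq_of_hasLineDerivAt_dotProduct {f : (Fin n → ℂ) → ℂ} {a : ℂ} {g : Quad n → ℂ}
    {z c : Fin n → ℂ} (h : ∀ v, HasLineDerivAt ℝ f (a * (cvec v ⬝ᵥ g)) z v) :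
    dzbar c f z = a * (mVecBar c ⬝ᵥ g) / ((Real.sqrt 2 : ℝ) : ℂ) := by
  have h0 := ofReal_sqrt_two_ne_zero
  have h2 := ofReal_sqrt_two_mul_self
  have h1 := congrArg (fun x => x ⬝ᵥ g) (sqrt_two_smul_mVecBar c)
  simp only [smul_dotProduct, add_dotProduct, smul_eq_mul] at h1
  rw [dzbar, (h c).lineDeriv, (h (Complex.I • c)).lineDeriv, eq_div_iff h0]
  linear_combination (-(a * ((Real.sqrt 2 : ℝ) : ℂ) / 2)) * h1 + (a * (mVecBar c ⬝ᵥ g) / 2) * h2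

theorem dzbar_quadExp (hM : Mᵀ = M) (κ τ : ℂ) (c z : Fin n → ℂ) :
    κ * dzbar c (quadExp K M b) z - τ * (∑ j, conj (c j) * z j) * quadExp K M b z =
      (mVecBar c ⬝ᵥ gammaVec κ τ M b z) * quadExp K M b z := by
  rw [dzbar_eq_of_hasLineDerivAt_dotProduct (hasLineDerivAt_quadExp hM z),
    ← sqrt_two_mul_mVecBar_dotProduct_cvec]
  simp only [gammaVec, dotProduct_sub, dotProduct_smul, smul_eq_mul]
  ring

theorem hasLineDerivAt_dotProduct_gammaVec (κ τ : ℂ) (m : Quad n → ℂ) (z v : Fin n → ℂ) :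
    HasLineDerivAt ℝ (fun z => m ⬝ᵥ gammaVec κ τ M b z)
      (-(κ / ((Real.sqrt 2 : ℝ) : ℂ) * (m ⬝ᵥ (M *ᵥ cvec v)) +
        τ * ((Real.sqrt 2 : ℝ) : ℂ) * (m ⬝ᵥ cvec v))) z v := by
  have h1 : HasDerivAt (fun t : ℝ => (t : ℂ)) 1 0 := Complex.ofRealCLM.hasDerivAt
  have h2 := (h1.mul_const (-(κ / ((Real.sqrt 2 : ℝ) : ℂ) * (m ⬝ᵥ (M *ᵥ cvec v)) +
        τ * ((Real.sqrt 2 : ℝ) : ℂ) * (m ⬝ᵥ cvec v)))).const_add (m ⬝ᵥ gammaVec κ τ M b z)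
  refine (h2.congr_of_eventuallyEq (Eventually.of_forall fun t => ?_)).congr_deriv (one_mul _)
  simp only [gammaVec, cvec_add_smul, Matrix.mulVec_add, Matrix.mulVec_smul, dotProduct_add,
    dotProduct_smul, dotProduct_sub, smul_eq_mul]
  ring

/-- One product rule for both functions: `(κ, τ)` is `(1, ±1/2)` for `χ` and `(1/2, ±1)` for `W`.
Differentiating the affine factor yields the two constants, where `m̄_c · m_c = 1` simplifies `-κτ`;
differentiating the Gaussian yields the product of linear factors. -/
theorem dz_gamma_mul_quadExp (hM : Mᵀ = M) (κ τ : ℂ) {c : Fin n → ℂ} (hc : ∑ j, ‖c j‖ ^ 2 = 1)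
    (z : Fin n → ℂ) :
    κ * dz c (fun z => (mVecBar c ⬝ᵥ gammaVec κ τ M b z) * quadExp K M b z) z -
        τ * (∑ j, c j * conj (z j)) *
          ((mVecBar c ⬝ᵥ gammaVec κ τ M b z) * quadExp K M b z) =
      (-(κ ^ 2 / 2) * (mVecBar c ⬝ᵥ (M *ᵥ mVec c)) - κ * τ +
        (gammaVec κ τ M b z ⬝ᵥ mVec c) * (mVecBar c ⬝ᵥ gammaVec κ τ M b z)) *
        quadExp K M b z := by
  have h0 := ofReal_sqrt_two_ne_zero
  have h2 := ofReal_sqrt_two_mul_self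
  set f := quadExp K M b z with hf
  set G := mVecBar c ⬝ᵥ gammaVec κ τ M b z with hG
  have hd : ∀ v, HasLineDerivAt ℝ
      (fun z => (mVecBar c ⬝ᵥ gammaVec κ τ M b z) * quadExp K M b z)
      (f * (cvec v ⬝ᵥ (G • (b - M *ᵥ cvec z) -
        ((κ / ((Real.sqrt 2 : ℝ) : ℂ)) • (M *ᵥ mVecBar c) +
          (τ * ((Real.sqrt 2 : ℝ) : ℂ)) • mVecBar c)))) z v := fun v => by
    have h := (hasLineDerivAt_dotProduct_gammaVec (M := M) (b := b) κ τ (mVecBar c) z v).mul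
      (hasLineDerivAt_quadExp (K := K) (b := b) hM z v)
    refine HasDerivAt.congr_deriv h ?_
    simp only [zero_smul, add_zero, ← hf, ← hG, dotProduct_sub, dotProduct_add, dotProduct_smul,
      smul_eq_mul, dotProduct_mulVec_comm hM (mVecBar c) (cvec v), dotProduct_comm (mVecBar c)]
    ring
  rw [dz_eq_of_hasLineDerivAt_dotProduct hd, ← sqrt_two_mul_mVec_dotProduct_cvec,
    dotProduct_comm (gammaVec κ τ M b z)]
  have hm := mVecBar_dotProduct_mVec hc
  rw [dotProduct_comm] at hm
  simp only [gammaVec, dotProduct_sub, dotProduct_add, dotProduct_smul, smul_eq_mul, hm,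
    dotProduct_mulVec_comm hM (mVec c) (mVecBar c)]
  field_simp
  linear_combination (κ ^ 2 * f * (mVecBar c ⬝ᵥ (M *ᵥ mVec c))) * h2

end QuadExp

/-! ### The characteristic function of a Gaussian state -/

theorem covarianceMatrix_transpose (ρ : FockSpace n →L[ℂ] FockSpace n) :
    (covarianceMatrix ρ)ᵀ = covarianceMatrix ρ := by
  ext i j
  simp only [covarianceMatrix, Matrix.transpose_apply, Matrix.of_apply]
  rw [add_comm, mul_right_comm]

theorem Omega_mulVec_zero (x : Quad n → ℝ) (j : Fin n) : (Omega n *ᵥ x) (j, 0) = x (j, 1) := by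
  simp [Omega, Matrix.mulVec, dotProduct, Fintype.sum_prod_type, Matrix.one_apply, ite_mul]

theorem Omega_mulVec_one (x : Quad n → ℝ) (j : Fin n) : (Omega n *ᵥ x) (j, 1) = -x (j, 0) := by
  simp [Omega, Matrix.mulVec, dotProduct, Fintype.sum_prod_type, Matrix.one_apply, ite_mul]

theorem Omega_transpose : (Omega n)ᵀ = -Omega n := by
  ext ⟨i, a⟩ ⟨j, b⟩
  fin_cases a <;> fin_cases b <;>
    simp [Omega, Matrix.one_apply, eq_comm]

theorem Omega_mul_Omega : Omega n * Omega n = -1 := by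
  have h : !![(0 : ℝ), 1; -1, 0] * !![(0 : ℝ), 1; -1, 0] = -1 := by
    ext i j
    fin_cases i <;> fin_cases j <;> simp
  rw [Omega, ← Matrix.mul_kronecker_mul, h, one_mul]
  ext ⟨i, a⟩ ⟨j, b⟩
  by_cases hij : i = j <;> by_cases hab : a = b <;> simp [hij, hab]

theorem toC_mul (A B : Matrix (Quad n) (Quad n) ℝ) : toC (A * B) = toC A * toC B :=
  Matrix.map_mul (f := Complex.ofRealHom)

theorem toC_neg (A : Matrix (Quad n) (Quad n) ℝ) : toC (-A) = -toC A := by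
  ext i j
  simp [toC]

theorem toC_transpose (A : Matrix (Quad n) (Quad n) ℝ) : (toC A)ᵀ = toC Aᵀ := rfl

theorem toC_mulVec (A : Matrix (Quad n) (Quad n) ℝ) (x : Quad n → ℝ) :
    toC A *ᵥ (fun q => (x q : ℂ)) = fun q => ((A *ᵥ x) q : ℂ) := by
  funext q
  simp [toC, Matrix.mulVec, dotProduct]

theorem ofReal_dotProduct (x y : Quad n → ℝ) :
    ((x ⬝ᵥ y : ℝ) : ℂ) = (fun q => (x q : ℂ)) ⬝ᵥ fun q => (y q : ℂ) := by
  simp [dotProduct]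

theorem toC_Omega_mulVec_mVec (c : Fin n → ℂ) :
    toC (Omega n) *ᵥ mVec c = -Complex.I • mVec c := by
  refine quad_ext (fun j => ?_) fun j => ?_
  · simp [toC, Omega, Matrix.mulVec, dotProduct, Fintype.sum_prod_type, Matrix.one_apply,
      mVec_apply_zero, mVec_apply_one, apply_ite Complex.ofReal]
  · simp [toC, Omega, Matrix.mulVec, dotProduct, Fintype.sum_prod_type, Matrix.one_apply,
      mVec_apply_zero, mVec_apply_one, apply_ite Complex.ofReal, ← mul_assoc]

theorem mVecBar_vecMul_toC_Omega (c : Fin n → ℂ) :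
    mVecBar c ᵥ* toC (Omega n) = -Complex.I • mVecBar c := by
  refine quad_ext (fun j => ?_) fun j => ?_
  · simp [toC, Omega, Matrix.vecMul, dotProduct, Fintype.sum_prod_type, Matrix.one_apply, mVecBar,
      mVec_apply_zero, mVec_apply_one, apply_ite Complex.ofReal]
  · simp [toC, Omega, Matrix.vecMul, dotProduct, Fintype.sum_prod_type, Matrix.one_apply, mVecBar,
      mVec_apply_zero, mVec_apply_one, apply_ite Complex.ofReal, ← mul_assoc]

/-- `m_c` is a right and `m̄_c` a left eigenvector of `Ω`, both with eigenvalue `-i`. With `Ωᵀ = -Ω`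
the conjugation contributes the factor `-(-i)² = 1`. -/
theorem mVecBar_dotProduct_conj_Omega (V : Matrix (Quad n) (Quad n) ℝ) (c : Fin n → ℂ) :
    mVecBar c ⬝ᵥ (toC (Omega n * V * (Omega n)ᵀ) *ᵥ mVec c) =
      mVecBar c ⬝ᵥ (toC V *ᵥ mVec c) := by
  rw [Omega_transpose, mul_neg, toC_neg, toC_mul, toC_mul, Matrix.neg_mulVec,
    ← Matrix.mulVec_mulVec, ← Matrix.mulVec_mulVec, toC_Omega_mulVec_mVec, dotProduct_neg,
    Matrix.dotProduct_mulVec, mVecBar_vecMul_toC_Omega]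
  simp only [Matrix.mulVec_smul, smul_dotProduct, dotProduct_smul, smul_eq_mul]
  linear_combination (-(mVecBar c ⬝ᵥ (toC V *ᵥ mVec c))) * Complex.I_sq

/-- It translates the complex notation of `betaVec` into the real coordinates in which the Gaussian
is differentiated. -/
theorem Umat_conjTranspose_mulVec_Zvec (z : Fin n → ℂ) :
    (Umat n)ᴴ *ᵥ Zvec z = ((Real.sqrt 2 : ℝ) : ℂ) • cvec z := by
  have h0 := ofReal_sqrt_two_ne_zero
  have h2 := ofReal_sqrt_two_mul_self
  refine quad_ext (fun j => ?_) fun j => ?_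
  · have hz : conj (z j) = ((z j).re : ℂ) - (z j).im * Complex.I := by
      apply Complex.ext <;> simp
    have hz' : z j = ((z j).re : ℂ) + (z j).im * Complex.I := (Complex.re_add_im _).symm
    have : ((Umat n)ᴴ *ᵥ Zvec z) (j, 0) =
        ((Real.sqrt 2 : ℝ) : ℂ)⁻¹ * z j + ((Real.sqrt 2 : ℝ) : ℂ)⁻¹ * conj (z j) := by
      simp [Umat, Zvec, Matrix.mulVec, dotProduct, Fintype.sum_prod_type, Matrix.one_apply,
        ite_mul, apply_ite (starRingEnd ℂ), Fin.sum_univ_two, Finset.sum_add_distrib]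
    rw [this, Pi.smul_apply, cvec_zero_index, smul_eq_mul, hz]
    conv_lhs => rw [hz']
    simp only [Complex.add_re, Complex.ofReal_re, Complex.mul_re, Complex.I_re, mul_zero,
      Complex.ofReal_im, Complex.I_im, sub_self, add_zero, Complex.add_im,
      Complex.mul_im, mul_one, zero_add]
    field_simp
    linear_combination (-((z j).re : ℂ)) * h2
  · have hz : conj (z j) = ((z j).re : ℂ) - (z j).im * Complex.I := by
      apply Complex.ext <;> simp
    have hz' : z j = ((z j).re : ℂ) + (z j).im * Complex.I := (Complex.re_add_im _).symm
    have : ((Umat n)ᴴ *ᵥ Zvec z) (j, 1) = -Complex.I *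
        (((Real.sqrt 2 : ℝ) : ℂ)⁻¹ * z j - ((Real.sqrt 2 : ℝ) : ℂ)⁻¹ * conj (z j)) := by
      simp [Umat, Zvec, Matrix.mulVec, dotProduct, Fintype.sum_prod_type, Matrix.one_apply,
        ite_mul, apply_ite (starRingEnd ℂ), Fin.sum_univ_two, Finset.sum_add_distrib]
      ring
    rw [this, Pi.smul_apply, cvec_one_index, smul_eq_mul, hz]
    conv_lhs => rw [hz']
    simp only [Complex.add_re, Complex.ofReal_re, Complex.mul_re, Complex.I_re, mul_zero,
      Complex.ofReal_im, Complex.I_im, sub_self, add_zero, Complex.add_im,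
      Complex.mul_im, mul_one, zero_add]
    field_simp
    linear_combination (-((z j).im : ℂ)) * h2 - 2 * ((z j).im : ℂ) * Complex.I_sq

/-- The coefficient vector of the linear part of the exponent of `gaussianChar`. -/
def linVec (d : Quad n → ℝ) : Quad n → ℂ :=
  (-Complex.I * ((Real.sqrt 2 : ℝ) : ℂ)) • fun q => ((Omega n *ᵥ d) q : ℂ)

theorem gaussianChar_eq_quadExp (V : Matrix (Quad n) (Quad n) ℝ) (d : Quad n → ℝ) :
    gaussianChar V d = quadExp 1 (toC (Omega n * V * (Omega n)ᵀ)) (linVec d) := by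
  funext z
  rw [gaussianChar, quadExp, one_mul, linVec]
  congr 1
  have hz : cvec z = fun q => (realVec z q : ℂ) := rfl
  rw [smul_dotProduct, hz, toC_mulVec, ← ofReal_dotProduct, ← ofReal_dotProduct, smul_eq_mul]
  push_cast
  ring

theorem gammaVec_eq_betaVec (s : PhotonProcess) (V : Matrix (Quad n) (Quad n) ℝ) (d : Quad n → ℝ)
    (z : Fin n → ℂ) :
    gammaVec 1 (s.sign / 2) (toC (Omega n * V * (Omega n)ᵀ)) (linVec d) z = betaVec s V d z := by
  have h0 := ofReal_sqrt_two_ne_zero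
  have h2 := ofReal_sqrt_two_mul_self
  rw [gammaVec, betaVec, linVec, Umat_conjTranspose_mulVec_Zvec, Omega_transpose, mul_neg, toC_neg,
    Matrix.neg_mulVec, Matrix.sub_mulVec, Matrix.mulVec_smul, Matrix.smul_mulVec,
    Matrix.one_mulVec]
  funext q
  simp only [Pi.sub_apply, Pi.smul_apply, Pi.neg_apply, smul_eq_mul]
  field_simp
  linear_combination (-((toC (Omega n * V * Omega n) *ᵥ cvec z) q)) * h2

theorem charOpBar_quadExp (s : PhotonProcess) {K : ℂ} {M : Matrix (Quad n) (Quad n) ℂ}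
    (hM : Mᵀ = M) (b : Quad n → ℂ) (c : Fin n → ℂ) :
    charOpBar s c (quadExp K M b) =
      fun z => (mVecBar c ⬝ᵥ gammaVec 1 (s.sign / 2) M b z) * quadExp K M b z := by
  funext z
  rw [← dzbar_quadExp hM, charOpBar]
  ring

theorem charOp_charOpBar_quadExp (s : PhotonProcess) {K : ℂ} {M : Matrix (Quad n) (Quad n) ℂ}
    (hM : Mᵀ = M) (b : Quad n → ℂ) {c : Fin n → ℂ} (hc : ∑ j, ‖c j‖ ^ 2 = 1) (z : Fin n → ℂ) :
    charOp s c (charOpBar s c (quadExp K M b)) z =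
      (-(1 / 2) * (mVecBar c ⬝ᵥ (M *ᵥ mVec c)) - s.sign / 2 +
        (gammaVec 1 (s.sign / 2) M b z ⬝ᵥ mVec c) *
          (mVecBar c ⬝ᵥ gammaVec 1 (s.sign / 2) M b z)) * quadExp K M b z := by
  rw [charOpBar_quadExp s hM]
  have h := dz_gamma_mul_quadExp (K := K) (b := b) hM 1 (s.sign / 2) hc z
  rw [one_pow, one_mul, one_mul] at h
  rw [← h, charOp]
  ring

theorem conj_Omega_transpose {V : Matrix (Quad n) (Quad n) ℝ} (hV : Vᵀ = V) :
    (toC (Omega n * V * (Omega n)ᵀ))ᵀ = toC (Omega n * V * (Omega n)ᵀ) := by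
  rw [toC_transpose, Matrix.transpose_mul, Matrix.transpose_mul, Matrix.transpose_transpose, hV,
    Matrix.mul_assoc]

theorem neg_charOp_charOpBar_gaussianChar (s : PhotonProcess) {V : Matrix (Quad n) (Quad n) ℝ}
    (hV : Vᵀ = V) (d : Quad n → ℝ) {c : Fin n → ℂ} (hc : ∑ j, ‖c j‖ ^ 2 = 1) (z : Fin n → ℂ) :
    -charOp s c (charOpBar s c (gaussianChar V d)) z =
      charFactor s c V d z * gaussianChar V d z := by
  rw [gaussianChar_eq_quadExp, charOp_charOpBar_quadExp s (conj_Omega_transpose hV) _ hc,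
    mVecBar_dotProduct_conj_Omega, gammaVec_eq_betaVec, charFactor]
  ring

/-! ### Positivity of the covariance matrix of a Gaussian state -/

/-- The quadratic form of the exponent of `gaussianChar`. -/
def charForm (V : Matrix (Quad n) (Quad n) ℝ) (z : Fin n → ℂ) : ℝ :=
  realVec z ⬝ᵥ ((Omega n * V * (Omega n)ᵀ) *ᵥ realVec z)

theorem norm_gaussianChar (V : Matrix (Quad n) (Quad n) ℝ) (d : Quad n → ℝ) (z : Fin n → ℂ) :
    ‖gaussianChar V d z‖ = Real.exp (-(1 / 2) * charForm V z) := by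
  rw [gaussianChar, Complex.norm_exp, charForm, Complex.sub_re, Complex.ofReal_re,
    Complex.I_mul_re, Complex.ofReal_im]
  ring_nf

theorem charForm_smul (V : Matrix (Quad n) (Quad n) ℝ) (t : ℝ) (z : Fin n → ℂ) :
    charForm V (t • z) = t ^ 2 * charForm V z := by
  simp only [charForm, realVec_smul, Matrix.mulVec_smul, smul_dotProduct, dotProduct_smul,
    smul_eq_mul]
  ring

theorem continuous_realVec (q : Quad n) : Continuous fun z : Fin n → ℂ => realVec z q := by
  unfold realVec
  split_ifs <;> fun_prop

theorem continuous_charForm (V : Matrix (Quad n) (Quad n) ℝ) : Continuous (charForm V) := by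
  have h : Continuous (realVec : (Fin n → ℂ) → Quad n → ℝ) := continuous_pi continuous_realVec
  unfold charForm
  exact h.dotProduct (continuous_const.matrix_mulVec h)

/-- The linear form of the phase of `gaussianChar`. -/
def charPhase (d : Quad n → ℝ) (z : Fin n → ℂ) : ℝ :=
  Real.sqrt 2 * ((Omega n *ᵥ d) ⬝ᵥ realVec z)

theorem re_gaussianChar (V : Matrix (Quad n) (Quad n) ℝ) (d : Quad n → ℝ) (z : Fin n → ℂ) :
    (gaussianChar V d z).re = Real.exp (-(1 / 2) * charForm V z) * Real.cos (charPhase d z) := by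
  rw [gaussianChar, Complex.exp_re, ← charForm, ← charPhase, Complex.sub_re, Complex.sub_im,
    Complex.ofReal_re, Complex.ofReal_im, Complex.I_mul_re, Complex.I_mul_im, Complex.ofReal_re,
    Complex.ofReal_im, neg_zero, sub_zero, zero_sub, Real.cos_neg]

theorem charPhase_smul (d : Quad n → ℝ) (t : ℝ) (z : Fin n → ℂ) :
    charPhase d (t • z) = t * charPhase d z := by
  simp only [charPhase, realVec_smul, dotProduct_smul, smul_eq_mul]
  ring

/-- For `a, b ≤ 1`, `1 - ab ≤ (1 - a) + (1 - b)`; here `a` is the exponential, `b` the cosine, and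
each deficit is quadratic in `t`. -/
theorem one_sub_re_gaussianChar_le {V : Matrix (Quad n) (Quad n) ℝ} (d : Quad n → ℝ)
    {z : Fin n → ℂ} (hz : 0 ≤ charForm V z) (t : ℝ) :
    1 - (gaussianChar V d (t • z)).re ≤ (charForm V z + charPhase d z ^ 2) / 2 * t ^ 2 := by
  rw [re_gaussianChar, charForm_smul, charPhase_smul]
  have h1 := Real.add_one_le_exp (-(1 / 2) * (t ^ 2 * charForm V z))
  have h2 : Real.exp (-(1 / 2) * (t ^ 2 * charForm V z)) ≤ 1 := by
    rw [Real.exp_le_one_iff]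
    nlinarith [sq_nonneg t, mul_nonneg (sq_nonneg t) hz]
  have h3 := Real.one_sub_sq_div_two_le_cos (x := t * charPhase d z)
  have h4 := Real.cos_le_one (t * charPhase d z)
  nlinarith [mul_nonneg (sub_nonneg.mpr h4) (sub_nonneg.mpr h2)]

section Gaussian

variable {ρ : FockSpace n →L[ℂ] FockSpace n} {ι : Type*} {ψ : ι → FockSpace n}

theorem Mixture.tsum_norm_sq (h : Mixture ρ ψ) (hρ : IsDensityOperator ρ) :
    ∑' l, ‖ψ l‖ ^ 2 = 1 := by
  have h1 := h.hasSum_trace.unique hρ.trace_one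
  exact_mod_cast h1

/-- Positivity is not part of `IsGaussian`. It follows from `|χ(z)| < 1`, which applies because an
exponential never vanishes. -/
theorem Mixture.charForm_pos (h : Mixture ρ ψ) (hρ : IsDensityOperator ρ) (hG : IsGaussian ρ)
    {z : Fin n → ℂ} (hz : z ≠ 0) : 0 < charForm (covarianceMatrix ρ) z := by
  have hχ : ∀ w, matCoeff ψ ψ w =
      gaussianChar (covarianceMatrix ρ) (displacementVector ρ) w := fun w => by
    rw [← h.charFn_eq, hG w]
  have h1 := norm_charFn_lt_one h.sq (h.tsum_norm_sq hρ)
    (fun w => by rw [hχ]; exact Complex.exp_ne_zero _) hz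
  rw [hχ, norm_gaussianChar, Real.exp_lt_one_iff] at h1
  linarith

theorem charForm_zero (V : Matrix (Quad n) (Quad n) ℝ) : charForm V 0 = 0 := by
  have h := charForm_smul V 0 0
  simpa using h

theorem Mixture.processTrace_ne_top_of_isGaussian (h : Mixture ρ ψ) (hρ : IsDensityOperator ρ)
    (hG : IsGaussian ρ) (s : PhotonProcess) (c : Fin n → ℂ) : processTrace s c ρ ≠ ∞ := by
  refine h.processTrace_ne_top s c fun v =>
    ⟨charForm (covarianceMatrix ρ) v + charPhase (displacementVector ρ) v ^ 2, fun t => ?_⟩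
  have h0 : 0 ≤ charForm (covarianceMatrix ρ) v := by
    by_cases hv : v = 0
    · rw [hv, charForm_zero]
    · exact (h.charForm_pos hρ hG hv).le
  have h1 := hasSum_norm_weyl_sub_sq h.sq (t • v) 1
  simp only [one_smul] at h1
  rw [h1.tsum_eq, h.tsum_norm_sq hρ, ← h.charFn_eq, hG]
  have h2 := one_sub_re_gaussianChar_le (displacementVector ρ) h0 t
  simp only [norm_one, map_one, one_mul]
  linarith

theorem exists_realVec_eq (x : Quad n → ℝ) : ∃ z : Fin n → ℂ, realVec z = x := by
  refine ⟨fun j => ⟨x (j, 0), x (j, 1)⟩, ?_⟩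
  funext ⟨j, i⟩
  fin_cases i <;> simp [realVec]

theorem Mixture.posDef_covarianceMatrix (h : Mixture ρ ψ) (hρ : IsDensityOperator ρ)
    (hG : IsGaussian ρ) : (covarianceMatrix ρ).PosDef := by
  refine Matrix.PosDef.of_dotProduct_mulVec_pos ?_ fun x hx => ?_
  · rw [Matrix.IsHermitian, Matrix.conjTranspose_eq_transpose_of_trivial,
      covarianceMatrix_transpose]
  -- The form in `χ` is that of `V` conjugated by `Ω`; the choice `ξ = Ωx` undoes this, since `ΩᵀΩ =
  -- 1`.
  · obtain ⟨z, hz⟩ := exists_realVec_eq (Omega n *ᵥ x)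
    have hΩ : (Omega n)ᵀ *ᵥ realVec z = x := by
      rw [hz, Omega_transpose, Matrix.mulVec_mulVec, neg_mul, Omega_mul_Omega, neg_neg,
        Matrix.one_mulVec]
    have hz0 : z ≠ 0 := by
      rintro rfl
      refine hx ?_
      rw [← hΩ]
      have : realVec (0 : Fin n → ℂ) = 0 := by
        funext q
        simp [realVec]
      rw [this, Matrix.mulVec_zero]
    have hpos := h.charForm_pos hρ hG hz0
    rw [charForm, Matrix.mul_assoc, ← Matrix.mulVec_mulVec, ← Matrix.mulVec_mulVec, hΩ,
      Matrix.dotProduct_mulVec, ← Matrix.mulVec_transpose, hΩ] at hpos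
    rwa [star_trivial]

end Gaussian

/-! ### Integrability of a quadratic polynomial times a Gaussian -/

theorem exists_le_charForm {V : Matrix (Quad n) (Quad n) ℝ}
    (hV : ∀ z : Fin n → ℂ, z ≠ 0 → 0 < charForm V z) :
    ∃ δ : ℝ, 0 < δ ∧ ∀ z : Fin n → ℂ, δ * ∑ j, ‖z j‖ ^ 2 ≤ charForm V z := by
  obtain ⟨δ, hδ, h⟩ := (isCompact_sphere (0 : Fin n → ℂ) 1).exists_forall_le'
    (continuous_charForm V).continuousOn (a := 0)
    fun z hz => hV z (by rintro rfl; simp at hz)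
  -- The minimum `δ` is taken on the unit sphere of the supremum norm. Dividing by `n + 1` compares
  -- with `∑ ‖z j‖²`, and remains meaningful for `n = 0`.
  refine ⟨δ / (n + 1), by positivity, fun z => ?_⟩
  have hsum : ∑ j, ‖z j‖ ^ 2 ≤ (n + 1) * ‖z‖ ^ 2 := by
    calc ∑ j, ‖z j‖ ^ 2 ≤ ∑ _j : Fin n, ‖z‖ ^ 2 :=
          Finset.sum_le_sum fun j _ => pow_le_pow_left₀ (norm_nonneg _) (norm_le_pi_norm z j) 2
      _ = n * ‖z‖ ^ 2 := by simp
      _ ≤ _ := by nlinarith [sq_nonneg ‖z‖]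
  have hn : δ / (n + 1) * ∑ j, ‖z j‖ ^ 2 ≤ δ * ‖z‖ ^ 2 := by
    rw [div_mul_eq_mul_div, div_le_iff₀ (by positivity)]
    nlinarith [mul_le_mul_of_nonneg_left hsum hδ.le]
  refine hn.trans ?_
  by_cases hz : z = 0
  · simp [hz, charForm_zero]
  · have hz' : ‖z‖ ≠ 0 := norm_ne_zero_iff.mpr hz
    have h1 := h (‖z‖⁻¹ • z) (by simp [norm_smul, hz'])
    rw [charForm_smul, inv_pow, le_inv_mul_iff₀ (by positivity)] at h1
    linarith

theorem continuous_gaussianChar (V : Matrix (Quad n) (Quad n) ℝ) (d : Quad n → ℝ) :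
    Continuous (gaussianChar V d) := by
  have h1 := continuous_charForm V
  have h2 : Continuous (realVec : (Fin n → ℂ) → Quad n → ℝ) := continuous_pi continuous_realVec
  have h3 : Continuous (charPhase d) := by
    unfold charPhase
    exact continuous_const.mul (continuous_const.dotProduct h2)
  change Continuous fun z => Complex.exp (((-(1 / 2) * charForm V z : ℝ) : ℂ) -
    Complex.I * (charPhase d z : ℂ))
  fun_prop

theorem QuadBounded.integrable_mul_gaussianChar {G : (Fin n → ℂ) → ℂ} (hG : QuadBounded G)
    {V : Matrix (Quad n) (Quad n) ℝ} (hV : ∀ z : Fin n → ℂ, z ≠ 0 → 0 < charForm V z)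
    (d : Quad n → ℝ) : Integrable fun z => G z * gaussianChar V d z := by
  obtain ⟨δ, hδ, h⟩ := exists_le_charForm hV
  refine (hG.integrable (half_pos hδ)).mono
    (hG.1.mul (continuous_gaussianChar V d)).aestronglyMeasurable (Eventually.of_forall fun z => ?_)
  rw [norm_mul, norm_mul, norm_gaussianChar, Complex.norm_real,
    Real.norm_of_nonneg (weight_pos _ z).le, mul_comm]
  refine mul_le_mul_of_nonneg_right (Real.exp_le_exp.mpr ?_) (norm_nonneg _)
  linarith [h z]

theorem quadBounded_affine_mul_affine (a b : Quad n → ℂ) (k l : ℂ) :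
    QuadBounded fun z => (k + a ⬝ᵥ cvec z) * (l + b ⬝ᵥ cvec z) := by
  have hc : Continuous (cvec : (Fin n → ℂ) → Quad n → ℂ) :=
    continuous_pi fun q => Complex.continuous_ofReal.comp (continuous_realVec q)
  have hb : ∀ (a : Quad n → ℂ) (k : ℂ) (z : Fin n → ℂ), ‖k + a ⬝ᵥ cvec z‖ ≤
      (‖k‖ + ∑ q, ‖a q‖) * (1 + ‖z‖) := fun a k z => by
    have h1 : ‖a ⬝ᵥ cvec z‖ ≤ (∑ q, ‖a q‖) * ‖z‖ := by
      rw [dotProduct, Finset.sum_mul]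
      refine (norm_sum_le _ _).trans (Finset.sum_le_sum fun q _ => ?_)
      rw [norm_mul]
      refine mul_le_mul_of_nonneg_left ?_ (norm_nonneg _)
      rw [cvec, Complex.norm_real, realVec]
      refine le_trans ?_ (norm_le_pi_norm z q.1)
      split_ifs
      · exact Complex.abs_re_le_norm _
      · exact Complex.abs_im_le_norm _
    have h2 : 0 ≤ ∑ q, ‖a q‖ := Finset.sum_nonneg fun _ _ => norm_nonneg _
    refine (norm_add_le _ _).trans ?_
    nlinarith [norm_nonneg k, norm_nonneg z, mul_nonneg (norm_nonneg k) (norm_nonneg z)]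
  refine ⟨(continuous_const.add (continuous_const.dotProduct hc)).mul
    (continuous_const.add (continuous_const.dotProduct hc)),
    2 * ((‖k‖ + ∑ q, ‖a q‖) * (‖l‖ + ∑ q, ‖b q‖)), fun z => ?_⟩
  have hz : ‖z‖ ^ 2 ≤ ∑ j, ‖z j‖ ^ 2 := by
    have h0 : 0 ≤ ∑ j, ‖z j‖ ^ 2 := Finset.sum_nonneg fun _ _ => sq_nonneg _
    have h1 : ‖z‖ ≤ Real.sqrt (∑ j, ‖z j‖ ^ 2) := by
      rw [pi_norm_le_iff_of_nonneg (Real.sqrt_nonneg _)]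
      intro j
      refine Real.le_sqrt_of_sq_le ?_
      exact Finset.single_le_sum (f := fun j => ‖z j‖ ^ 2) (fun _ _ => sq_nonneg _)
        (Finset.mem_univ j)
    exact (pow_le_pow_left₀ (norm_nonneg z) h1 2).trans_eq (Real.sq_sqrt h0)
  have ha0 : 0 ≤ ‖k‖ + ∑ q, ‖a q‖ :=
    add_nonneg (norm_nonneg k) (Finset.sum_nonneg fun _ _ => norm_nonneg _)
  have hb0 : 0 ≤ ‖l‖ + ∑ q, ‖b q‖ :=
    add_nonneg (norm_nonneg l) (Finset.sum_nonneg fun _ _ => norm_nonneg _)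
  rw [norm_mul]
  calc _ ≤ ((‖k‖ + ∑ q, ‖a q‖) * (1 + ‖z‖)) * ((‖l‖ + ∑ q, ‖b q‖) * (1 + ‖z‖)) :=
        mul_le_mul (hb a k z) (hb b l z) (norm_nonneg _)
          (mul_nonneg ha0 (by positivity))
    _ = ((‖k‖ + ∑ q, ‖a q‖) * (‖l‖ + ∑ q, ‖b q‖)) * (1 + ‖z‖) ^ 2 := by ring
    _ ≤ ((‖k‖ + ∑ q, ‖a q‖) * (‖l‖ + ∑ q, ‖b q‖)) * (2 * (1 + ∑ j, ‖z j‖ ^ 2)) := by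
        refine mul_le_mul_of_nonneg_left ?_ (mul_nonneg ha0 hb0)
        nlinarith [sq_nonneg (1 - ‖z‖)]
    _ = _ := by ring

theorem quadBounded_charFactor (s : PhotonProcess) (c : Fin n → ℂ)
    (V : Matrix (Quad n) (Quad n) ℝ) (d : Quad n → ℝ) : QuadBounded (charFactor s c V d) := by
  have hg : ∀ m : Quad n → ℂ, ∃ (k : ℂ) (a : Quad n → ℂ), ∀ z,
      m ⬝ᵥ betaVec s V d z = k + a ⬝ᵥ cvec z := fun m => by
    refine ⟨m ⬝ᵥ (-(Complex.I • fun q => ((Omega n *ᵥ d) q : ℂ))),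
      (((Real.sqrt 2 : ℝ) : ℂ) / 2) • (m ᵥ* (toC (Omega n * V * Omega n) - s.sign • 1)),
      fun z => ?_⟩
    rw [betaVec, Umat_conjTranspose_mulVec_Zvec, Matrix.mulVec_smul, smul_dotProduct,
      ← Matrix.dotProduct_mulVec]
    simp only [dotProduct_sub, dotProduct_neg, dotProduct_smul, smul_eq_mul]
    ring
  obtain ⟨k, a, hk⟩ := hg (mVec c)
  obtain ⟨l, b, hl⟩ := hg (mVecBar c)
  have h1 := (quadBounded_affine_mul_affine a b k l).const_mul (-1)
  have h2 : QuadBounded fun _ : Fin n → ℂ =>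
      (1 / 2) * (mVecBar c ⬝ᵥ (toC V *ᵥ mVec c)) + s.sign * (1 / 2) :=
    QuadBounded.of_bounded continuous_const fun _ => le_rfl
  have h3 := h2.add h1
  have h4 : charFactor s c V d = fun z =>
      (1 / 2) * (mVecBar c ⬝ᵥ (toC V *ᵥ mVec c)) + s.sign * (1 / 2) +
        -1 * ((k + a ⬝ᵥ cvec z) * (l + b ⬝ᵥ cvec z)) := by
    funext z
    rw [charFactor, dotProduct_comm (betaVec s V d z), hk, hl]
    ring
  rw [h4]
  exact h3

/-! ### The Wigner function of a Gaussian state -/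

open scoped MatrixOrder in
theorem exists_eq_transpose_mul_self {V : Matrix (Quad n) (Quad n) ℝ} (hV : V.PosDef) :
    ∃ B : Matrix (Quad n) (Quad n) ℝ, V = Bᵀ * B := by
  obtain ⟨B, hB⟩ := CStarAlgebra.nonneg_iff_eq_star_mul_self.mp hV.posSemidef.nonneg
  exact ⟨B, by rw [hB, Matrix.star_eq_conjTranspose, Matrix.conjTranspose_eq_transpose_of_trivial]⟩

/-- The real linear map `z ↦ B Ωᵀ ξ`, with `ξ` the real vector of `z`. -/
def quadMap (B : Matrix (Quad n) (Quad n) ℝ) : (Fin n → ℂ) →ₗ[ℝ] (Quad n → ℝ) where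
  toFun z := B *ᵥ ((Omega n)ᵀ *ᵥ realVec z)
  map_add' z w := by rw [realVec_add, Matrix.mulVec_add, Matrix.mulVec_add]
  map_smul' t z := by rw [realVec_smul, Matrix.mulVec_smul, Matrix.mulVec_smul]; rfl

theorem quadMap_apply (B : Matrix (Quad n) (Quad n) ℝ) (z : Fin n → ℂ) :
    quadMap B z = B *ᵥ ((Omega n)ᵀ *ᵥ realVec z) := rfl

theorem charForm_eq_quadMap (B : Matrix (Quad n) (Quad n) ℝ) (z : Fin n → ℂ) :
    charForm (Bᵀ * B) z = quadMap B z ⬝ᵥ quadMap B z := by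
  rw [charForm, quadMap_apply, ← Matrix.mulVec_mulVec, ← Matrix.mulVec_mulVec,
    ← Matrix.mulVec_mulVec, Matrix.dotProduct_mulVec, ← Matrix.mulVec_transpose,
    Matrix.dotProduct_mulVec, ← Matrix.mulVec_transpose, Matrix.transpose_transpose]

theorem finrank_modes : Module.finrank ℝ (Fin n → ℂ) = Module.finrank ℝ (Quad n → ℝ) := by
  rw [Module.finrank_pi_fintype, Module.finrank_fintype_fun_eq_card]
  simp [Complex.finrank_real_complex]

/-- Uniqueness of Haar measure replaces the Jacobian. Its value is irrelevant, as it multiplies `W`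
by a constant. -/
theorem exists_integral_comp_quadMap {B : Matrix (Quad n) (Quad n) ℝ}
    (hB : ∀ z : Fin n → ℂ, z ≠ 0 → 0 < charForm (Bᵀ * B) z) :
    ∃ k : ℂ, ∀ g : (Quad n → ℝ) → ℂ, ∫ z : Fin n → ℂ, g (quadMap B z) = k * ∫ y, g y := by
  have hinj : Function.Injective (quadMap B) := by
    rw [injective_iff_map_eq_zero]
    intro z hz
    by_contra h
    have := hB z h
    rw [charForm_eq_quadMap, hz, dotProduct_zero] at this
    exact lt_irrefl _ this
  set L := ((quadMap B).linearEquivOfInjective hinj finrank_modes).toContinuousLinearEquiv with hL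
  have hLz : ∀ z, L z = quadMap B z := fun z => rfl
  have hmap : (Measure.map L (volume : Measure (Fin n → ℂ))).IsAddHaarMeasure :=
    L.isAddHaarMeasure_map _
  refine ⟨(((Measure.map L volume).addHaarScalarFactor (volume : Measure (Quad n → ℝ)) : ℝ) : ℂ),
    fun g => ?_⟩
  have h1 := Measure.isAddLeftInvariant_eq_smul (Measure.map L (volume : Measure (Fin n → ℂ)))
    (volume : Measure (Quad n → ℝ))
  have h2 : ∫ y, g y ∂(Measure.map L volume) = ∫ z, g (L z) :=
    (L.toHomeomorph.measurableEmbedding).integral_map g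
  simp only [← hLz]
  rw [← h2]
  conv_lhs => rw [h1]
  rw [integral_smul_nnreal_measure, NNReal.smul_def, Complex.real_smul]

theorem realVec_alphaOf (r : Quad n → ℝ) :
    (Real.sqrt 2) • realVec (alphaOf r) = r := by
  have h : Real.sqrt 2 ≠ 0 := by simp
  funext ⟨j, i⟩
  have h1 : alphaOf r j = (((Real.sqrt 2)⁻¹ : ℝ) : ℂ) *
      ((r (j, 0) : ℂ) + Complex.I * (r (j, 1) : ℂ)) := by
    rw [alphaOf, Complex.ofReal_inv]
  fin_cases i
  · simp [realVec, h1, -Complex.ofReal_inv]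
  · simp [realVec, h1, -Complex.ofReal_inv]

theorem phase_eq_exp (α z : Fin n → ℂ) : phase α z = Complex.exp
    (Complex.I * ((2 * ((Omega n *ᵥ realVec α) ⬝ᵥ realVec z) : ℝ) : ℂ)) := by
  rw [phase, dotProduct, Fintype.sum_prod_type]
  congr 1
  rw [Finset.mul_sum, Complex.ofReal_sum, Finset.mul_sum]
  refine Finset.sum_congr rfl fun j _ => ?_
  rw [Fin.sum_univ_two, Omega_mulVec_zero, Omega_mulVec_one]
  apply Complex.ext <;> simp [realVec]
  ring

/-- In the coordinates `y = BΩᵀξ` the quadratic form is `|y|²`. The linear form, of vector `Ω(√2 ξ_α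
- d)`, is a pairing with `y` through `BV⁻¹`, because `BᵀBV⁻¹ = 1`. -/
theorem charFn_mul_phase {V B : Matrix (Quad n) (Quad n) ℝ} (hV : IsUnit V.det)
    (hVB : V = Bᵀ * B) (d : Quad n → ℝ) (α z : Fin n → ℂ) :
    gaussianChar V d z * phase α z = Complex.exp (-(1 / 2 : ℂ) * ∑ q, (quadMap B z q : ℂ) ^ 2 +
      ∑ q, (Complex.I * ((Real.sqrt 2 * (B *ᵥ (V⁻¹ *ᵥ (Real.sqrt 2 • realVec α - d))) q : ℝ) : ℂ)) *
        (quadMap B z q : ℂ)) := by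
  have hlin : (B *ᵥ (V⁻¹ *ᵥ (Real.sqrt 2 • realVec α - d))) ⬝ᵥ quadMap B z =
      (Omega n *ᵥ (Real.sqrt 2 • realVec α - d)) ⬝ᵥ realVec z := by
    rw [quadMap_apply, dotProduct_comm, Matrix.dotProduct_mulVec, ← Matrix.mulVec_transpose,
      Matrix.mulVec_mulVec, ← hVB, dotProduct_comm, Matrix.dotProduct_mulVec,
      ← Matrix.mulVec_transpose]
    have hVt : Vᵀ = V := by rw [hVB, Matrix.transpose_mul, Matrix.transpose_transpose]
    rw [hVt, Matrix.mulVec_mulVec, Matrix.mul_nonsing_inv _ hV, Matrix.one_mulVec,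
      Matrix.dotProduct_mulVec, ← Matrix.mulVec_transpose, Matrix.transpose_transpose]
  have hq : charForm V z = ∑ q, quadMap B z q ^ 2 := by
    rw [hVB, charForm_eq_quadMap, dotProduct]
    simp only [sq]
  have h2 : Real.sqrt 2 * Real.sqrt 2 = 2 := Real.mul_self_sqrt (by norm_num)
  rw [gaussianChar, ← charForm, hq, phase_eq_exp, ← Complex.exp_add]
  congr 1
  have hl : Real.sqrt 2 * ((B *ᵥ (V⁻¹ *ᵥ (Real.sqrt 2 • realVec α - d))) ⬝ᵥ quadMap B z) =
      2 * ((Omega n *ᵥ realVec α) ⬝ᵥ realVec z) -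
        Real.sqrt 2 * ((Omega n *ᵥ d) ⬝ᵥ realVec z) := by
    rw [hlin, Matrix.mulVec_sub, Matrix.mulVec_smul, sub_dotProduct, smul_dotProduct, smul_eq_mul,
      mul_sub, ← mul_assoc, h2]
  have hs : ∑ q, (Complex.I * ((Real.sqrt 2 *
      (B *ᵥ (V⁻¹ *ᵥ (Real.sqrt 2 • realVec α - d))) q : ℝ) : ℂ)) * (quadMap B z q : ℂ) =
      Complex.I * ((Real.sqrt 2 *
        ((B *ᵥ (V⁻¹ *ᵥ (Real.sqrt 2 • realVec α - d))) ⬝ᵥ quadMap B z) : ℝ) : ℂ) := by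
    rw [dotProduct, Finset.mul_sum, Complex.ofReal_sum, Finset.mul_sum]
    refine Finset.sum_congr rfl fun q _ => ?_
    push_cast
    ring
  rw [hs, hl]
  push_cast
  ring

theorem exists_wigner_eq {ρ : FockSpace n →L[ℂ] FockSpace n} {V : Matrix (Quad n) (Quad n) ℝ}
    {d : Quad n → ℝ} (hG : ∀ z, charFn ρ z = gaussianChar V d z) (hV : V.PosDef)
    (hpos : ∀ z : Fin n → ℂ, z ≠ 0 → 0 < charForm V z) (hint : Integrable (charFn ρ)) :
    ∃ K : ℂ, ∀ α, wigner ρ α = K * Complex.exp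
      (-(((Real.sqrt 2 • realVec α - d) ⬝ᵥ (V⁻¹ *ᵥ (Real.sqrt 2 • realVec α - d)) : ℝ) : ℂ)) := by
  obtain ⟨B, hVB⟩ := exists_eq_transpose_mul_self hV
  have hdet : IsUnit V.det := hV.det_pos.ne'.isUnit
  obtain ⟨k, hk⟩ := exists_integral_comp_quadMap (B := B) (by rwa [← hVB])
  refine ⟨(((Real.pi ^ 2) ^ n : ℝ) : ℂ)⁻¹ *
    (k * (Real.pi / (1 / 2 : ℂ)) ^ (Fintype.card (Quad n) / 2 : ℂ)), fun α => ?_⟩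
  rw [wigner_eq_integral ρ hint]
  simp only [hG, charFn_mul_phase hdet hVB]
  rw [hk fun y => Complex.exp (-(1 / 2 : ℂ) * ∑ q, (y q : ℂ) ^ 2 +
      ∑ q, (Complex.I * ((Real.sqrt 2 * (B *ᵥ (V⁻¹ *ᵥ (Real.sqrt 2 • realVec α - d))) q : ℝ) : ℂ)) *
        (y q : ℂ)),
    GaussianFourier.integral_cexp_neg_mul_sum_add (by norm_num)]
  set w := Real.sqrt 2 • realVec α - d with hw
  have h2 : Real.sqrt 2 * Real.sqrt 2 = 2 := Real.mul_self_sqrt (by norm_num)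
  have hu : (B *ᵥ (V⁻¹ *ᵥ w)) ⬝ᵥ (B *ᵥ (V⁻¹ *ᵥ w)) = w ⬝ᵥ (V⁻¹ *ᵥ w) := by
    rw [Matrix.dotProduct_mulVec, ← Matrix.mulVec_transpose, Matrix.mulVec_mulVec, ← hVB,
      Matrix.mulVec_mulVec, Matrix.mul_nonsing_inv _ hdet, Matrix.one_mulVec]
  have hexp : (∑ q, (Complex.I * ((Real.sqrt 2 * (B *ᵥ (V⁻¹ *ᵥ w)) q : ℝ) : ℂ)) ^ 2) /
      (4 * (1 / 2 : ℂ)) = -((w ⬝ᵥ (V⁻¹ *ᵥ w) : ℝ) : ℂ) := by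
    rw [← hu, dotProduct, Complex.ofReal_sum, Finset.sum_div, ← Finset.sum_neg_distrib]
    refine Finset.sum_congr rfl fun q _ => ?_
    rw [mul_pow, Complex.I_sq, ← Complex.ofReal_pow, mul_pow, sq (Real.sqrt 2), h2]
    push_cast
    ring
  rw [hexp]
  ring

/-- Expanding the square at `√2 ξ - d` gives `-2 ξᵀV⁻¹ξ + 2√2 (V⁻¹d)ᵀξ`; the normalization `-1/2` in
`quadExp` explains the `4`, and the term in `d` alone goes into `K`. -/
theorem exists_wigner_eq_quadExp {ρ : FockSpace n →L[ℂ] FockSpace n}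
    {V : Matrix (Quad n) (Quad n) ℝ} {d : Quad n → ℝ}
    (hG : ∀ z, charFn ρ z = gaussianChar V d z) (hV : V.PosDef)
    (hpos : ∀ z : Fin n → ℂ, z ≠ 0 → 0 < charForm V z) (hint : Integrable (charFn ρ)) :
    ∃ K : ℂ, wigner ρ = quadExp K ((4 : ℂ) • toC V⁻¹)
      ((2 * ((Real.sqrt 2 : ℝ) : ℂ)) • (toC V⁻¹ *ᵥ fun q => (d q : ℂ))) := by
  obtain ⟨K, hK⟩ := exists_wigner_eq hG hV hpos hint
  have hVt : (V⁻¹)ᵀ = V⁻¹ := by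
    rw [Matrix.transpose_nonsing_inv]
    congr 1
    have := hV.isHermitian
    rwa [Matrix.IsHermitian, Matrix.conjTranspose_eq_transpose_of_trivial] at this
  refine ⟨K * Complex.exp (-((d ⬝ᵥ (V⁻¹ *ᵥ d) : ℝ) : ℂ)), funext fun α => ?_⟩
  have h2 : Real.sqrt 2 * Real.sqrt 2 = 2 := Real.mul_self_sqrt (by norm_num)
  have hcomm : realVec α ⬝ᵥ (V⁻¹ *ᵥ d) = d ⬝ᵥ (V⁻¹ *ᵥ realVec α) := by
    rw [Matrix.dotProduct_mulVec, ← Matrix.mulVec_transpose, hVt, dotProduct_comm]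
  have hz : cvec α = fun q => (realVec α q : ℂ) := rfl
  have hreal : (Real.sqrt 2 • realVec α - d) ⬝ᵥ (V⁻¹ *ᵥ (Real.sqrt 2 • realVec α - d)) =
      2 * (realVec α ⬝ᵥ (V⁻¹ *ᵥ realVec α)) -
        2 * Real.sqrt 2 * ((V⁻¹ *ᵥ d) ⬝ᵥ realVec α) + d ⬝ᵥ (V⁻¹ *ᵥ d) := by
    simp only [Matrix.mulVec_sub, Matrix.mulVec_smul, dotProduct_sub, sub_dotProduct,
      smul_dotProduct, dotProduct_smul, smul_eq_mul, ← hcomm, dotProduct_comm (V⁻¹ *ᵥ d)]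
    linear_combination (realVec α ⬝ᵥ (V⁻¹ *ᵥ realVec α)) * h2
  rw [hK, quadExp, mul_assoc, ← Complex.exp_add, hreal, hz, Matrix.smul_mulVec, dotProduct_smul,
    smul_dotProduct, toC_mulVec, toC_mulVec, ← ofReal_dotProduct, ← ofReal_dotProduct]
  congr 2
  simp only [smul_eq_mul]
  push_cast
  ring

/-! ### The phase-space operators on the Gaussian Wigner function -/

theorem wignerOpBar_quadExp (s : PhotonProcess) {K : ℂ} {M : Matrix (Quad n) (Quad n) ℂ}
    (hM : Mᵀ = M) (b : Quad n → ℂ) (c : Fin n → ℂ) :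
    wignerOpBar s c (quadExp K M b) =
      fun z => (mVecBar c ⬝ᵥ gammaVec (1 / 2) s.sign M b z) * quadExp K M b z := by
  funext z
  rw [← dzbar_quadExp hM, wignerOpBar]
  ring

theorem wignerOp_wignerOpBar_quadExp (s : PhotonProcess) {K : ℂ}
    {M : Matrix (Quad n) (Quad n) ℂ} (hM : Mᵀ = M) (b : Quad n → ℂ) {c : Fin n → ℂ}
    (hc : ∑ j, ‖c j‖ ^ 2 = 1) (z : Fin n → ℂ) :
    wignerOp s c (wignerOpBar s c (quadExp K M b)) z =
      (-(1 / 8) * (mVecBar c ⬝ᵥ (M *ᵥ mVec c)) - s.sign / 2 +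
        (gammaVec (1 / 2) s.sign M b z ⬝ᵥ mVec c) *
          (mVecBar c ⬝ᵥ gammaVec (1 / 2) s.sign M b z)) * quadExp K M b z := by
  rw [wignerOpBar_quadExp s hM]
  have h := dz_gamma_mul_quadExp (K := K) (b := b) hM (1 / 2) s.sign hc z
  rw [wignerOp, div_eq_inv_mul, ← one_div, h]
  ring

/-- The sign is harmless, because this vector enters the final formula twice. -/
theorem gammaVec_eq_neg_lambdaVec (s : PhotonProcess) (V : Matrix (Quad n) (Quad n) ℝ)
    (d r : Quad n → ℝ) :
    gammaVec (1 / 2) s.sign ((4 : ℂ) • toC V⁻¹)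
      ((2 * ((Real.sqrt 2 : ℝ) : ℂ)) • (toC V⁻¹ *ᵥ fun q => (d q : ℂ))) (alphaOf r) =
      -lambdaVec s V d r := by
  have h0 := ofReal_sqrt_two_ne_zero
  have h2 := ofReal_sqrt_two_mul_self
  have hr : (fun q => (r q : ℂ)) = ((Real.sqrt 2 : ℝ) : ℂ) • cvec (alphaOf r) := by
    funext q
    conv_lhs => rw [← realVec_alphaOf r]
    simp [cvec]
  rw [gammaVec, lambdaVec, hr, Matrix.add_mulVec, Matrix.mulVec_smul, Matrix.smul_mulVec,
    Matrix.smul_mulVec, Matrix.one_mulVec]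
  funext q
  simp only [Pi.sub_apply, Pi.add_apply, Pi.smul_apply, Pi.neg_apply, smul_eq_mul]
  field_simp
  linear_combination (2 * (toC V⁻¹ *ᵥ cvec (alphaOf r)) q) * h2

theorem wignerOp_wignerOpBar_gaussian (s : PhotonProcess) {V : Matrix (Quad n) (Quad n) ℝ}
    (hV : Vᵀ = V) (K : ℂ) (d r : Quad n → ℝ) {c : Fin n → ℂ} (hc : ∑ j, ‖c j‖ ^ 2 = 1)
    {W : (Fin n → ℂ) → ℂ} (hW : W = quadExp K ((4 : ℂ) • toC V⁻¹)
      ((2 * ((Real.sqrt 2 : ℝ) : ℂ)) • (toC V⁻¹ *ᵥ fun q => (d q : ℂ)))) :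
    wignerOp s c (wignerOpBar s c W) (alphaOf r) = wignerFactor s c V d r * W (alphaOf r) := by
  have hM : ((4 : ℂ) • toC V⁻¹)ᵀ = (4 : ℂ) • toC V⁻¹ := by
    rw [Matrix.transpose_smul, toC_transpose, Matrix.transpose_nonsing_inv, hV]
  rw [hW, wignerOp_wignerOpBar_quadExp s hM _ hc, gammaVec_eq_neg_lambdaVec, wignerFactor, Mconst,
    Matrix.smul_mulVec, dotProduct_smul, neg_dotProduct, dotProduct_neg, smul_eq_mul]
  ring

theorem processed_of_isGaussian (s : PhotonProcess) (c : Fin n → ℂ) (hc : ∑ j, ‖c j‖ ^ 2 = 1)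
    (ρ : FockSpace n →L[ℂ] FockSpace n) (hρ : IsDensityOperator ρ)
    (hs : s = PhotonProcess.subtraction → processTrace s c ρ ≠ 0) (hG : IsGaussian ρ) :
    processTrace s c ρ ≠ ∞ ∧ IsUnit (covarianceMatrix ρ).det ∧ Integrable (charFn ρ) ∧
      ∀ σ, IsProcessed s c ρ σ → Integrable (charFn σ) ∧
        (∀ z, charFn σ z = (normConst s c ρ : ℂ) *
          charFactor s c (covarianceMatrix ρ) (displacementVector ρ) z * charFn ρ z) ∧
        (∀ r : Quad n → ℝ, wigner σ (alphaOf r) = (normConst s c ρ : ℂ) *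
          wignerFactor s c (covarianceMatrix ρ) (displacementVector ρ) r *
            wigner ρ (alphaOf r)) := by
  obtain ⟨ψ, hψ⟩ := hρ.exists_mixture
  have hfin := hψ.processTrace_ne_top_of_isGaussian hρ hG s c
  have hV := hψ.posDef_covarianceMatrix hρ hG
  have hpos : ∀ z : Fin n → ℂ, z ≠ 0 → 0 < charForm (covarianceMatrix ρ) z :=
    fun z hz => hψ.charForm_pos hρ hG hz
  have hχ : charFn ρ = gaussianChar (covarianceMatrix ρ) (displacementVector ρ) := funext hG
  have hint : Integrable (charFn ρ) := by
    have h := (QuadBounded.of_bounded (n := n) (continuous_const (y := (1 : ℂ)))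
      fun _ => le_rfl).integrable_mul_gaussianChar hpos (displacementVector ρ)
    simpa only [one_mul, ← hχ] using h
  have hsym := covarianceMatrix_transpose ρ
  have hfactor := quadBounded_charFactor s c (covarianceMatrix ρ) (displacementVector ρ)
  obtain ⟨K, hK⟩ := exists_wigner_eq_quadExp hG hV hpos hint
  refine ⟨hfin, hV.det_pos.ne'.isUnit, hint, fun σ hσ => ?_⟩
  -- With the trace finite, the general differential formulas hold; only their evaluation on a
  -- Gaussian is left.
  obtain ⟨-, -, -, hcharσ, -, -, -, -, hwigσ⟩ :=
    (processed_of_ne_top s c hc ρ hρ hs hfin).2 σ hσ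
  have hchar : ∀ z, charFn σ z = (normConst s c ρ : ℂ) *
      charFactor s c (covarianceMatrix ρ) (displacementVector ρ) z * charFn ρ z := fun z => by
    rw [hcharσ, hχ, mul_assoc, ← neg_charOp_charOpBar_gaussianChar s hsym _ hc]
    ring
  refine ⟨?_, hchar, fun r => ?_⟩
  · have h := (hfactor.const_mul (normConst s c ρ : ℂ)).integrable_mul_gaussianChar hpos
      (displacementVector ρ)
    rw [funext hchar, hχ]
    exact h
  · rw [hwigσ, wignerOp_wignerOpBar_gaussian s hsym K _ r hc hK, mul_assoc]

end PhotonGaussian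

end

theorem mainTheorem3 {n : ℕ} (s : PhotonGaussian.PhotonProcess) (c : Fin n → ℂ)
    (hc : ∑ j, ‖c j‖ ^ 2 = 1)
    (ρ : PhotonGaussian.FockSpace n →L[ℂ] PhotonGaussian.FockSpace n)
    (hρ : PhotonGaussian.IsDensityOperator ρ)
    (hs : s = PhotonGaussian.PhotonProcess.subtraction →
      PhotonGaussian.processTrace s c ρ ≠ 0) :
    -- an arbitrary mother state for which the trace defining the normalization is finite
    (PhotonGaussian.processTrace s c ρ ≠ ∞ →
      (∃! σ, PhotonGaussian.IsProcessed s c ρ σ) ∧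
      ∀ σ, PhotonGaussian.IsProcessed s c ρ σ →
        PhotonGaussian.IsDensityOperator σ ∧
        -- the characteristic function
        PhotonGaussian.DirDifferentiable c (PhotonGaussian.charFn ρ) ∧
        PhotonGaussian.DirDifferentiable c
          (PhotonGaussian.charOpBar s c (PhotonGaussian.charFn ρ)) ∧
        (∀ z, PhotonGaussian.charFn σ z = -(PhotonGaussian.normConst s c ρ : ℂ) *
          PhotonGaussian.charOp s c
            (PhotonGaussian.charOpBar s c (PhotonGaussian.charFn ρ)) z) ∧
        -- the Wigner function
        (∀ α, Tendsto (fun ε => PhotonGaussian.regFourier (PhotonGaussian.charFn ρ) ε α)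
          (𝓝[>] 0) (𝓝 (PhotonGaussian.wigner ρ α))) ∧
        (∀ α, Tendsto (fun ε => PhotonGaussian.regFourier (PhotonGaussian.charFn σ) ε α)
          (𝓝[>] 0) (𝓝 (PhotonGaussian.wigner σ α))) ∧
        PhotonGaussian.DirDifferentiable c (PhotonGaussian.wigner ρ) ∧
        PhotonGaussian.DirDifferentiable c
          (PhotonGaussian.wignerOpBar s c (PhotonGaussian.wigner ρ)) ∧
        (∀ α, PhotonGaussian.wigner σ α = (PhotonGaussian.normConst s c ρ : ℂ) *
          PhotonGaussian.wignerOp s c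
            (PhotonGaussian.wignerOpBar s c (PhotonGaussian.wigner ρ)) α)) ∧
    -- a Gaussian mother state
    (PhotonGaussian.IsGaussian ρ →
      PhotonGaussian.processTrace s c ρ ≠ ∞ ∧
      IsUnit (PhotonGaussian.covarianceMatrix ρ).det ∧
      Integrable (PhotonGaussian.charFn ρ) ∧
      ∀ σ, PhotonGaussian.IsProcessed s c ρ σ →
        Integrable (PhotonGaussian.charFn σ) ∧
        (∀ z, PhotonGaussian.charFn σ z = (PhotonGaussian.normConst s c ρ : ℂ) *
          PhotonGaussian.charFactor s c (PhotonGaussian.covarianceMatrix ρ)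
            (PhotonGaussian.displacementVector ρ) z * PhotonGaussian.charFn ρ z) ∧
        (∀ r : PhotonGaussian.Quad n → ℝ,
          PhotonGaussian.wigner σ (PhotonGaussian.alphaOf r) =
            (PhotonGaussian.normConst s c ρ : ℂ) *
            PhotonGaussian.wignerFactor s c (PhotonGaussian.covarianceMatrix ρ)
              (PhotonGaussian.displacementVector ρ) r *
            PhotonGaussian.wigner ρ (PhotonGaussian.alphaOf r))) := by
  exact ⟨fun hfin => PhotonGaussian.processed_of_ne_top s c hc ρ hρ hs hfin,
    fun hG => PhotonGaussian.processed_of_isGaussian s c hc ρ hρ hs hG⟩
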